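/- **Setting.** Let $d\ge 1$, let $\mathcal N$ be a $d$-dimensional boundary portion, given as an arbitrary open subset of a $d$-dimensional real vector space, and let $\mathcal N\times[0,b)$ be the neighbourhood of $\mathcal N$ in spacetime obtained from a rigging vector field $v$: $\Phi$ is the second coordinate, $v=\partial/\partial\Phi$, and $\pi_\upsilon(x)=(x,\upsilon)$; the boundary is $\Phi=0$. Put $D=\mathcal N\times(0,b)$ and fix $\upsilon_0\in(0,b)$. Fields $\phi$ are smooth tensor fields on $D$ (sections of a natural bundle given by a finite-dimensional representation of $\mathfrak{gl}_{d+1}$) with values in a given open set; variations $\delta\phi$ are arbitrary smooth tensor fields of the same type. Let $L'[\phi]$ (a $(d+1)$-form) and $\theta'[\phi;\delta\phi]$ (a $d$-form, linear in $\delta\phi$) be smooth local functionals on $D$, with $\delta L'=E\cdot\delta\phi+d\theta'$; no regularity at $\Phi=0$ is assumed. On field space, $\delta$ is the exterior derivative and $I$ is contraction; for a possibly field-dependent vector field $\xi$ on spacetime, $\hat\xi$ is the vector field on field space with $I_{\hat\xi}\delta\phi=\pounds_\xi\phi$, $L_{\hat\xi}=I_{\hat\xi}\delta+\delta I_{\hat\xi}$,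 $I_{\widehat{\delta\xi}}$ replaces $\delta\phi$ by $\pounds_{\delta\xi}\phi$, and the anomaly operator is $\Delta_{\hat\xi}=L_{\hat\xi}-\pounds_\xi-I_{\widehat{\delta\xi}}$. Assume that $L'$ and $\theta'$ are covariant, i.e. $\Delta_{\hat\xi}L'=0$ and $\Delta_{\hat\xi}\theta'=0$ for field-independent $\xi$. Define $B$ and $\Lambda$ by $$i_vB=0,\quad \pi_\upsilon^*B=\int_\upsilon^{\upsilon_0}\pi_s^*i_vL'\,ds,\qquad i_v\Lambda=0,\quad \pi_\upsilon^*\Lambda=-\int_\upsilon^{\upsilon_0}\pi_s^*i_v\theta'\,ds,$$ and $L'_{\rm ren}=L'+dB$, $\theta'_{\rm ren}=\theta'+\delta B-d\Lambda$. For a vector field $\xi$ define $\kappa_\xi,\mu_\xi$ by $i_v\kappa_\xi=0$, $i_v\mu_\xi=0$, $$\pi_\upsilon^*\kappa_\xi=\int_\upsilon^{\upsilon_0}\pi_s^*i_\xi i_vL'\,ds-i_{\pi_\upsilon^*\xi}\int_\upsilon^{\upsilon_0}\pi_s^*i_vL'\,ds,\qquad \pi_\upsilon^*\mu_\xi=\int_\upsilon^{\upsilon_0}\pi_s^*i_\xi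 i_v\theta'\,ds-i_{\pi_\upsilon^*\xi}\int_\upsilon^{\upsilon_0}\pi_s^*i_v\theta'\,ds,$$ where $\pi_\upsilon^*\xi$ is the part of $\xi$ tangent to $\Phi=\upsilon$ (forms of negative degree vanish), and $(\Delta_{\hat\xi}B)_{\rm fin}$, $(\Delta_{\hat\xi}\Lambda)_{\rm fin}$ by vanishing contraction with $v$ and $$\pi_\upsilon^*(\Delta_{\hat\xi}B)_{\rm fin}=\pi_{\upsilon_0}^*i_\xi L',\qquad \pi_\upsilon^*(\Delta_{\hat\xi}\Lambda)_{\rm fin}=-\pi_{\upsilon_0}^*\big[i_v\theta'\,\pounds_\xi\Phi\big]-i_{\pi_{\upsilon_0}^*\xi-\pi_\upsilon^*\xi}\,\pi_{\upsilon_0}^*\theta'.$$ **Claim.** All these forms are differentiable on $D$ and along variations, as needed for the derivatives below. (1) Let $\xi$ be a smooth local functional of $\phi$, possibly field-dependent, and let $\phi$ be a field for which $\xi$ is smooth up to the boundary $\Phi=0$ and tangent to it. Then $(\Delta_{\hat\xi}B)_{\rm fin}$ and $(\Delta_{\hat\xi}\Lambda)_{\rm fin}$ are smooth up to and including $\Phi=0$,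 and on $D$ $$\Delta_{\hat\xi}B=(\Delta_{\hat\xi}B)_{\rm fin}+d\kappa_\xi ;$$ if $\phi$ solves the field equations $E=0$, then moreover $$\Delta_{\hat\xi}\Lambda=(\Delta_{\hat\xi}\Lambda)_{\rm fin}+\delta\kappa_\xi-d\mu_\xi-\kappa_{\delta\xi}.$$ (2) Let $\xi$ be field-independent, smooth up to the boundary and tangent to it, and let $\phi$ be a solution. Then on $D$ $$\Delta_{\hat\xi}\Lambda=(\Delta_{\hat\xi}\Lambda)_{\rm fin}+\delta\kappa_\xi-d\mu_\xi-I_{\widehat{\delta\xi}}\Lambda$$ (where the last term is zero), and $$\Delta_{\hat\xi}L'_{\rm ren}=d(\Delta_{\hat\xi}B)_{\rm fin},\qquad \Delta_{\hat\xi}\theta'_{\rm ren}=\delta(\Delta_{\hat\xi}B)_{\rm fin}-d(\Delta_{\hat\xi}\Lambda)_{\rm fin}.$$ The pullback $\pi_\upsilon^*\theta'_{\rm ren}$ converges as $\upsilon\to0^+$ to a finite limit $\underline{\theta}'_{\rm ren}=\pi_{\upsilon_0}^*\theta'$ on $\mathcal N$, and $$\Delta_{\hat\xi}\underline{\theta}'_{\rm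 ren}=\lim_{\upsilon\to0^+}\pi_\upsilon^*\big(\Delta_{\hat\xi}\theta'_{\rm ren}\big)=\delta\,\pi_0^*(\Delta_{\hat\xi}B)_{\rm fin}-d\,\pi_0^*(\Delta_{\hat\xi}\Lambda)_{\rm fin},$$ where $\pi_0^*(\Delta_{\hat\xi}B)_{\rm fin}$, its variation and $\pi_0^*(\Delta_{\hat\xi}\Lambda)_{\rm fin}$ are smooth on $\mathcal N$. -/

import Mathlib

open Set Filter Topology
open scoped ContDiff

noncomputable section

namespace HoloRen

/-! ## Differential forms on (open subsets of) a normed space -/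

/-- Differential `k`-forms on `V`, as total functions; they are only used on open subsets. The
exterior derivative is Mathlib's `extDeriv`, the contraction `i_w` is `curryLeft w`. -/
abbrev Form (k : ℕ) (V : Type*) [NormedAddCommGroup V] [NormedSpace ℝ V] : Type _ :=
  V → V [⋀^Fin k]→L[ℝ] ℝ

section Forms

variable {V : Type*} [NormedAddCommGroup V] [NormedSpace ℝ V]

/-- Contraction `i_w a` in every degree: the contraction of a `0`-form vanishes. -/
def contr : {k : ℕ} → V → V [⋀^Fin k]→L[ℝ] ℝ → V [⋀^Fin (k - 1)]→L[ℝ] ℝ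
  | 0, _, _ => 0
  | _ + 1, w, a => a.curryLeft w

/-- The exterior derivative from degree `k - 1` to degree `k`; for `k = 0` there are no forms of
degree `-1`, and it vanishes. -/
def extDerivPred : {k : ℕ} → Form (k - 1) V → Form k V
  | 0, _ => 0
  | _ + 1, a => extDeriv a

/-- The Lie derivative of forms, `£_ξ a = i_ξ da + d i_ξ a`. -/
def lieForm {k : ℕ} (ξ : V → V) (a : Form k V) : Form k V := fun p =>
  (extDeriv a p).curryLeft (ξ p) + extDerivPred (fun q => contr (ξ q) (a q)) p

end Forms

/-! ## The collar of the boundary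

The rigging vector field `v` identifies a neighbourhood of the boundary `N` with `N × [0, b)`: the
point `π_υ x` is `(x, υ)`, `Φ` is the second coordinate, and `v = ∂/∂Φ`. -/

section Collar

variable {E : Type*} [NormedAddCommGroup E] [NormedSpace ℝ E]

/-- The interior `{0 < Φ < b}` of the collar. -/
def collar (N : Set E) (b : ℝ) : Set (E × ℝ) := N ×ˢ Ioo 0 b

/-- The collar `{0 ≤ Φ < b}` together with the boundary. -/
def closedCollar (N : Set E) (b : ℝ) : Set (E × ℝ) := N ×ˢ Ico 0 b

/-- The rigging vector `v`. -/
def rig : E × ℝ := (0, 1)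

/-- The pullback `π_υ^* a`, a form on `N`. -/
def pull {k : ℕ} (υ : ℝ) (a : Form k (E × ℝ)) : Form k E := fun x =>
  (a (x, υ)).compContinuousLinearMap (ContinuousLinearMap.inl ℝ E ℝ)

/-- The form `a` on the collar determined by `i_v a = 0` and `π_υ^* a = β υ`. -/
def lift {k : ℕ} (β : ℝ → Form k E) : Form k (E × ℝ) := fun p =>
  (β p.2 p.1).compContinuousLinearMap (ContinuousLinearMap.fst ℝ E ℝ)

theorem pull_lift {k : ℕ} (β : ℝ → Form k E) (υ : ℝ) : pull υ (lift β) = β υ := by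
  funext x
  ext w
  simp only [pull, lift, ContinuousAlternatingMap.compContinuousLinearMap_apply]
  congr 1

theorem curryLeft_rig_lift {k : ℕ} (β : ℝ → Form (k + 1) E) (p : E × ℝ) :
    (lift β p).curryLeft rig = 0 := by
  ext w
  rw [ContinuousAlternatingMap.curryLeft_apply_apply]
  simp only [lift, ContinuousAlternatingMap.compContinuousLinearMap_apply]
  exact (β p.2 p.1).map_coord_zero 0 (by simp [rig])

/-- The form `m` on the collar with `i_v m = 0` and
`π_υ^* m = ∫_υ^{υ₀} π_s^* (i_η i_v a) ds - i_{π_υ^* η} ∫_υ^{υ₀} π_s^* (i_v a) ds`,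
where `π_υ^* η` is the part of the vector field `η` tangent to the surface `Φ = υ`. -/
def kappaMu {k : ℕ} (υ₀ : ℝ) (η : E × ℝ → E × ℝ) (a : Form (k + 1) (E × ℝ)) :
    Form (k - 1) (E × ℝ) :=
  lift fun υ x =>
    (∫ s in υ..υ₀, pull s (fun p => contr (η p) ((a p).curryLeft rig)) x)
      - contr (η (x, υ)).1 (∫ s in υ..υ₀, pull s (fun p => (a p).curryLeft rig) x)

/-- A vector field on the collar which is smooth up to the boundary and tangent to it. -/
structure IsBoundaryVectorField (N : Set E) (b : ℝ) (ξ : E × ℝ → E × ℝ) : Prop where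
  smooth : ContDiffOn ℝ ∞ ξ (closedCollar N b)
  tangent : ∀ x ∈ N, (ξ (x, 0)).2 = 0

end Collar

/-! ## Calculus on field space

A field is a function `φ : V → W`; the admissible values form an open set `O ⊆ W` (for instance the
nondegenerate symmetric bilinear forms). A field-space `0`-form is a functional `F φ`, a field-space
`1`-form a functional `α φ Y`, linear in the variation `Y = δφ`; both take values in functions on a
space `S` (in the applications, differential forms on the collar or on the boundary). -/

section FieldSpace

variable {V W S Z : Type*} [NormedAddCommGroup V] [NormedSpace ℝ V]
  [NormedAddCommGroup W] [NormedSpace ℝ W] [NormedAddCommGroup Z] [NormedSpace ℝ Z]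

/-- A smooth field on the open set `U` with admissible values. -/
def IsField (O : Set W) (U : Set V) (φ : V → W) : Prop :=
  ContDiffOn ℝ ∞ φ U ∧ ∀ p ∈ U, φ p ∈ O

/-- `G` is a smooth local functional on the open set `D`: for every finite-parameter family of
fields that is smooth and admissible on an open set of parameters and points, the values of `G`
depend smoothly on parameter and point there. Smooth functions of finitely many derivatives of the
field have this property. -/
def IsSmoothLocal (D : Set V) (O : Set W) (G : (V → W) → V → Z) : Prop :=
  ∀ (k : ℕ) (U : Set ((Fin k → ℝ) × V)) (Ψ : (Fin k → ℝ) → V → W),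
    IsOpen U → (∀ q ∈ U, q.2 ∈ D) → ContDiffOn ℝ ∞ (fun q => Ψ q.1 q.2) U →
    (∀ q ∈ U, Ψ q.1 q.2 ∈ O) → ContDiffOn ℝ ∞ (fun q => G (Ψ q.1) q.2) U

/-- The field-space exterior derivative of a `0`-form, `(δF)(φ; Y)`. -/
def delta0 (F : (V → W) → S → Z) (φ Y : V → W) (p : S) : Z :=
  deriv (fun t : ℝ => F (φ + t • Y) p) 0

/-- The field-space exterior derivative of a `1`-form, `(δα)(φ; X, Y)`. -/
def delta1 (α : (V → W) → (V → W) → S → Z) (φ X Y : V → W) (p : S) : Z :=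
  delta0 (fun χ => α χ Y) φ X p - delta0 (fun χ => α χ X) φ Y p

/-- A representation of the Lie algebra `𝔤𝔩(V)` on `W`. The dynamical fields are tensor fields, that
is, sections of the natural bundle given by such a representation: for `W = V`, `ρ A = A` these are
the vector fields, for `W = V*`, `ρ A = -Aᵀ` the one-forms, and so on for tensor products, direct
sums, subbundles and densities. -/
structure TensorRep (V W : Type*) [NormedAddCommGroup V] [NormedSpace ℝ V]
    [NormedAddCommGroup W] [NormedSpace ℝ W] where
  toLinearMap : (V →L[ℝ] V) →ₗ[ℝ] (W →L[ℝ] W)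
  map_commutator : ∀ A B : V →L[ℝ] V, toLinearMap (A * B - B * A) =
    toLinearMap A * toLinearMap B - toLinearMap B * toLinearMap A

/-- The Lie derivative of a tensor field, `£_ξ φ = ∂_ξ φ - ρ(∂ξ) φ`. -/
def lieField (ρ : TensorRep V W) (ξ : V → V) (φ : V → W) : V → W := fun p =>
  fderiv ℝ φ p (ξ p) - ρ.toLinearMap (fderiv ℝ ξ p) (φ p)

/-- The vector field `ξ̂` on field space, `I_ξ̂ δφ = £_ξ φ`, for a (possibly field-dependent)
vector field `ξ` on spacetime. -/
def hat (ρ : TensorRep V W) (ξ : (V → W) → V → V) (φ : V → W) : V → W :=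
  lieField ρ (ξ φ) φ

/-- The field-space Lie derivative `L_X = I_X δ + δ I_X` of a `1`-form. -/
def lieFieldSpace1 (X : (V → W) → V → W) (α : (V → W) → (V → W) → S → Z)
    (φ Y : V → W) (p : S) : Z :=
  delta1 α φ (X φ) Y p + delta0 (fun χ => α χ (X χ)) φ Y p

/-- `I_{δξ̂} α`: the variation `Y` is replaced by the Lie derivative of the field along the
vector field `δξ(φ; Y)`. -/
def iDeltaHat (ρ : TensorRep V W) (ξ : (V → W) → V → V)
    (α : (V → W) → (V → W) → S → Z) (φ Y : V → W) (p : S) : Z :=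
  α φ (lieField ρ (delta0 ξ φ Y) φ) p

/-- The anomaly `Δ_ξ̂ F = L_ξ̂ F - £_ξ F - I_{δξ̂} F` of a field-space `0`-form, for which
`L_ξ̂ F = I_ξ̂ δF` and `I_{δξ̂} F = 0`. -/
def anomaly0 {k : ℕ} (ρ : TensorRep V W) (ξ : (V → W) → V → V)
    (F : (V → W) → Form k V) (φ : V → W) : Form k V := fun p =>
  delta0 F φ (hat ρ ξ φ) p - lieForm (ξ φ) (F φ) p

/-- The anomaly `Δ_ξ̂ α = L_ξ̂ α - £_ξ α - I_{δξ̂} α` of a field-space `1`-form. -/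
def anomaly1 {k : ℕ} (ρ : TensorRep V W) (ξ : (V → W) → V → V)
    (α : (V → W) → (V → W) → Form k V) (φ Y : V → W) : Form k V := fun p =>
  lieFieldSpace1 (hat ρ ξ) α φ Y p - lieForm (ξ φ) (α φ Y) p - iDeltaHat ρ ξ α φ Y p

/-- The anomaly of a field-space `1`-form with values in forms on the boundary `Φ = 0`: the
spacetime Lie derivative is taken along the restriction of `ξ` to the boundary. -/
def boundaryAnomaly1 {E : Type*} [NormedAddCommGroup E] [NormedSpace ℝ E] {k : ℕ}
    (ρ : TensorRep (E × ℝ) W) (ξ : (E × ℝ → W) → E × ℝ → E × ℝ)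
    (α : (E × ℝ → W) → (E × ℝ → W) → Form k E) (φ Y : E × ℝ → W) : Form k E := fun x =>
  lieFieldSpace1 (hat ρ ξ) α φ Y x - lieForm (fun y => (ξ φ (y, 0)).1) (α φ Y) x
    - iDeltaHat ρ ξ α φ Y x

end FieldSpace

/-! ## Lagrangian theories -/

section Theory

variable {V W : Type*} [NormedAddCommGroup V] [NormedSpace ℝ V]
  [NormedAddCommGroup W] [NormedSpace ℝ W]

/-- A local Lagrangian field theory on the open set `D`: a Lagrangian `L'`, a symplectic potential
`θ'` and field equations `E`, related by `δL' = E · δφ + dθ'`. Nothing is required of the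
behaviour of `L'` and `θ'` at the boundary of `D`. -/
structure Theory (n : ℕ) (D : Set V) (O : Set W) where
  L : (V → W) → Form (n + 2) V
  θ : (V → W) → (V → W) → Form (n + 1) V
  eom : (V → W) → V → W →L[ℝ] V [⋀^Fin (n + 2)]→L[ℝ] ℝ
  smooth_L : IsSmoothLocal D O L
  smooth_θ : IsSmoothLocal D (O ×ˢ (univ : Set W))
    (fun χ : V → W × W => θ (fun p => (χ p).1) (fun p => (χ p).2))
  linear_θ : ∀ U ⊆ D, IsOpen U → ∀ φ, IsField O U φ → ∀ X Y : V → W,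
    ContDiffOn ℝ ∞ X U → ContDiffOn ℝ ∞ Y U → ∀ c : ℝ, ∀ p ∈ U,
      θ φ (X + c • Y) p = θ φ X p + c • θ φ Y p
  variation : ∀ U ⊆ D, IsOpen U → ∀ φ, IsField O U φ → ∀ Y : V → W, ContDiffOn ℝ ∞ Y U →
    ∀ p ∈ U, delta0 L φ Y p = eom φ p (Y p) + extDeriv (θ φ Y) p

variable {n : ℕ} {D : Set V} {O : Set W}

/-- The Lagrangian and the symplectic potential are covariant: `Δ_ξ̂ L' = 0` and `Δ_ξ̂ θ' = 0`
for all field-independent vector fields `ξ`. -/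
def Theory.IsCovariant (T : Theory n D O) (ρ : TensorRep V W) : Prop :=
  ∀ U ⊆ D, IsOpen U → ∀ φ, IsField O U φ → ∀ ξ : V → V, ContDiffOn ℝ ∞ ξ U →
    (∀ p ∈ U, anomaly0 ρ (fun _ => ξ) T.L φ p = 0) ∧
    ∀ Y : V → W, ContDiffOn ℝ ∞ Y U → ∀ p ∈ U, anomaly1 ρ (fun _ => ξ) T.θ φ Y p = 0

/-- The solutions of the field equations. -/
def Theory.IsSolution (T : Theory n D O) (φ : V → W) : Prop :=
  IsField O D φ ∧ ∀ p ∈ D, T.eom φ p = 0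

end Theory

/-! ## The boundary canonical transformation and its anomalies -/

namespace Theory

variable {E W : Type*} [NormedAddCommGroup E] [NormedSpace ℝ E]
  [NormedAddCommGroup W] [NormedSpace ℝ W] {n : ℕ} {D : Set (E × ℝ)} {O : Set W}
  (T : Theory n D O) (υ₀ : ℝ)

/-- `i_v B = 0`, `π_υ^* B = ∫_υ^{υ₀} π_s^* (i_v L') ds`. -/
def B (φ : E × ℝ → W) : Form (n + 1) (E × ℝ) :=
  lift fun υ x => ∫ s in υ..υ₀, pull s (fun p => (T.L φ p).curryLeft rig) x

/-- `i_v Λ = 0`, `π_υ^* Λ = -∫_υ^{υ₀} π_s^* (i_v θ') ds`. -/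
def Lam (φ Y : E × ℝ → W) : Form n (E × ℝ) :=
  lift fun υ x => -∫ s in υ..υ₀, pull s (fun p => (T.θ φ Y p).curryLeft rig) x

/-- `L'_ren = L' + dB`. -/
def Lren (φ : E × ℝ → W) : Form (n + 2) (E × ℝ) := fun p =>
  T.L φ p + extDeriv (T.B υ₀ φ) p

/-- `θ'_ren = θ' + δB - dΛ`. -/
def θren (φ Y : E × ℝ → W) : Form (n + 1) (E × ℝ) := fun p =>
  T.θ φ Y p + delta0 (T.B υ₀) φ Y p - extDeriv (T.Lam υ₀ φ Y) p

/-- `κ_η`, for a vector field `η` on the collar. -/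
def kappa (η : E × ℝ → E × ℝ) (φ : E × ℝ → W) : Form n (E × ℝ) :=
  kappaMu (k := n + 1) υ₀ η (T.L φ)

/-- `μ_η`, a field-space `1`-form of degree `d - 2 = n - 1` on spacetime. For `n = 0` there are
no such forms, and `extDerivPred` sends it to `0`. -/
def mu (η : E × ℝ → E × ℝ) (φ Y : E × ℝ → W) : Form (n - 1) (E × ℝ) :=
  kappaMu (k := n) υ₀ η (T.θ φ Y)

/-- The finite part of the anomaly of `B`:
`i_v (Δ_ξ̂ B)_finite = 0`, `π_υ^* (Δ_ξ̂ B)_finite = π_{υ₀}^* (i_ξ L')`. -/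
def finB (η : E × ℝ → E × ℝ) (φ : E × ℝ → W) : Form (n + 1) (E × ℝ) :=
  lift fun _ x => pull υ₀ (fun p => (T.L φ p).curryLeft (η p)) x

/-- The finite part of the anomaly of `Λ`: `i_v (Δ_ξ̂ Λ)_finite = 0` and
`π_υ^* (Δ_ξ̂ Λ)_finite = -π_{υ₀}^* (£_ξ Φ i_v θ') - i_{π_{υ₀}^* ξ - π_υ^* ξ} π_{υ₀}^* θ'`. -/
def finLam (η : E × ℝ → E × ℝ) (φ Y : E × ℝ → W) : Form n (E × ℝ) :=
  lift fun υ x =>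
    -pull υ₀ (fun p => (η p).2 • (T.θ φ Y p).curryLeft rig) x
      - (pull υ₀ (T.θ φ Y) x).curryLeft ((η (x, υ₀)).1 - (η (x, υ)).1)

end Theory

end HoloRen

end

open HoloRen

noncomputable section

namespace HoloRen

/-! ### Integrals depending smoothly on parameters -/

section Analysis

/-! Everything follows from one homotopy formula. Let `P` integrate `π_s^* i_v a` over `s` from `υ`
to `υ₀` (`homotopyPred`, `homotopyOp`), and let `Q` be the pullback under the retraction of the
collar onto the slice `Φ = υ₀` (`slicePullback`). Then `dP + Pd = Q - 1`, while `B = P L'` and `Λ =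
-P θ'`. Since `L'` has top degree, `dL' = 0` and `Q L' = 0`, so `L'_ren = 0`. On solutions `δL' =
dθ'`, so `θ'_ren = θ' + P dθ' + d P θ' = Q θ'`: its pullback to every slice is the fixed form
`π_{υ₀}^* θ'`, which gives the limit at the boundary without any control of `θ'` there.

The forms `κ` and `μ` are both `-(P i_ξ + i_ξ P)`, applied to `L'` and to `θ'` (`kappaMu_eq`). With
Cartan's formula, the homotopy formula becomes `[P, £_ξ] a = Q i_ξ a - i_ξ Q a + d κ(a) - κ(da)`,
where `κ(a)` is this operator on `a` (`homotopyOp_lieForm_sub`). Covariance says that varying `L'`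
or `θ'` along `ξ̂` is taking `£_ξ`, so the anomalies of `B` and `Λ` are this commutator on `L'` and
minus this commutator on `θ'`. Its `Q`-terms are the finite parts; they involve the fields only at
`υ₀`, hence are smooth wherever `ξ` is. For `Λ`, the term `κ(dθ') = κ(δL')` is `δκ_ξ - κ_{δξ}`.

For field-dependent `ξ`, the product rule for `δ I_ξ̂` produces exactly the term removed by
`I_{δξ̂}`, so an anomaly sees only the vector field `ξ φ` (`anomaly1_eq`). The anomaly of `θ'_ren`
then follows because anomalies for field-independent `ξ` commute with `δ` and with `d`: the two
contributions `d δκ` cancel and `ddμ = 0`.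

The analytic work is to make all these derivatives genuine. `B` and `Λ` at a point depend on the
field along the whole segment to the slice, which `Reach` records, and `φ + t • Y` may take
inadmissible values far away even for small `t`. The tube lemma below shows that near a given point
and for small `t` the whole segment remains admissible. Smoothness in parameters then reduces to
differentiation under the integral sign, and the chain rule along curves of fields to Hadamard's
lemma. -/

theorem isOpen_setOf_forall_mem_compact {X Y : Type*} [TopologicalSpace X] [TopologicalSpace Y]
    {U : Set (X × Y)} (hU : IsOpen U) {K : Set Y} (hK : IsCompact K) :
    IsOpen {x | ∀ u ∈ K, (x, u) ∈ U} := by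
  rw [isOpen_iff_mem_nhds]
  intro x hx
  obtain ⟨u, v, hu, -, hxu, hKv, huv⟩ := generalized_tube_lemma (isCompact_singleton (x := x)) hK
    hU (by rintro ⟨y, s⟩ ⟨hy, hs⟩; obtain rfl : y = x := hy; exact hx s hs)
  exact Filter.mem_of_superset (hu.mem_nhds (hxu rfl)) fun y hy s hs => huv ⟨hy, hKv hs⟩

theorem continuousOn_slice {X Z : Type*} [TopologicalSpace X] [TopologicalSpace Z] {F : X × ℝ → Z} {U : Set (X × ℝ)} (hF : ContinuousOn F U) {K : Set ℝ}
    {x : X} (hx : ∀ s ∈ K, (x, s) ∈ U) : ContinuousOn (fun s => F (x, s)) K :=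
  hF.comp (by fun_prop) hx

/-- The set of `(x, υ)` for which the segment from `(x, υ)` to `(x, c)` lies in `U`. -/
def columnSet {X : Type*} (c : ℝ) (U : Set (X × ℝ)) : Set (X × ℝ) := {q | ∀ s ∈ uIcc q.2 c, (q.1, s) ∈ U}

/-- Parametrizing the segment by `[0, 1]` replaces an interval that moves with `q` by a fixed
compact set, as the tube lemma requires. -/
theorem mem_columnSet_iff {X : Type*} {c : ℝ} {U : Set (X × ℝ)} {q : X × ℝ} :
    q ∈ columnSet c U ↔ ∀ u ∈ Icc (0 : ℝ) 1, (q.1, q.2 + u * (c - q.2)) ∈ U := by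
  rw [columnSet, mem_ofPred_eq, ← segment_eq_uIcc, segment_eq_image', forall_mem_image]
  rfl

theorem columnSet_subset {X : Type*} {c : ℝ} {U : Set (X × ℝ)} : columnSet c U ⊆ U :=
  fun _ hq => hq _ left_mem_uIcc

variable {X Z : Type*} [NormedAddCommGroup X] [NormedSpace ℝ X]
  [NormedAddCommGroup Z] [NormedSpace ℝ Z]

theorem ContDiffOn.fderiv_infty {f : X → Z} {U : Set X} (hU : IsOpen U)
    (hf : ContDiffOn ℝ ∞ f U) : ContDiffOn ℝ ∞ (fderiv ℝ f) U :=
  ((contDiffOn_infty_iff_fderiv_of_isOpen hU).1 hf).2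

theorem ContDiffOn.differentiableAt_infty {f : X → Z} {U : Set X} (hU : IsOpen U)
    (hf : ContDiffOn ℝ ∞ f U) {x : X} (hx : x ∈ U) : DifferentiableAt ℝ f x :=
  (hf.differentiableOn (by simp)).differentiableAt (hU.mem_nhds hx)

/-- Differentiation under the integral sign, for an integrand that is continuously differentiable
near a compact segment. -/
theorem hasFDerivAt_integral_of_contDiffOn {F : X × ℝ → Z} {U : Set (X × ℝ)} (hU : IsOpen U)
    (hF : ContDiffOn ℝ 1 F U) {a b : ℝ} {x : X} (hx : ∀ s ∈ uIcc a b, (x, s) ∈ U) :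
    HasFDerivAt (fun y => ∫ s in a..b, F (y, s))
      (∫ s in a..b, (fderiv ℝ F (x, s)).comp (ContinuousLinearMap.inl ℝ X ℝ)) x := by
  have hF' : ContinuousOn (fderiv ℝ F) U := hF.continuousOn_fderiv_of_isOpen hU (by simp)
  have hG : ContinuousOn (fun q => (fderiv ℝ F q).comp (ContinuousLinearMap.inl ℝ X ℝ)) U := by
    fun_prop
  have hc : ContinuousOn (fun s => (fderiv ℝ F (x, s)).comp (ContinuousLinearMap.inl ℝ X ℝ))
      (uIcc a b) := continuousOn_slice hG hx
  obtain ⟨C, hC⟩ := isCompact_uIcc.exists_bound_of_continuousOn hc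
  -- `C` bounds the derivative on the segment over `x`. The strict bound `C + 1` is an open
  -- condition, so by the tube lemma it persists on the segments over all `y` near `x` and gives a
  -- constant dominating function.
  have hV : IsOpen (U ∩ {q | ‖(fderiv ℝ F q).comp (ContinuousLinearMap.inl ℝ X ℝ)‖ < C + 1}) := by
    have := hG.norm.isOpen_inter_preimage hU (isOpen_Iio (a := C + 1))
    exact this
  have hO := isOpen_setOf_forall_mem_compact hV (isCompact_uIcc (a := a) (b := b))
  have hmem : {y | ∀ s ∈ uIcc a b, (y, s) ∈ U ∩ {q | ‖(fderiv ℝ F q).comp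
      (ContinuousLinearMap.inl ℝ X ℝ)‖ < C + 1}} ∈ 𝓝 x :=
    hO.mem_nhds fun s hs => ⟨hx s hs, (hC s hs).trans_lt (by linarith)⟩
  refine intervalIntegral.hasFDerivAt_integral_of_dominated_of_fderiv_le
    (F' := fun y s => (fderiv ℝ F (y, s)).comp (ContinuousLinearMap.inl ℝ X ℝ))
    (bound := fun _ => C + 1) hmem ?_ ?_ ?_ ?_ ?_ ?_
  · filter_upwards [hmem] with y hy
    exact ((continuousOn_slice hF.continuousOn fun s hs => (hy s hs).1).mono
      uIoc_subset_uIcc).aestronglyMeasurable measurableSet_uIoc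
  · exact (continuousOn_slice hF.continuousOn hx).intervalIntegrable
  · exact (hc.mono uIoc_subset_uIcc).aestronglyMeasurable measurableSet_uIoc
  · exact Filter.Eventually.of_forall fun s hs y hy => (hy s (uIoc_subset_uIcc hs)).2.le
  · exact intervalIntegrable_const
  · refine Filter.Eventually.of_forall fun s hs y hy => ?_
    have h1 : HasFDerivAt F (fderiv ℝ F (y, s)) (y, s) :=
      ((hF.differentiableOn (by simp)).differentiableAt
        (hU.mem_nhds (hy s (uIoc_subset_uIcc hs)).1)).hasFDerivAt
    exact h1.comp y (hasFDerivAt_prodMk_left y s)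

/-- The derivative of the integral is the integral of the derivative, so induction on the order
applies. Finite dimension of `X` allows the derivative to be tested on single vectors `y`; the new
integrand then still takes values in `Z`. -/
theorem contDiffOn_integral [FiniteDimensional ℝ X] [CompleteSpace Z] {F : X × ℝ → Z}
    {U : Set (X × ℝ)} (hU : IsOpen U) (hF : ContDiffOn ℝ ∞ F U) (a b : ℝ) :
    ContDiffOn ℝ ∞ (fun y => ∫ s in a..b, F (y, s)) {x | ∀ s ∈ uIcc a b, (x, s) ∈ U} := by
  have hO := isOpen_setOf_forall_mem_compact hU (isCompact_uIcc (a := a) (b := b))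
  rw [contDiffOn_infty]
  intro m
  induction m generalizing F with
  | zero =>
    have : ContDiffOn ℝ 1 F U := hF.of_le (by simp)
    exact contDiffOn_zero.2 fun x hx =>
      (hasFDerivAt_integral_of_contDiffOn hU this hx).continuousAt.continuousWithinAt
  | succ m ih =>
    have h1 : ContDiffOn ℝ 1 F U := hF.of_le (by simp)
    push_cast
    rw [contDiffOn_succ_iff_fderiv_of_isOpen hO]
    refine ⟨fun x hx => (hasFDerivAt_integral_of_contDiffOn hU h1
      hx).differentiableAt.differentiableWithinAt, by simp, ?_⟩
    rw [contDiffOn_clm_apply]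
    intro y
    have hG : ContDiffOn ℝ ∞ (fun q => fderiv ℝ F q (y, 0)) U :=
      (ContDiffOn.fderiv_infty hU hF).clm_apply contDiffOn_const
    refine (ih hG).congr fun x hx => ?_
    rw [(hasFDerivAt_integral_of_contDiffOn hU h1 hx).fderiv,
      ContinuousLinearMap.intervalIntegral_apply]
    · simp
    · have hc : ContinuousOn (fun q => (fderiv ℝ F q).comp (ContinuousLinearMap.inl ℝ X ℝ)) U := by
        have := (ContDiffOn.fderiv_infty hU hF).continuousOn
        fun_prop
      exact (continuousOn_slice hc hx).intervalIntegrable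

theorem isOpen_columnSet {c : ℝ} {U : Set (X × ℝ)} (hU : IsOpen U) : IsOpen (columnSet c U) := by
  have : columnSet c U = {q | ∀ u ∈ Icc (0 : ℝ) 1,
      (q, u) ∈ (fun w : (X × ℝ) × ℝ => (w.1.1, w.1.2 + w.2 * (c - w.1.2))) ⁻¹' U} := by
    ext q
    exact mem_columnSet_iff
  rw [this]
  exact isOpen_setOf_forall_mem_compact (hU.preimage (by fun_prop)) isCompact_Icc

theorem integral_eq_smul_integral_unit (f : ℝ → Z) (a c : ℝ) :
    ∫ s in a..c, f s = (c - a) • ∫ u in (0 : ℝ)..1, f (a + u * (c - a)) := by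
  have := intervalIntegral.smul_integral_comp_mul_add (a := 0) (b := 1) f (c - a) a
  simp only [mul_zero, zero_add, mul_one, sub_add_cancel] at this
  rw [← this]
  congr 2
  funext u
  congr 1
  ring

/-- Rescaling the segment to `[0, 1]` moves the variable lower limit into the integrand, where it is
one more parameter. -/
theorem contDiffOn_column_integral [FiniteDimensional ℝ X] [CompleteSpace Z] {F : X × ℝ → Z}
    {U : Set (X × ℝ)} (hU : IsOpen U) (hF : ContDiffOn ℝ ∞ F U) (c : ℝ) :
    ContDiffOn ℝ ∞ (fun q : X × ℝ => ∫ s in q.2..c, F (q.1, s)) (columnSet c U) := by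
  have hm : ContDiff ℝ ∞ (fun w : (X × ℝ) × ℝ => (w.1.1, w.1.2 + w.2 * (c - w.1.2))) := by fun_prop
  have h := contDiffOn_integral (hU.preimage hm.continuous)
    (hF.comp hm.contDiffOn fun _ h => h) 0 1
  have h2 : ContDiffOn ℝ ∞ (fun q : X × ℝ => (c - q.2) • ∫ u in (0 : ℝ)..1,
      F (q.1, q.2 + u * (c - q.2))) (columnSet c U) := by
    refine ContDiffOn.smul (by fun_prop) (h.mono fun q hq u hu => ?_)
    rw [uIcc_of_le zero_le_one] at hu
    exact mem_columnSet_iff.1 hq u hu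
  exact h2.congr fun q _ => integral_eq_smul_integral_unit (fun s => F (q.1, s)) q.2 c

/-- Hadamard's lemma: the difference quotient of a smooth family in its parameter is smooth. -/
theorem contDiffOn_dslope_family [FiniteDimensional ℝ X] [CompleteSpace Z] {f : ℝ → X → Z}
    {U : Set (ℝ × X)} (hU : IsOpen U) (hf : ContDiffOn ℝ ∞ (fun q : ℝ × X => f q.1 q.2) U) :
    ContDiffOn ℝ ∞ (fun q : ℝ × X => dslope (fun t => f t q.2) 0 q.1)
      {q | ∀ u ∈ Icc (0 : ℝ) 1, (u * q.1, q.2) ∈ U} := by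
  set g : ℝ × X → Z := fun q => fderiv ℝ (fun q : ℝ × X => f q.1 q.2) q (1, 0) with hg
  have hgs : ContDiffOn ℝ ∞ g U := (ContDiffOn.fderiv_infty hU hf).clm_apply contDiffOn_const
  have hm : ContDiff ℝ ∞ (fun w : (ℝ × X) × ℝ => (w.2 * w.1.1, w.1.2)) := by fun_prop
  have h := contDiffOn_integral (hU.preimage hm.continuous)
    (hgs.comp hm.contDiffOn fun _ h => h) 0 1
  rw [uIcc_of_le zero_le_one] at h
  refine h.congr fun q hq => ?_
  have hder : ∀ t, (t, q.2) ∈ U → HasDerivAt (fun t => f t q.2) (g (t, q.2)) t := by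
    intro t ht
    have h1 := (ContDiffOn.differentiableAt_infty hU hf ht).hasFDerivAt
    exact h1.comp_hasDerivAt (f := fun t => (t, q.2)) t
      ((hasDerivAt_id t).prodMk (hasDerivAt_const t q.2))
  have h0 : ((0 : ℝ), q.2) ∈ U := by simpa using hq 0 (by simp)
  rcases eq_or_ne q.1 0 with h | h
  · rw [h, dslope_same, (hder 0 h0).deriv]
    simp [h]
  · rw [dslope_of_ne _ h, slope_def_module, sub_zero]
    -- The fundamental theorem of calculus in `u` exhibits the difference quotient as `∫₀¹ ∂_t f(ut,
    -- x) du`, which has no singularity at `t = 0`.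
    have hint : ∫ u in (0 : ℝ)..1, q.1 • g (u * q.1, q.2) = f (1 * q.1) q.2 - f (0 * q.1) q.2 := by
      refine intervalIntegral.integral_eq_sub_of_hasDerivAt (f := fun u => f (u * q.1) q.2) ?_ ?_
      · intro u hu
        rw [uIcc_of_le zero_le_one] at hu
        exact (hder _ (hq u hu)).scomp u (by simpa using (hasDerivAt_id u).mul_const q.1)
      · refine ContinuousOn.intervalIntegrable ?_
        rw [uIcc_of_le zero_le_one]
        exact (hgs.continuousOn.comp (by fun_prop) hq).const_smul q.1
    rw [intervalIntegral.integral_smul, one_mul, zero_mul] at hint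
    rw [← hint, smul_smul, inv_mul_cancel₀ h, one_smul]
    rfl

end Analysis

/-! ### Contraction, exterior derivative and Cartan's formula in all degrees -/

section FormOperators

variable {V V' : Type*} [NormedAddCommGroup V] [NormedSpace ℝ V]
  [NormedAddCommGroup V'] [NormedSpace ℝ V']

/-- The contraction in positive degree as a bilinear map. -/
def curryL (k : ℕ) : V →L[ℝ] (V [⋀^Fin (k + 1)]→L[ℝ] ℝ) →L[ℝ] V [⋀^Fin k]→L[ℝ] ℝ :=
  ContinuousLinearMap.flip
    (ContinuousAlternatingMap.curryLeftLI (𝕜 := ℝ) (E := V) (F := ℝ)).toContinuousLinearMap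

/-- The contraction as a bilinear map. -/
def contrL : (k : ℕ) → V →L[ℝ] (V [⋀^Fin k]→L[ℝ] ℝ) →L[ℝ] V [⋀^Fin (k - 1)]→L[ℝ] ℝ
  | 0 => 0
  | k + 1 => curryL k

theorem contr_eq_contrL {k : ℕ} (w : V) (a : V [⋀^Fin k]→L[ℝ] ℝ) : contr w a = contrL k w a := by
  cases k <;> rfl

/-- The alternatization from degree `k - 1` to degree `k`. -/
def altL : (k : ℕ) → (V →L[ℝ] V [⋀^Fin (k - 1)]→L[ℝ] ℝ) →L[ℝ] V [⋀^Fin k]→L[ℝ] ℝ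
  | 0 => 0
  | _ + 1 => ContinuousAlternatingMap.alternatizeUncurryFinCLM ℝ V ℝ

theorem extDerivPred_eq_altL {k : ℕ} (a : Form (k - 1) V) (p : V) :
    extDerivPred a p = altL k (fderiv ℝ a p) := by
  cases k <;> rfl

theorem extDeriv_eq_altL {k : ℕ} (a : Form k V) (p : V) :
    extDeriv a p = altL (k + 1) (fderiv ℝ a p) := rfl

theorem contr_zero_left {k : ℕ} (a : V [⋀^Fin k]→L[ℝ] ℝ) : contr 0 a = 0 := by
  simp [contr_eq_contrL]

theorem contr_zero_right {k : ℕ} (w : V) : contr w (0 : V [⋀^Fin k]→L[ℝ] ℝ) = 0 := by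
  simp [contr_eq_contrL]

theorem contr_add_right {k : ℕ} (w : V) (a b : V [⋀^Fin k]→L[ℝ] ℝ) :
    contr w (a + b) = contr w a + contr w b := by
  simp [contr_eq_contrL]

theorem contr_sub_right {k : ℕ} (w : V) (a b : V [⋀^Fin k]→L[ℝ] ℝ) :
    contr w (a - b) = contr w a - contr w b := by
  simp only [contr_eq_contrL]
  exact map_sub (contrL (V := V) k w) a b

theorem contr_contr {k : ℕ} (v w : V) (a : V [⋀^Fin k]→L[ℝ] ℝ) :
    contr v (contr w a) = -contr w (contr v a) := by
  -- Degree subtraction truncates at zero. In degrees 0 and 1 each side contracts a 0-form, or is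
  -- the contraction of zero, and vanishes; from degree 2 on, the sign is that of a transposition of
  -- the first two slots.
  match k, a with
  | 0, a => exact (neg_zero (G := V [⋀^Fin 0]→L[ℝ] ℝ)).symm
  | 1, a => exact (neg_zero (G := V [⋀^Fin 0]→L[ℝ] ℝ)).symm
  | k + 2, a =>
    ext u
    change a (Matrix.vecCons w (Matrix.vecCons v u)) = -a (Matrix.vecCons v (Matrix.vecCons w u))
    have := a.toAlternatingMap.map_swap (Matrix.vecCons v (Matrix.vecCons w u))
      (i := 0) (j := 1) (by simp)
    change a _ = - a _ at this
    rw [← this]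
    congr 1
    funext i
    refine Fin.cases ?_ (fun i => Fin.cases ?_ (fun i => ?_) i) i
    · simp
    · rfl
    · have h : Equiv.swap (0 : Fin (k + 2)) 1 i.succ.succ = i.succ.succ :=
        Equiv.swap_apply_of_ne_of_ne (by simp [Fin.ext_iff]) (by simp [Fin.ext_iff])
      simp [h]

theorem contr_self_contr {k : ℕ} (w : V) (a : V [⋀^Fin k]→L[ℝ] ℝ) : contr w (contr w a) = 0 := by
  have h : (2 : ℝ) • contr w (contr w a) = 0 := by
    rw [two_smul]
    nth_rewrite 1 [contr_contr w w a]
    exact neg_add_cancel _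
  exact (smul_eq_zero.1 h).resolve_left two_ne_zero

/-- Alternatization is natural in the vector space. This is the pointwise reason why `d` commutes
with pullback along linear maps, such as slices and projections. -/
theorem altL_compContinuousLinearMap {k : ℕ} (T : V' →L[ℝ] V' [⋀^Fin (k - 1)]→L[ℝ] ℝ)
    (f : V →L[ℝ] V') :
    (altL k T).compContinuousLinearMap f =
      altL k ((ContinuousAlternatingMap.compContinuousLinearMapCLM f).comp (T.comp f)) := by
  cases k with
  | zero => rfl
  | succ k =>
    ext v
    simp +unfoldPartialApp [altL, ContinuousAlternatingMap.alternatizeUncurryFin_apply,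
      Fin.removeNth, Function.comp_def]

/-- Splitting off the first term of the alternating sum leaves the alternatization of the contracted
form with all signs shifted. This is the algebra behind Cartan's formula for constant `w`. -/
theorem alternatizeUncurryFin_vecCons {k : ℕ} (T : V →L[ℝ] V [⋀^Fin (k + 1)]→L[ℝ] ℝ) (w : V)
    (v : Fin (k + 1) → V) :
    ContinuousAlternatingMap.alternatizeUncurryFin T (Matrix.vecCons w v) =
      T w v - ContinuousAlternatingMap.alternatizeUncurryFin ((curryL k w).comp T) v := by
  rw [ContinuousAlternatingMap.alternatizeUncurryFin_apply,
    ContinuousAlternatingMap.alternatizeUncurryFin_apply, Fin.sum_univ_succ, sub_eq_add_neg,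
    ← Finset.sum_neg_distrib]
  congr 1
  · rw [Fin.val_zero, pow_zero, one_smul]
    congr 1
  · refine Finset.sum_congr rfl fun i _ => ?_
    have : (Fin.removeNth i.succ (Matrix.vecCons w v) : Fin (k + 1) → V) =
        Matrix.vecCons w (Fin.removeNth i v) := by
      funext j
      refine Fin.cases ?_ (fun j => ?_) j <;> simp [Fin.removeNth]
    rw [this, Matrix.cons_val_succ, Fin.val_succ, pow_succ, mul_neg_one, neg_smul]
    rfl

/-- Cartan's formula for a constant vector field. -/
theorem contr_extDeriv_add {k : ℕ} {a : Form k V} {p : V} (ha : DifferentiableAt ℝ a p) (w : V) :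
    (extDeriv a p).curryLeft w + extDerivPred (fun q => contr w (a q)) p = fderiv ℝ a p w := by
  rw [extDerivPred_eq_altL, extDeriv_eq_altL]
  simp only [contr_eq_contrL]
  have h : fderiv ℝ (fun q => contrL k w (a q)) p = (contrL k w).comp (fderiv ℝ a p) :=
    ((contrL k w).hasFDerivAt.comp p ha.hasFDerivAt).fderiv
  rw [h]
  cases k with
  | zero =>
    ext v
    change ContinuousAlternatingMap.alternatizeUncurryFin (fderiv ℝ a p) (Matrix.vecCons w v) + 0
      = _
    rw [ContinuousAlternatingMap.alternatizeUncurryFin_apply, Fin.sum_univ_succ, add_zero]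
    simp only [Fin.val_zero, pow_zero, one_smul]
    refine (add_zero _).trans ?_
    congr 1
  | succ k =>
    ext v
    exact eq_sub_iff_add_eq.1 (alternatizeUncurryFin_vecCons (fderiv ℝ a p) w v)

theorem ContDiffOn.contr {X : Type*} [NormedAddCommGroup X] [NormedSpace ℝ X] {k : ℕ}
    {U : Set X} {η : X → V} {a : X → V [⋀^Fin k]→L[ℝ] ℝ} (hη : ContDiffOn ℝ ∞ η U)
    (ha : ContDiffOn ℝ ∞ a U) : ContDiffOn ℝ ∞ (fun q => contr (η q) (a q)) U := by
  simp only [contr_eq_contrL]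
  exact ((contrL k).contDiff.comp_contDiffOn hη).clm_apply ha

theorem ContDiffOn.extDerivPred {k : ℕ} {U : Set V} (hU : IsOpen U) {a : Form (k - 1) V}
    (ha : ContDiffOn ℝ ∞ a U) : ContDiffOn ℝ ∞ (extDerivPred a) U := by
  have : HoloRen.extDerivPred a = fun p => altL k (fderiv ℝ a p) :=
    funext (extDerivPred_eq_altL a)
  rw [this]
  exact (altL k).contDiff.comp_contDiffOn (ContDiffOn.fderiv_infty hU ha)

theorem ContDiffOn.extDeriv {k : ℕ} {U : Set V} (hU : IsOpen U) {a : Form k V}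
    (ha : ContDiffOn ℝ ∞ a U) : ContDiffOn ℝ ∞ (extDeriv a) U :=
  ContDiffOn.extDerivPred (k := k + 1) hU ha

theorem ContDiffOn.lieForm {k : ℕ} {U : Set V} (hU : IsOpen U) {η : V → V} {a : Form k V}
    (hη : ContDiffOn ℝ ∞ η U) (ha : ContDiffOn ℝ ∞ a U) : ContDiffOn ℝ ∞ (lieForm η a) U :=
  (ContDiffOn.contr (k := k + 1) hη (ContDiffOn.extDeriv hU ha)).add
    (ContDiffOn.extDerivPred hU (ContDiffOn.contr hη ha))

theorem extDerivPred_congr {k : ℕ} {a a' : Form (k - 1) V} {p : V} (h : a =ᶠ[𝓝 p] a') :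
    extDerivPred a p = extDerivPred a' p := by
  rw [extDerivPred_eq_altL, extDerivPred_eq_altL, h.fderiv_eq]

theorem extDerivPred_add {k : ℕ} {a a' : Form (k - 1) V} {p : V} (h : DifferentiableAt ℝ a p)
    (h' : DifferentiableAt ℝ a' p) :
    extDerivPred (fun q => a q + a' q) p = extDerivPred a p + extDerivPred a' p := by
  rw [extDerivPred_eq_altL, fderiv_fun_add h h', map_add]
  simp only [extDerivPred_eq_altL]

theorem extDerivPred_neg {k : ℕ} (a : Form (k - 1) V) (p : V) :
    extDerivPred (fun q => -a q) p = -extDerivPred a p := by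
  rw [extDerivPred_eq_altL, extDerivPred_eq_altL, fderiv_fun_neg]
  exact map_neg (altL (V := V) k) _

theorem extDerivPred_sub {k : ℕ} {a a' : Form (k - 1) V} {p : V} (h : DifferentiableAt ℝ a p)
    (h' : DifferentiableAt ℝ a' p) :
    extDerivPred (fun q => a q - a' q) p = extDerivPred a p - extDerivPred a' p := by
  rw [extDerivPred_eq_altL, extDerivPred_eq_altL, extDerivPred_eq_altL, fderiv_fun_sub h h']
  exact map_sub (altL (V := V) k) _ _

theorem extDeriv_extDerivPred {k : ℕ} {U : Set V} (hU : IsOpen U) {a : Form (k - 1) V}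
    (ha : ContDiffOn ℝ ∞ a U) {p : V} (hp : p ∈ U) : extDeriv (extDerivPred a) p = 0 := by
  cases k with
  | zero =>
    change extDeriv (fun _ => 0) p = 0
    rw [extDeriv_eq_altL]
    simp
  | succ k =>
    exact extDeriv_extDeriv_apply (r := ∞) ((ha p hp).contDiffAt (hU.mem_nhds hp))
      (by rw [minSmoothness_of_isRCLikeNormedField]; exact WithTop.coe_le_coe.2 (le_top (a := (2 : ℕ∞))))

/-- Forms of degree larger than the dimension vanish. -/
theorem form_eq_zero_of_finrank_lt [FiniteDimensional ℝ V] {k : ℕ} (hk : Module.finrank ℝ V < k)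
    (a : V [⋀^Fin k]→L[ℝ] ℝ) : a = 0 := by
  ext v
  refine a.toAlternatingMap.map_linearDependent v fun hv => ?_
  have := hv.fintype_card_le_finrank
  simp only [Fintype.card_fin] at this
  omega

end FormOperators

/-! ### The homotopy operator of the collar and its commutator with Lie derivatives -/

theorem columnSet_subset_slice {E : Type*} {c : ℝ} {U : Set (E × ℝ)} :
    columnSet c U ⊆ {p | (p.1, c) ∈ U} := fun _ hp => hp _ right_mem_uIcc

section CollarOperators

variable {E : Type*} [NormedAddCommGroup E] [NormedSpace ℝ E]

/-- The pullback to a slice of the collar, as a linear map. -/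
def pullL (E : Type*) [NormedAddCommGroup E] [NormedSpace ℝ E] (k : ℕ) :
    ((E × ℝ) [⋀^Fin k]→L[ℝ] ℝ) →L[ℝ] E [⋀^Fin k]→L[ℝ] ℝ :=
  ContinuousAlternatingMap.compContinuousLinearMapCLM (ContinuousLinearMap.inl ℝ E ℝ)

/-- The extension of a form on a slice to a form annihilated by `v`, as a linear map. -/
def liftL (E : Type*) [NormedAddCommGroup E] [NormedSpace ℝ E] (k : ℕ) :
    (E [⋀^Fin k]→L[ℝ] ℝ) →L[ℝ] (E × ℝ) [⋀^Fin k]→L[ℝ] ℝ :=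
  ContinuousAlternatingMap.compContinuousLinearMapCLM (ContinuousLinearMap.fst ℝ E ℝ)

theorem pull_eq_pullL {k : ℕ} (υ : ℝ) (a : Form k (E × ℝ)) (x : E) :
    pull υ a x = pullL E k (a (x, υ)) := rfl

theorem lift_eq_liftL {k : ℕ} (β : ℝ → Form k E) (p : E × ℝ) :
    lift β p = liftL E k (β p.2 p.1) := rfl

theorem pullL_liftL {k : ℕ} (b : E [⋀^Fin k]→L[ℝ] ℝ) : pullL E k (liftL E k b) = b := by
  ext v
  rfl

theorem contr_liftL {k : ℕ} (w : E × ℝ) (b : E [⋀^Fin k]→L[ℝ] ℝ) :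
    contr w (liftL E k b) = liftL E (k - 1) (contr w.1 b) := by
  cases k with
  | zero => exact (map_zero (liftL E (0 - 1))).symm
  | succ k =>
    ext v
    change b _ = b _
    congr 1
    funext i
    refine Fin.cases ?_ (fun i => ?_) i <;> simp

theorem contr_pullL {k : ℕ} (x : E) (a : (E × ℝ) [⋀^Fin k]→L[ℝ] ℝ) :
    contr x (pullL E k a) = pullL E (k - 1) (contr (x, 0) a) := by
  cases k with
  | zero => exact (map_zero (pullL E (0 - 1))).symm
  | succ k =>
    ext v
    change a _ = a _
    congr 1
    funext i
    refine Fin.cases ?_ (fun i => ?_) i <;> simp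

/-- The contraction inserts `w` in slot 0; a transposition brings slot `i` there at the cost of a
sign. -/
theorem apply_eq_zero_of_contr_eq_zero {V : Type*} [NormedAddCommGroup V] [NormedSpace ℝ V] {k : ℕ}
    {c : V [⋀^Fin k]→L[ℝ] ℝ} {w : V}
    (hc : contr w c = 0) {v : Fin k → V} {i : Fin k} {τ : ℝ} (hv : v i = τ • w) : c v = 0 := by
  cases k with
  | zero => exact i.elim0
  | succ k =>
    have key : ∀ u : Fin (k + 1) → V, u 0 = τ • w → c u = 0 := by
      intro u hu
      have h : u = Matrix.vecCons (τ • w) (Matrix.vecTail u) := by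
        funext j
        refine Fin.cases ?_ (fun j => ?_) j
        · simpa using hu
        · rfl
      rw [h]
      change (c.curryLeft (τ • w)) _ = 0
      rw [map_smul]
      change (τ • contr w c) _ = 0
      rw [hc, smul_zero]
      rfl
    rcases eq_or_ne i 0 with h | h
    · exact key v (h ▸ hv)
    · have := c.toAlternatingMap.map_swap v h.symm
      change c _ = - c v at this
      rw [← neg_eq_zero, ← this]
      exact key _ (by simpa using hv)

/-- A form on the collar is determined by its contraction with `v` and its pullback to the
slices. -/
theorem form_ext {k : ℕ} {a b : (E × ℝ) [⋀^Fin k]→L[ℝ] ℝ} (h1 : pullL E k a = pullL E k b)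
    (h2 : contr rig a = contr rig b) : a = b := by
  rw [← sub_eq_zero]
  have h1' : pullL E k (a - b) = 0 := by rw [map_sub, h1, sub_self]
  have h2' : contr rig (a - b) = 0 := by
    rw [contr_sub_right, h2, sub_self]
  generalize a - b = c at h1' h2'
  ext v
  have hv : v = (fun i => ((v i).1, (0 : ℝ))) + fun i => (v i).2 • (rig : E × ℝ) := by
    funext i
    simp [rig]
  -- Each argument is split into a part tangent to the slice and a multiple of `rig`. In the
  -- multilinear expansion every term except the purely tangential one has a `rig` slot and
  -- vanishes; the tangential one is the pullback.
  have hadd := c.toMultilinearMap.map_add_univ (fun i => ((v i).1, (0 : ℝ)))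
    (fun i => (v i).2 • (rig : E × ℝ))
  rw [← hv, Finset.sum_eq_single Finset.univ] at hadd
  · refine hadd.trans ?_
    rw [Finset.piecewise_univ]
    exact congrArg (fun f : E [⋀^Fin k]→L[ℝ] ℝ => f fun i => (v i).1) h1'
  · intro s _ hs
    obtain ⟨i, hi⟩ : ∃ i, i ∉ s := by
      by_contra! h
      exact hs (Finset.eq_univ_iff_forall.2 h)
    refine apply_eq_zero_of_contr_eq_zero h2' (i := i) (τ := (v i).2) ?_
    simp [hi]
  · simp

theorem liftL_pullL {k : ℕ} {a : (E × ℝ) [⋀^Fin k]→L[ℝ] ℝ} (ha : contr rig a = 0) :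
    liftL E k (pullL E k a) = a := by
  refine form_ext (pullL_liftL _) ?_
  rw [contr_liftL, ha]
  simp [rig, contr_zero_left]

/-- The homotopy operator of the retraction of the collar onto the slice `Φ = c`. -/
def homotopyPred (c : ℝ) {k : ℕ} (a : Form k (E × ℝ)) : Form (k - 1) (E × ℝ) :=
  lift fun υ x => ∫ s in υ..c, pull s (fun p => contr rig (a p)) x

/-- The homotopy operator in positive degree. -/
def homotopyOp (c : ℝ) {k : ℕ} (a : Form (k + 1) (E × ℝ)) : Form k (E × ℝ) := homotopyPred c a

/-- The form `kappaMu c η a` for a form `a` of degree at least two. -/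
def kappaSucc (c : ℝ) {k : ℕ} (η : E × ℝ → E × ℝ) (a : Form (k + 2) (E × ℝ)) : Form k (E × ℝ) :=
  kappaMu c η a

/-- The pullback of forms under the retraction of the collar onto the slice `Φ = c`. -/
def slicePullback (c : ℝ) {k : ℕ} (a : Form k (E × ℝ)) : Form k (E × ℝ) :=
  lift fun _ => pull c a

theorem homotopyPred_apply (c : ℝ) {k : ℕ} (a : Form k (E × ℝ)) (p : E × ℝ) :
    homotopyPred c a p = liftL E (k - 1)
      (∫ s in p.2..c, pullL E (k - 1) (contrL k rig (a (p.1, s)))) := by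
  simp only [← contr_eq_contrL]
  rfl

theorem homotopyOp_apply (c : ℝ) {k : ℕ} (a : Form (k + 1) (E × ℝ)) (p : E × ℝ) :
    homotopyOp c a p = liftL E k (∫ s in p.2..c, pullL E k (curryL k rig (a (p.1, s)))) :=
  homotopyPred_apply c a p

theorem slicePullback_apply (c : ℝ) {k : ℕ} (a : Form k (E × ℝ)) (p : E × ℝ) :
    slicePullback c a p = liftL E k (pullL E k (a (p.1, c))) := rfl

/-- The sign of the first term comes from `i_η i_v = -i_v i_η`. Written as an anticommutator of
`i_η` with the homotopy operator, `kappaMu` enters the commutator computations purely algebraically.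
-/
theorem kappaMu_eq (c : ℝ) {k : ℕ} (η : E × ℝ → E × ℝ) (a : Form (k + 1) (E × ℝ)) (p : E × ℝ) :
    kappaMu c η a p =
      -(homotopyPred c (fun q => (a q).curryLeft (η q)) p +
        contr (η p) (homotopyOp c a p)) := by
  have h : ∀ s, pull s (fun p => contr (η p) ((a p).curryLeft rig)) p.1 =
      -pull s (fun p => contr rig ((a p).curryLeft (η p))) p.1 := by
    intro s
    rw [pull_eq_pullL, pull_eq_pullL]
    have := contr_contr (η (p.1, s)) rig (a (p.1, s))
    refine (congrArg (pullL E (k - 1)) this).trans ?_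
    exact (pullL E (k - 1)).map_neg _
  have h2 : contr (η p) (homotopyOp c a p) = liftL E (k - 1)
      (contr (η p).1 (∫ s in p.2..c, pull s (fun p => (a p).curryLeft rig) p.1)) :=
    contr_liftL (k := k) (η p) _
  rw [h2]
  change liftL E (k - 1) ((∫ s in p.2..c, pull s (fun p => contr (η p) ((a p).curryLeft rig)) p.1) -
    contr (η p).1 (∫ s in p.2..c, pull s (fun p => (a p).curryLeft rig) p.1)) = _
  simp only [h, intervalIntegral.integral_neg]
  rw [map_sub, map_neg, neg_add]
  rfl

theorem contDiffOn_slice_integrand {k : ℕ} {U : Set (E × ℝ)} {a : Form k (E × ℝ)}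
    (ha : ContDiffOn ℝ ∞ a U) :
    ContDiffOn ℝ ∞ (fun q => pullL E (k - 1) (contrL k rig (a q))) U :=
  (pullL E (k - 1)).contDiff.comp_contDiffOn 
    ((contrL (V := E × ℝ) k rig).contDiff.comp_contDiffOn ha)

theorem ContDiffOn.homotopyPred [FiniteDimensional ℝ E] (c : ℝ) {k : ℕ} {U : Set (E × ℝ)}
    (hU : IsOpen U) {a : Form k (E × ℝ)} (ha : ContDiffOn ℝ ∞ a U) :
    ContDiffOn ℝ ∞ (homotopyPred c a) (columnSet c U) := by
  have : HoloRen.homotopyPred c a = fun p => _ := funext (homotopyPred_apply c a)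
  rw [this]
  exact (liftL E (k - 1)).contDiff.comp_contDiffOn
    (contDiffOn_column_integral hU (contDiffOn_slice_integrand ha) c)

theorem ContDiffOn.slicePullback (c : ℝ) {k : ℕ} {U : Set (E × ℝ)}
    {a : Form k (E × ℝ)} (ha : ContDiffOn ℝ ∞ a U) :
    ContDiffOn ℝ ∞ (slicePullback c a) {p | (p.1, c) ∈ U} :=
  (liftL E k).contDiff.comp_contDiffOn ((pullL E k).contDiff.comp_contDiffOn
    (ha.comp (f := fun p : E × ℝ => (p.1, c)) (by fun_prop) fun _ h => h))

theorem intervalIntegrable_slice {k : ℕ} {U : Set (E × ℝ)} {a : Form k (E × ℝ)}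
    (ha : ContinuousOn a U) {c : ℝ} {p : E × ℝ} (hp : p ∈ columnSet c U) :
    IntervalIntegrable (fun s => pullL E (k - 1) (contrL k rig (a (p.1, s))))
      MeasureTheory.volume p.2 c :=
  ContinuousOn.intervalIntegrable
    (((pullL E (k - 1)).continuous.comp (contrL k rig).continuous).comp_continuousOn
      (continuousOn_slice ha hp))

theorem homotopyPred_add {c : ℝ} {k : ℕ} {U : Set (E × ℝ)} {a a' : Form k (E × ℝ)}
    (ha : ContinuousOn a U) (ha' : ContinuousOn a' U) {p : E × ℝ} (hp : p ∈ columnSet c U) :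
    homotopyPred c (fun q => a q + a' q) p = homotopyPred c a p + homotopyPred c a' p := by
  simp only [homotopyPred_apply, map_add]
  rw [intervalIntegral.integral_add (intervalIntegrable_slice ha hp)
    (intervalIntegrable_slice ha' hp), map_add]

theorem homotopyPred_smul (c : ℝ) {k : ℕ} (r : ℝ) (a : Form k (E × ℝ)) (p : E × ℝ) :
    homotopyPred c (fun q => r • a q) p = r • homotopyPred c a p := by
  simp only [homotopyPred_apply, map_smul, intervalIntegral.integral_smul]

theorem homotopyPred_congr {c : ℝ} {k : ℕ} {U : Set (E × ℝ)} {a a' : Form k (E × ℝ)}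
    (h : ∀ q ∈ U, a q = a' q) {p : E × ℝ} (hp : p ∈ columnSet c U) :
    homotopyPred c a p = homotopyPred c a' p := by
  rw [homotopyPred_apply, homotopyPred_apply]
  congr 1
  refine intervalIntegral.integral_congr fun s hs => ?_
  simp only [h _ (hp s hs)]

theorem pullL_extDerivPred {k : ℕ} {a : Form (k - 1) (E × ℝ)} {x : E} {υ : ℝ}
    (ha : DifferentiableAt ℝ a (x, υ)) :
    pullL E k (extDerivPred a (x, υ)) = extDerivPred (pull υ a) x := by
  have h : HasFDerivAt (pull υ a) ((pullL E (k - 1)).comp ((fderiv ℝ a (x, υ)).comp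
      (ContinuousLinearMap.inl ℝ E ℝ))) x :=
    (pullL E (k - 1)).hasFDerivAt.comp x (ha.hasFDerivAt.comp x (hasFDerivAt_prodMk_left x υ))
  rw [extDerivPred_eq_altL, extDerivPred_eq_altL, h.fderiv]
  exact altL_compContinuousLinearMap _ _

theorem contr_rig_liftL {k : ℕ} (b : E [⋀^Fin k]→L[ℝ] ℝ) : contr rig (liftL E k b) = 0 := by
  rw [contr_liftL]
  simp [rig, contr_zero_left]

/-- Along `v` only the lower limit of the integral moves, which gives minus the integrand there.
Lifting it from the slice recovers `i_v a` itself because `i_v i_v a = 0`. -/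
theorem fderiv_homotopyOp_rig [FiniteDimensional ℝ E] {c : ℝ} {k : ℕ} {U : Set (E × ℝ)}
    (hU : IsOpen U) {a : Form (k + 1) (E × ℝ)} (ha : ContDiffOn ℝ ∞ a U) {p : E × ℝ}
    (hp : p ∈ columnSet c U) :
    fderiv ℝ (homotopyOp c a) p rig = -(a p).curryLeft rig := by
  have hPd : DifferentiableAt ℝ (homotopyOp c a) p :=
    ContDiffOn.differentiableAt_infty (isOpen_columnSet hU) (ContDiffOn.homotopyPred c hU ha) hp
  obtain ⟨x, υ⟩ := p
  have hG : ContinuousOn (fun q => pullL E k (curryL k rig (a q))) U :=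
    ((pullL E k).continuous.comp (curryL (V := E × ℝ) k rig).continuous).comp_continuousOn
      ha.continuousOn
  have hcont : ContinuousOn (fun s => pullL E k (curryL k rig (a (x, s)))) {s | (x, s) ∈ U} :=
    continuousOn_slice hG fun _ h => h
  have hs : IntervalIntegrable (fun s => pullL E k (curryL k rig (a (x, s))))
    MeasureTheory.volume υ c := (hcont.mono hp).intervalIntegrable
  have hO : IsOpen {s | (x, s) ∈ U} := hU.preimage (by fun_prop : Continuous fun s => (x, s))
  have hυ : υ ∈ {s | (x, s) ∈ U} := hp υ left_mem_uIcc
  have h1 := intervalIntegral.integral_hasDerivAt_left hs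
    (hcont.stronglyMeasurableAtFilter hO υ hυ) (hcont.continuousAt (hO.mem_nhds hυ))
  have h2 : HasDerivAt (fun s => homotopyOp c a (x, s))
      (liftL E k (-pullL E k (curryL k rig (a (x, υ))))) υ := by
    simp only [homotopyOp_apply]
    exact (liftL E k).hasFDerivAt.comp_hasDerivAt υ h1
  have h3 : HasDerivAt (fun s => homotopyOp c a (x, s))
      (fderiv ℝ (homotopyOp c a) (x, υ) rig) υ :=
    hPd.hasFDerivAt.comp_hasDerivAt (f := fun s => (x, s)) υ
      ((hasDerivAt_const υ x).prodMk (hasDerivAt_id υ))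
  rw [h3.unique h2, map_neg]
  congr 1
  exact liftL_pullL (contr_self_contr rig (a (x, υ)))

/-- The homotopy formula `d P + P d = Q - 1`. -/
theorem extDerivPred_homotopyPred_add [FiniteDimensional ℝ E] {c : ℝ} {k : ℕ} {U : Set (E × ℝ)}
    (hU : IsOpen U) {a : Form k (E × ℝ)} (ha : ContDiffOn ℝ ∞ a U) {p : E × ℝ}
    (hp : p ∈ columnSet c U) :
    extDerivPred (homotopyPred c a) p + homotopyOp c (extDeriv a) p = slicePullback c a p - a p := by
  have hPd : DifferentiableAt ℝ (homotopyPred c a) p :=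
    ContDiffOn.differentiableAt_infty (isOpen_columnSet hU) (ContDiffOn.homotopyPred c hU ha) hp
  have hF := contDiffOn_slice_integrand ha
  have hda : ContDiffOn ℝ ∞ (extDeriv a) U := ContDiffOn.extDeriv hU ha
  obtain ⟨x, υ⟩ := p
  -- The formula is checked separately on the pullback to the slice and on the contraction with `v`.
  -- The first is the fundamental theorem of calculus along the column, the second the derivative at
  -- the moving endpoint.
  refine form_ext ?_ ?_
  · rw [map_add, map_sub, pullL_extDerivPred hPd, homotopyOp_apply, slicePullback_apply,
      pullL_liftL, pullL_liftL]
    have hpull : pull υ (homotopyPred c a) =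
        fun y => ∫ s in υ..c, pullL E (k - 1) (contrL k rig (a (y, s))) := by
      funext y
      rw [pull_eq_pullL, homotopyPred_apply, pullL_liftL]
    rw [hpull, extDerivPred_eq_altL, (hasFDerivAt_integral_of_contDiffOn
      (F := fun q => pullL E (k - 1) (contrL k rig (a q))) hU (hF.of_le (by simp)) hp).fderiv]
    have hc : ContinuousOn (fun s => (fderiv ℝ (fun q => pullL E (k - 1) (contrL k rig (a q)))
        (x, s)).comp (ContinuousLinearMap.inl ℝ E ℝ)) (uIcc υ c) := by
      have := continuousOn_slice (ContDiffOn.fderiv_infty hU hF).continuousOn hp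
      exact this.clm_comp continuousOn_const
    have hci := ContinuousLinearMap.intervalIntegral_comp_comm (𝕜 := ℝ)
      (E := E →L[ℝ] E [⋀^Fin (k - 1)]→L[ℝ] ℝ) (F := E [⋀^Fin k]→L[ℝ] ℝ) (altL (V := E) k)
      (ContinuousOn.intervalIntegrable (μ := MeasureTheory.volume)
        (E := E →L[ℝ] E [⋀^Fin (k - 1)]→L[ℝ] ℝ) hc)
    rw [← hci]
    have hi1 : IntervalIntegrable (fun s => altL k ((fderiv ℝ (fun q => pullL E (k - 1)
        (contrL k rig (a q))) (x, s)).comp (ContinuousLinearMap.inl ℝ E ℝ)))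
        MeasureTheory.volume υ c := ((altL k).continuous.comp_continuousOn hc).intervalIntegrable
    have hi2 : IntervalIntegrable (fun s => pullL E k (curryL k rig (extDeriv a (x, s))))
        MeasureTheory.volume υ c := 
      (((pullL E k).continuous.comp (curryL (V := E × ℝ) k rig).continuous).comp_continuousOn
        (continuousOn_slice hda.continuousOn hp)).intervalIntegrable
    refine (intervalIntegral.integral_add hi1 hi2).symm.trans ?_
    -- By Cartan's formula for the constant field `v`, the two integrands add up to the
    -- `s`-derivative of `π_s^* a`; the integral is therefore the difference between the slices `c`
    -- and `υ`.
    rw [intervalIntegral.integral_eq_sub_of_hasDerivAt (f := fun s => pullL E k (a (x, s)))]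
    · intro s hs
      have has := ContDiffOn.differentiableAt_infty hU ha (hp s hs)
      have e1 : altL k ((fderiv ℝ (fun q => pullL E (k - 1) (contrL k rig (a q)))
          (x, s)).comp (ContinuousLinearMap.inl ℝ E ℝ)) =
          pullL E k (extDerivPred (fun q => contr rig (a q)) (x, s)) := by
        have hd : DifferentiableAt ℝ (fun q => contrL k rig (a q)) (x, s) :=
          (contrL k rig).differentiableAt.comp _ has
        rw [extDerivPred_eq_altL]
        refine Eq.trans ?_ (altL_compContinuousLinearMap _ _).symm
        simp only [contr_eq_contrL]
        have hd2 : fderiv ℝ (fun q => pullL E (k - 1) (contrL k rig (a q))) (x, s) =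
            (pullL E (k - 1)).comp (fderiv ℝ (fun q => contrL k rig (a q)) (x, s)) :=
          ((pullL E (k - 1)).hasFDerivAt.comp (x, s) hd.hasFDerivAt).fderiv
        rw [hd2]
        rfl
      rw [e1]
      have e2 := contr_extDeriv_add has rig
      have e3 : curryL k rig (extDeriv a (x, s)) = (extDeriv a (x, s)).curryLeft rig := rfl
      rw [e3, ← map_add, add_comm, e2]
      exact (pullL E k).hasFDerivAt.comp_hasDerivAt s (has.hasFDerivAt.comp_hasDerivAt
        (f := fun s => (x, s)) s ((hasDerivAt_const s x).prodMk (hasDerivAt_id s)))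
    · exact hi1.add hi2
  · rw [contr_add_right, contr_sub_right, slicePullback_apply, homotopyOp_apply, contr_rig_liftL, contr_rig_liftL, add_zero, zero_sub]
    cases k with
    | zero => exact (neg_zero (G := (E × ℝ) [⋀^Fin 0]→L[ℝ] ℝ)).symm
    | succ k =>
      have e4 := contr_extDeriv_add hPd (rig : E × ℝ)
      have e5 : (fun q => contr rig (homotopyPred c a q)) = fun _ => 0 := by
        funext q
        rw [homotopyPred_apply, contr_rig_liftL]
      rw [e5, extDerivPred_eq_altL, fderiv_fun_const, Pi.zero_apply, map_zero, add_zero] at e4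
      exact e4.trans (fderiv_homotopyOp_rig hU ha hp)

/-- The homotopy formula in positive degree. -/
theorem extDeriv_homotopyOp [FiniteDimensional ℝ E] {c : ℝ} {k : ℕ} {U : Set (E × ℝ)}
    (hU : IsOpen U) {a : Form (k + 1) (E × ℝ)} (ha : ContDiffOn ℝ ∞ a U) {p : E × ℝ}
    (hp : p ∈ columnSet c U) :
    extDeriv (homotopyOp c a) p = slicePullback c a p - a p - homotopyOp c (extDeriv a) p :=
  eq_sub_of_add_eq (extDerivPred_homotopyPred_add hU ha hp)

theorem ContDiffOn.homotopyOp [FiniteDimensional ℝ E] (c : ℝ) {k : ℕ} {U : Set (E × ℝ)}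
    (hU : IsOpen U) {a : Form (k + 1) (E × ℝ)} (ha : ContDiffOn ℝ ∞ a U) :
    ContDiffOn ℝ ∞ (homotopyOp c a) (columnSet c U) :=
  ContDiffOn.homotopyPred c hU ha

/-- The commutator of the homotopy operator with the Lie derivative. -/
theorem homotopyOp_lieForm_sub [FiniteDimensional ℝ E] {c : ℝ} {k : ℕ} {U : Set (E × ℝ)}
    (hU : IsOpen U) {a : Form (k + 1) (E × ℝ)} (ha : ContDiffOn ℝ ∞ a U) {η : E × ℝ → E × ℝ}
    (hη : ContDiffOn ℝ ∞ η U) {p : E × ℝ} (hp : p ∈ columnSet c U) :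
    homotopyOp c (lieForm η a) p - lieForm η (homotopyOp c a) p =
      slicePullback c (fun q => (a q).curryLeft (η q)) p - (slicePullback c a p).curryLeft (η p)
        + extDerivPred (kappaMu c η a) p - kappaSucc c η (extDeriv a) p := by
  have hO := isOpen_columnSet (c := c) hU
  have hda := ContDiffOn.extDeriv hU ha
  have hia : ContDiffOn ℝ ∞ (fun q => (a q).curryLeft (η q)) U :=
    ContDiffOn.contr (k := k + 1) hη ha
  have hida : ContDiffOn ℝ ∞ (fun q => (extDeriv a q).curryLeft (η q)) U :=
    ContDiffOn.contr (k := k + 2) hη hda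
  have hdia : ContDiffOn ℝ ∞ (extDeriv fun q => (a q).curryLeft (η q)) U :=
    ContDiffOn.extDeriv hU hia
  have hPa := ContDiffOn.homotopyOp c hU ha
  have hη' : ContDiffOn ℝ ∞ η (columnSet c U) := hη.mono columnSet_subset
  -- Cartan's formula is expanded on both sides, and the homotopy formula replaces `P d i_η a` and
  -- `i_η d P a`. The terms `i_η a` cancel, and what remains beside the slice terms combines into
  -- the two copies of `-(P i_η + i_η P)`.
  have h1 : homotopyOp c (lieForm η a) p =
      homotopyOp c (fun q => (extDeriv a q).curryLeft (η q)) p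
        + homotopyOp c (extDeriv fun q => (a q).curryLeft (η q)) p :=
    homotopyPred_add (k := k + 1) hida.continuousOn hdia.continuousOn hp
  have h2 : homotopyOp c (extDeriv fun q => (a q).curryLeft (η q)) p =
      slicePullback c (fun q => (a q).curryLeft (η q)) p - (a p).curryLeft (η p)
        - extDerivPred (homotopyPred c fun q => (a q).curryLeft (η q)) p :=
    eq_sub_of_add_eq' (extDerivPred_homotopyPred_add hU hia hp)
  have h3 : lieForm η (homotopyOp c a) p =
      (slicePullback c a p).curryLeft (η p) - (a p).curryLeft (η p)
        - (homotopyOp c (extDeriv a) p).curryLeft (η p)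
        + extDerivPred (fun q => contr (η q) (homotopyOp c a q)) p := by
    rw [lieForm, extDeriv_homotopyOp hU ha hp]
    rfl
  have h4 : extDerivPred (kappaMu c η a) p =
      -(extDerivPred (homotopyPred c fun q => (a q).curryLeft (η q)) p +
        extDerivPred (fun q => contr (η q) (homotopyOp c a q)) p) := by
    rw [← extDerivPred_add, ← extDerivPred_neg]
    · congr 1
      exact funext (kappaMu_eq c η a)
    · exact ContDiffOn.differentiableAt_infty hO (ContDiffOn.homotopyPred c hU hia) hp
    · exact ContDiffOn.differentiableAt_infty hO (ContDiffOn.contr hη' hPa) hp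
  have h5 : kappaSucc c η (extDeriv a) p =
      -(homotopyOp c (fun q => (extDeriv a q).curryLeft (η q)) p +
        (homotopyOp c (extDeriv a) p).curryLeft (η p)) := kappaMu_eq c η (extDeriv a) p
  rw [h1, h2, h3, h4, h5]
  abel

end CollarOperators

/-! ### Interchange of variations and spatial derivatives -/

section MixedDerivatives

variable {V Z : Type*} [NormedAddCommGroup V] [NormedSpace ℝ V]
  [NormedAddCommGroup Z] [NormedSpace ℝ Z]

theorem hasFDerivAt_slice_right {P : Type*} [NormedAddCommGroup P] [NormedSpace ℝ P]
    {H : P × V → Z} {t : P} {p : V} (h : DifferentiableAt ℝ H (t, p)) :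
    HasFDerivAt (fun q => H (t, q)) ((fderiv ℝ H (t, p)).comp (ContinuousLinearMap.inr ℝ P V)) p :=
  h.hasFDerivAt.comp p (hasFDerivAt_prodMk_right t p)

theorem hasDerivAt_slice_left {H : ℝ × V → Z} {t : ℝ} {p : V} (h : DifferentiableAt ℝ H (t, p)) :
    HasDerivAt (fun s => H (s, p)) (fderiv ℝ H (t, p) (1, 0)) t :=
  h.hasFDerivAt.comp_hasDerivAt (f := fun s => (s, p)) t
    ((hasDerivAt_id t).prodMk (hasDerivAt_const t p))

/-- Symmetry of mixed partial derivatives. -/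
theorem hasDerivAt_fderiv_slice {H : ℝ × V → Z} {t : ℝ} {p : V} (hH : ContDiffAt ℝ ∞ H (t, p)) :
    HasDerivAt (fun s => fderiv ℝ (fun q => H (s, q)) p)
      (fderiv ℝ (fun q => deriv (fun s => H (s, q)) t) p) t := by
  have hev : ∀ᶠ w in 𝓝 (t, p), DifferentiableAt ℝ H w :=
    ((hH.of_le (m := 1) (by simp)).eventually (by simp)).mono fun w hw =>
      hw.differentiableAt (by simp)
  have hD : DifferentiableAt ℝ (fderiv ℝ H) (t, p) :=
    (hH.fderiv_right (m := 1) (WithTop.coe_le_coe.2 (le_top (a := ((1 : ℕ∞) + 1))))).differentiableAt (by simp)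
  have hsymm : IsSymmSndFDerivAt ℝ H (t, p) := hH.isSymmSndFDerivAt (by
    rw [minSmoothness_of_isRCLikeNormedField]; exact WithTop.coe_le_coe.2 (le_top (a := (2 : ℕ∞))))
  have h1 : HasDerivAt (fun s => (fderiv ℝ H (s, p)).comp (ContinuousLinearMap.inr ℝ ℝ V))
      ((fderiv ℝ (fderiv ℝ H) (t, p) (1, 0)).comp (ContinuousLinearMap.inr ℝ ℝ V)) t :=
    ((ContinuousLinearMap.compL ℝ V (ℝ × V) Z).flip
      (ContinuousLinearMap.inr ℝ ℝ V)).hasFDerivAt.comp_hasDerivAt t (hasDerivAt_slice_left hD)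
  have h2 : HasFDerivAt (fun q => fderiv ℝ H (t, q) (1, 0))
      ((ContinuousLinearMap.apply ℝ Z ((1 : ℝ), (0 : V))).comp
        ((fderiv ℝ (fderiv ℝ H) (t, p)).comp (ContinuousLinearMap.inr ℝ ℝ V))) p :=
    (ContinuousLinearMap.apply ℝ Z ((1 : ℝ), (0 : V))).hasFDerivAt.comp p
      (hasFDerivAt_slice_right hD)
  have e1 : (fun s => fderiv ℝ (fun q => H (s, q)) p) =ᶠ[𝓝 t]
      fun s => (fderiv ℝ H (s, p)).comp (ContinuousLinearMap.inr ℝ ℝ V) := by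
    have := (Continuous.prodMk_left p).tendsto t |>.eventually hev
    exact this.mono fun s hs => (hasFDerivAt_slice_right hs).fderiv
  have e2 : (fun q => deriv (fun s => H (s, q)) t) =ᶠ[𝓝 p] fun q => fderiv ℝ H (t, q) (1, 0) := by
    have := (Continuous.prodMk_right t).tendsto p |>.eventually hev
    exact this.mono fun s hs => (hasDerivAt_slice_left hs).deriv
  rw [e2.fderiv_eq, h2.fderiv]
  refine (h1.congr_of_eventuallyEq e1).congr_deriv ?_
  ext v
  exact hsymm.eq _ _

theorem deriv_deriv_comm {H : ℝ × ℝ → Z} {s t : ℝ} (hH : ContDiffAt ℝ ∞ H (s, t)) :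
    deriv (fun a => deriv (fun b => H (a, b)) t) s =
      deriv (fun b => deriv (fun a => H (a, b)) s) t := by
  have h := (ContinuousLinearMap.apply ℝ Z (1 : ℝ)).hasFDerivAt.comp_hasDerivAt s
    (hasDerivAt_fderiv_slice hH)
  exact h.deriv

end MixedDerivatives

/-! ### Smooth functionals of fields, their variations and the chain rule -/

section Families

section Reach

variable {V P : Type*} [NormedAddCommGroup V]

/-- A continuous choice of paths, issuing from each point, on which the values of a nonlocal
functional at that point depend. -/
structure Reach (V : Type*) [NormedAddCommGroup V] where
  path : V → ℝ → V
  continuous_path : Continuous fun q : V × ℝ => path q.1 q.2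
  path_zero : ∀ p, path p 0 = p

/-- The reach of local functionals. -/
def Reach.point (V : Type*) [NormedAddCommGroup V] : Reach V where
  path p _ := p
  continuous_path := continuous_fst
  path_zero _ := rfl

/-- The points whose reach is contained in `D`. -/
def Reach.core (r : Reach V) (D : Set V) : Set V := {p | ∀ u ∈ Icc (0 : ℝ) 1, r.path p u ∈ D}

/-- The parameters and points for which the reach of the point is contained in `U`. -/
def Reach.dom (r : Reach V) (U : Set (P × V)) : Set (P × V) :=
  {q | ∀ u ∈ Icc (0 : ℝ) 1, (q.1, r.path q.2 u) ∈ U}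

theorem Reach.isOpen_core (r : Reach V) {D : Set V} (hD : IsOpen D) : IsOpen (r.core D) :=
  isOpen_setOf_forall_mem_compact (hD.preimage r.continuous_path) isCompact_Icc

theorem Reach.dom_subset (r : Reach V) (U : Set (P × V)) : r.dom U ⊆ U := fun q hq => by
  have := hq 0 (by simp)
  rwa [r.path_zero] at this

theorem Reach.core_subset (r : Reach V) (D : Set V) : r.core D ⊆ D := fun q hq => by
  have := hq 0 (by simp)
  rwa [r.path_zero] at this

theorem Reach.core_point (D : Set V) : (Reach.point V).core D = D :=
  Set.Subset.antisymm ((Reach.point V).core_subset D) fun _ hp _ _ => hp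

theorem Reach.isOpen_dom [TopologicalSpace P] (r : Reach V) {U : Set (P × V)} (hU : IsOpen U) : IsOpen (r.dom U) := by
  refine isOpen_setOf_forall_mem_compact
    (U := (fun w : (P × V) × ℝ => (w.1.1, r.path w.1.2 w.2)) ⁻¹' U) (hU.preimage ?_) isCompact_Icc
  have := r.continuous_path.comp
    (f := fun w : (P × V) × ℝ => (w.1.2, w.2)) (by fun_prop)
  exact (by fun_prop : Continuous fun w : (P × V) × ℝ => w.1.1).prodMk this

end Reach

variable {V W Z P : Type*} [NormedAddCommGroup V] [NormedSpace ℝ V]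
  [NormedAddCommGroup W] [NormedSpace ℝ W] [NormedAddCommGroup Z] [NormedSpace ℝ Z]
  [NormedAddCommGroup P] [NormedSpace ℝ P] {r : Reach V} {D D' : Set V} {O : Set W}

/-- A smooth family of admissible fields, on an open set of parameters and points. -/
structure IsFamily (D : Set V) (O : Set W) (U : Set (P × V)) (Ψ : P → V → W) : Prop where
  isOpen : IsOpen U
  mem_base : ∀ q ∈ U, q.2 ∈ D
  smooth : ContDiffOn ℝ ∞ (fun q : P × V => Ψ q.1 q.2) U
  mem_values : ∀ q ∈ U, Ψ q.1 q.2 ∈ O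

/-- A functional whose values at a point depend smoothly on the field along the reach of the
point. -/
def SmoothFunctional (r : Reach V) (D : Set V) (O : Set W) (G : (V → W) → V → Z) : Prop :=
  ∀ (P : Type) [NormedAddCommGroup P] [NormedSpace ℝ P] [FiniteDimensional ℝ P]
    (U : Set (P × V)) (Ψ : P → V → W), IsFamily D O U Ψ →
    ContDiffOn ℝ ∞ (fun q : P × V => G (Ψ q.1) q.2) (r.dom U)

theorem IsFamily.mono {U : Set (P × V)} {Ψ : P → V → W} (h : IsFamily D O U Ψ) (hD : D ⊆ D') :
    IsFamily D' O U Ψ :=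
  ⟨h.isOpen, fun q hq => hD (h.mem_base q hq), h.smooth, h.mem_values⟩

theorem SmoothFunctional.mono {G : (V → W) → V → Z} (hG : SmoothFunctional r D' O G)
    (hD : D ⊆ D') : SmoothFunctional r D O G :=
  fun P _ _ _ U Ψ h => hG P U Ψ (h.mono hD)

/-- A linear isomorphism carries parameter spaces `Fin k → ℝ` to arbitrary finite-dimensional ones.
Later arguments need this freedom to adjoin parameters, as in `ℝ × P`. -/
theorem IsSmoothLocal.smoothFunctional {G : (V → W) → V → Z} (hG : IsSmoothLocal D O G)
    (r : Reach V) : SmoothFunctional r D O G := by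
  intro P _ _ _ U Ψ h
  let e : P ≃L[ℝ] (Fin (Module.finrank ℝ P) → ℝ) :=
    ContinuousLinearEquiv.ofFinrankEq (by simp)
  have hm : ContDiff ℝ ∞ fun q : (Fin (Module.finrank ℝ P) → ℝ) × V => (e.symm q.1, q.2) :=
    (e.symm.contDiff.comp contDiff_fst).prodMk contDiff_snd
  have hm' : ContDiff ℝ ∞ fun q : P × V => (e q.1, q.2) :=
    (e.contDiff.comp contDiff_fst).prodMk contDiff_snd
  have := hG _ _ (fun t => Ψ (e.symm t)) (h.isOpen.preimage hm.continuous)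
    (fun q hq => h.mem_base _ hq) (h.smooth.comp hm.contDiffOn fun _ hq => hq)
    (fun q hq => h.mem_values _ hq)
  have h2 := this.comp (s := U) hm'.contDiffOn (fun q hq => by simpa using hq)
  refine (h2.mono (r.dom_subset U)).congr fun q _ => ?_
  simp

theorem IsFamily.isOpen_slice {U : Set (P × V)} {Ψ : P → V → W} (h : IsFamily D O U Ψ) (t : P) :
    IsOpen {q | (t, q) ∈ U} := h.isOpen.preimage (by fun_prop)

theorem IsFamily.isField {U : Set (P × V)} {Ψ : P → V → W} (h : IsFamily D O U Ψ) (t : P) :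
    IsField O {q | (t, q) ∈ U} (Ψ t) :=
  ⟨h.smooth.comp (f := fun q => (t, q)) (by fun_prop) fun _ hq => hq,
    fun q hq => h.mem_values (t, q) hq⟩

/-- The natural domain of a family of fields on `D`. -/
def familyDomain (D : Set V) (O : Set W) (Ψ : P → V → W) : Set (P × V) :=
  {q | q.2 ∈ D ∧ Ψ q.1 q.2 ∈ O}

theorem isFamily_familyDomain (hD : IsOpen D) (hO : IsOpen O) {Ψ : P → V → W}
    (hΨ : ContDiffOn ℝ ∞ (fun q : P × V => Ψ q.1 q.2) {q | q.2 ∈ D}) :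
    IsFamily D O (familyDomain D O Ψ) Ψ where
  isOpen := hΨ.continuousOn.isOpen_inter_preimage (hD.preimage continuous_snd) hO
  mem_base _ hq := hq.1
  smooth := hΨ.mono fun _ hq => hq.1
  mem_values _ hq := hq.2

theorem mem_dom_familyDomain {P : Type*} {Ψ : P → V → W} {φ : V → W} (hφ : IsField O D φ) {t : P}
    (ht : Ψ t = φ) {p : V} (hp : p ∈ r.core D) : (t, p) ∈ r.dom (familyDomain D O Ψ) :=
  fun u hu => ⟨hp u hu, by simpa [ht] using hφ.2 _ (hp u hu)⟩

theorem contDiffOn_affine {φ Y : V → W} (hφ : ContDiffOn ℝ ∞ φ D) (hY : ContDiffOn ℝ ∞ Y D) :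
    ContDiffOn ℝ ∞ (fun q : ℝ × V => (φ + q.1 • Y) q.2) {q | q.2 ∈ D} :=
  (hφ.comp contDiffOn_snd fun _ h => h).add
    (contDiffOn_fst.smul (hY.comp contDiffOn_snd fun _ h => h))

theorem contDiffOn_affine₂ {φ X Y : V → W} (hφ : ContDiffOn ℝ ∞ φ D) (hX : ContDiffOn ℝ ∞ X D)
    (hY : ContDiffOn ℝ ∞ Y D) :
    ContDiffOn ℝ ∞ (fun q : (ℝ × ℝ) × V => (φ + q.1.1 • X + q.1.2 • Y) q.2) {q | q.2 ∈ D} :=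
  ((hφ.comp contDiffOn_snd fun _ h => h).add
    (contDiff_fst.fst.contDiffOn.smul (hX.comp contDiffOn_snd fun _ h => h))).add
    (contDiff_fst.snd.contDiffOn.smul (hY.comp contDiffOn_snd fun _ h => h))

section Basic

variable {G : (V → W) → V → Z} {φ X Y : V → W}

/-- The values of a smooth functional along an affine family of fields. -/
theorem SmoothFunctional.contDiffAt_affine (hG : SmoothFunctional r D O G) (hD : IsOpen D)
    (hO : IsOpen O) (hφ : IsField O D φ) (hY : ContDiffOn ℝ ∞ Y D) {p : V} (hp : p ∈ r.core D) :
    ContDiffAt ℝ ∞ (fun q : ℝ × V => G (φ + q.1 • Y) q.2) (0, p) := by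
  have hf := isFamily_familyDomain (Ψ := fun t : ℝ => φ + t • Y) hD hO
    (contDiffOn_affine hφ.1 hY)
  have hmem : ((0 : ℝ), p) ∈ r.dom (familyDomain D O fun t : ℝ => φ + t • Y) :=
    mem_dom_familyDomain hφ (by simp) hp
  exact (hG ℝ _ _ hf).contDiffAt ((r.isOpen_dom hf.isOpen).mem_nhds hmem)

theorem SmoothFunctional.contDiffAt_affine₂ (hG : SmoothFunctional r D O G) (hD : IsOpen D)
    (hO : IsOpen O) (hφ : IsField O D φ) (hX : ContDiffOn ℝ ∞ X D) (hY : ContDiffOn ℝ ∞ Y D)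
    {p : V} (hp : p ∈ r.core D) :
    ContDiffAt ℝ ∞ (fun t : ℝ × ℝ => G (φ + t.1 • X + t.2 • Y) p) (0, 0) := by
  have hf := isFamily_familyDomain (Ψ := fun t : ℝ × ℝ => φ + t.1 • X + t.2 • Y) hD hO
    (contDiffOn_affine₂ hφ.1 hX hY)
  have hmem : ((0 : ℝ × ℝ), p) ∈ r.dom (familyDomain D O fun t : ℝ × ℝ => φ + t.1 • X + t.2 • Y) :=
    mem_dom_familyDomain hφ (by simp) hp
  exact ((hG (ℝ × ℝ) _ _ hf).contDiffAt ((r.isOpen_dom hf.isOpen).mem_nhds hmem)).comp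
    (f := fun t : ℝ × ℝ => (t, p)) (0, 0) (by fun_prop)

theorem SmoothFunctional.hasDerivAt (hG : SmoothFunctional r D O G) (hD : IsOpen D)
    (hO : IsOpen O) (hφ : IsField O D φ) (hY : ContDiffOn ℝ ∞ Y D) {p : V} (hp : p ∈ r.core D) :
    HasDerivAt (fun t : ℝ => G (φ + t • Y) p) (delta0 G φ Y p) 0 := by
  have := (hG.contDiffAt_affine hD hO hφ hY hp).differentiableAt (by simp)
  exact (hasDerivAt_slice_left this).differentiableAt.hasDerivAt

theorem SmoothFunctional.contDiffOn (hG : SmoothFunctional r D O G) (hD : IsOpen D)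
    (hφ : IsField O D φ) : ContDiffOn ℝ ∞ (G φ) (r.core D) := by
  have hf : IsFamily (P := ℝ) D O {q | q.2 ∈ D} fun _ => φ :=
    ⟨hD.preimage continuous_snd, fun _ h => h, hφ.1.comp contDiffOn_snd fun _ h => h,
      fun q hq => hφ.2 _ hq⟩
  exact (hG ℝ _ _ hf).comp (f := fun p => ((0 : ℝ), p)) (by fun_prop) fun p hp u hu => hp u hu

theorem SmoothFunctional.differentiableAt (hG : SmoothFunctional r D O G) (hD : IsOpen D)
    (hφ : IsField O D φ) {p : V} (hp : p ∈ r.core D) : DifferentiableAt ℝ (G φ) p :=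
  ContDiffOn.differentiableAt_infty (r.isOpen_core hD) (hG.contDiffOn hD hφ) hp

/-- The spatial derivative commutes with variations. -/
theorem SmoothFunctional.delta0_fderiv (hG : SmoothFunctional r D O G) (hD : IsOpen D)
    (hO : IsOpen O) (hφ : IsField O D φ) (hY : ContDiffOn ℝ ∞ Y D) {p : V} (hp : p ∈ r.core D) :
    HasDerivAt (fun t : ℝ => fderiv ℝ (G (φ + t • Y)) p) (fderiv ℝ (delta0 G φ Y) p) 0 :=
  hasDerivAt_fderiv_slice (hG.contDiffAt_affine hD hO hφ hY hp)

/-- Second variations are symmetric. -/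
theorem SmoothFunctional.delta0_comm (hG : SmoothFunctional r D O G) (hD : IsOpen D)
    (hO : IsOpen O) (hφ : IsField O D φ) (hX : ContDiffOn ℝ ∞ X D) (hY : ContDiffOn ℝ ∞ Y D)
    {p : V} (hp : p ∈ r.core D) :
    delta0 (fun χ => delta0 G χ Y) φ X p = delta0 (fun χ => delta0 G χ X) φ Y p := by
  refine (deriv_deriv_comm (hG.contDiffAt_affine₂ hD hO hφ hX hY hp)).trans ?_
  simp only [delta0, add_right_comm]

/-- Directional derivatives in field space reduce to the Fréchet derivative of a two-parameter
function at the origin, and that is linear. -/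
theorem SmoothFunctional.delta0_add_smul (hG : SmoothFunctional r D O G) (hD : IsOpen D)
    (hO : IsOpen O) (hφ : IsField O D φ) (hX : ContDiffOn ℝ ∞ X D) (hY : ContDiffOn ℝ ∞ Y D)
    (c : ℝ) {p : V} (hp : p ∈ r.core D) :
    delta0 G φ (X + c • Y) p = delta0 G φ X p + c • delta0 G φ Y p := by
  have h := (hG.contDiffAt_affine₂ hD hO hφ hX hY hp).differentiableAt (by simp)
  set H := fun t : ℝ × ℝ => G (φ + t.1 • X + t.2 • Y) p with hH
  have key : ∀ a b : ℝ, HasDerivAt (fun t : ℝ => G (φ + t • (a • X + b • Y)) p)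
      (fderiv ℝ H (0, 0) (a, b)) 0 := by
    intro a b
    have h1 : HasDerivAt (fun t : ℝ => (t * a, t * b)) (a, b) 0 := by
      simpa using ((hasDerivAt_id (0 : ℝ)).mul_const a).prodMk ((hasDerivAt_id (0 : ℝ)).mul_const b)
    have h2 : HasFDerivAt H (fderiv ℝ H (0, 0)) ((0 : ℝ) * a, (0 : ℝ) * b) := by
      simpa using h.hasFDerivAt
    have h3 := h2.comp_hasDerivAt (f := fun t : ℝ => (t * a, t * b)) 0 h1
    refine h3.congr_of_eventuallyEq (Filter.Eventually.of_forall fun t => ?_)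
    simp [hH, smul_add, smul_smul, add_assoc]
  have e1 := (key 1 c).deriv
  have e2 := (key 1 0).deriv
  have e3 := (key 0 1).deriv
  simp only [one_smul, zero_smul, add_zero, zero_add] at e1 e2 e3
  simp only [delta0, e1, e2, e3]
  rw [← map_smul, ← map_add]
  simp

end Basic

/-- A functional of a field and a variation, as a functional of the pair. -/
def pairFunctional (α : (V → W) → (V → W) → V → Z) : (V → W × W) → V → Z :=
  fun χ => α (fun p => (χ p).1) (fun p => (χ p).2)

/-- A field-space one-form that depends smoothly on the field along the reach of a point. -/
structure IsOneForm (r : Reach V) (D : Set V) (O : Set W) (α : (V → W) → (V → W) → V → Z) :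
    Prop where
  smooth : SmoothFunctional r D (O ×ˢ (univ : Set W)) (pairFunctional α)
  linear : ∀ U ⊆ D, IsOpen U → ∀ φ, IsField O U φ → ∀ X Y : V → W,
    ContDiffOn ℝ ∞ X U → ContDiffOn ℝ ∞ Y U → ∀ c : ℝ, ∀ p ∈ r.core U,
      α φ (X + c • Y) p = α φ X p + c • α φ Y p

theorem IsOneForm.mono {α : (V → W) → (V → W) → V → Z} (hα : IsOneForm r D' O α) (hD : D ⊆ D') :
    IsOneForm r D O α :=
  ⟨hα.smooth.mono hD, fun U hU => hα.linear U (hU.trans hD)⟩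

/-- A one-form, evaluated on a fixed variation. -/
theorem IsOneForm.smoothFunctional {α : (V → W) → (V → W) → V → Z} (hα : IsOneForm r D O α)
    {Y : V → W} (hY : ContDiffOn ℝ ∞ Y D) : SmoothFunctional r D O fun φ => α φ Y := by
  intro P _ _ _ U Ψ h
  exact hα.smooth P U (fun t p => (Ψ t p, Y p)) ⟨h.isOpen, h.mem_base,
    h.smooth.prodMk (hY.comp contDiffOn_snd h.mem_base), fun q hq => ⟨h.mem_values q hq, trivial⟩⟩

theorem IsOneForm.map_zero {α : (V → W) → (V → W) → V → Z} (hα : IsOneForm r D O α)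
    (hD : IsOpen D) {φ : V → W} (hφ : IsField O D φ) {p : V} (hp : p ∈ r.core D) :
    α φ 0 p = 0 := by
  have := hα.linear D Subset.rfl hD φ hφ 0 0 contDiffOn_const contDiffOn_const 1 p hp
  simpa using this

/-- The variation of a smooth functional is a smooth one-form. -/
theorem SmoothFunctional.isOneForm_delta0 {G : (V → W) → V → Z} (hG : SmoothFunctional r D O G)
    (hO : IsOpen O) : IsOneForm r D O (delta0 G) where
  linear U hUD hU φ hφ X Y hX hY c p hp :=
    (hG.mono hUD).delta0_add_smul hU hO hφ hX hY c hp
  smooth := by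
    intro P _ _ _ U χ h
    -- A family of pairs (field, variation) over `P` becomes a family of fields over `ℝ × P`, and
    -- the variation of `G` is a partial derivative of its values on the latter. Admissibility holds
    -- only on an open set, which contains the relevant points at `s = 0`.
    have hs : ContDiffOn ℝ ∞ (fun q : (ℝ × P) × V => (χ q.1.2 q.2).1 + q.1.1 • (χ q.1.2 q.2).2)
        {q | (q.1.2, q.2) ∈ U} := by
      have h1 : ContDiffOn ℝ ∞ (fun q : (ℝ × P) × V => χ q.1.2 q.2) {q | (q.1.2, q.2) ∈ U} :=
        h.smooth.comp (f := fun q : (ℝ × P) × V => (q.1.2, q.2)) (by fun_prop) fun _ h => h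
      exact h1.fst.add (contDiff_fst.fst.contDiffOn.smul h1.snd)
    set U' : Set ((ℝ × P) × V) :=
      {q | (q.1.2, q.2) ∈ U ∧ (χ q.1.2 q.2).1 + q.1.1 • (χ q.1.2 q.2).2 ∈ O} with hU'
    have hf : IsFamily D O U' fun (t : ℝ × P) p => (χ t.2 p).1 + t.1 • (χ t.2 p).2 := by
      refine ⟨?_, fun q hq => h.mem_base _ hq.1, hs.mono fun q hq => hq.1, fun q hq => hq.2⟩
      exact hs.continuousOn.isOpen_inter_preimage (h.isOpen.preimage (by fun_prop)) hO
    have hsm := hG (ℝ × P) U' _ hf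
    have hO' := r.isOpen_dom hf.isOpen
    have hmem : ∀ q ∈ r.dom U, (((0 : ℝ), q.1), q.2) ∈ r.dom U' := by
      intro q hq u hu
      refine ⟨hq u hu, ?_⟩
      simpa using (h.mem_values _ (hq u hu)).1
    have h2 : ContDiffOn ℝ ∞ (fun q : P × V => fderiv ℝ (fun q : (ℝ × P) × V =>
        G (fun p => (χ q.1.2 p).1 + q.1.1 • (χ q.1.2 p).2) q.2) ((0, q.1), q.2) ((1, 0), 0))
        (r.dom U) :=
      ((ContDiffOn.fderiv_infty hO' hsm).comp
        (f := fun q : P × V => (((0 : ℝ), q.1), q.2)) (by fun_prop) hmem).clm_apply contDiffOn_const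
    refine h2.congr fun q hq => ?_
    have h3 := ContDiffOn.differentiableAt_infty hO' hsm (hmem q hq)
    have h4 : HasDerivAt (fun s : ℝ => ((s, q.1), q.2)) (((1 : ℝ), (0 : P)), (0 : V)) 0 :=
      ((hasDerivAt_id _).prodMk (hasDerivAt_const _ _)).prodMk (hasDerivAt_const _ _)
    exact (h3.hasFDerivAt.comp_hasDerivAt (f := fun s : ℝ => ((s, q.1), q.2)) 0 h4).deriv

section ChainRule

variable [FiniteDimensional ℝ V] [CompleteSpace W]

/-- The chain rule for smooth functionals along curves of fields. -/
theorem SmoothFunctional.hasDerivAt_curve {G : (V → W) → V → Z} (hG : SmoothFunctional r D O G)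
    (hO : IsOpen O) {U : Set (ℝ × V)} {Ψ : ℝ → V → W} (h : IsFamily D O U Ψ) {Y : V → W}
    (hY : ∀ q, (0, q) ∈ U → HasDerivAt (fun t => Ψ t q) (Y q) 0) {p : V}
    (hp : ((0 : ℝ), p) ∈ r.dom U) :
    HasDerivAt (fun t => G (Ψ t) p) (delta0 G (Ψ 0) Y p) 0 := by
  -- `R` is the difference quotient, so `Ψ t = Ψ 0 + t • R t`, and it is smooth by Hadamard's lemma.
  -- The value at `s = 0` is set to `Y` so that `R 0 = Y` holds at all points, even where the curve
  -- need not be differentiable. Separating the two occurrences of `t` gives the function `(t, s) ↦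
  -- G (Ψ 0 + t • R s) p`, whose diagonal is the curve.
  set R : ℝ → V → W := fun s q => Function.update (slope (fun t => Ψ t q) 0) 0 (Y q) s with hR
  have hΨ : ∀ t, Ψ t = Ψ 0 + t • R t := by
    intro t
    funext q
    rcases eq_or_ne t 0 with ht | ht
    · simp [ht]
    · simp [hR, Function.update_of_ne ht, slope_def_module, smul_smul, mul_inv_cancel₀ ht]
  have hR0 : R 0 = Y := by
    funext q
    simp [hR]
  set U' : Set (ℝ × V) := {q | ∀ u ∈ Icc (0 : ℝ) 1, (u * q.1, q.2) ∈ U} with hU'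
  have hU'0 : ∀ q ∈ U', ((0 : ℝ), q.2) ∈ U := fun q hq => by simpa using hq 0 (by simp)
  have hU'o : IsOpen U' := isOpen_setOf_forall_mem_compact
    (U := (fun w : (ℝ × V) × ℝ => (w.2 * w.1.1, w.1.2)) ⁻¹' U) (h.isOpen.preimage (by fun_prop))
    isCompact_Icc
  have hRs : ContDiffOn ℝ ∞ (fun q : ℝ × V => R q.1 q.2) U' := by
    refine (contDiffOn_dslope_family h.isOpen h.smooth).congr fun q hq => ?_
    rw [dslope, (hY q.2 (hU'0 q hq)).deriv]
  have hs : ContDiffOn ℝ ∞ (fun q : (ℝ × ℝ) × V => Ψ 0 q.2 + q.1.1 • R q.1.2 q.2)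
      {q | (q.1.2, q.2) ∈ U'} :=
    (h.smooth.comp (f := fun q : (ℝ × ℝ) × V => ((0 : ℝ), q.2)) (by fun_prop)
      fun q hq => hU'0 _ hq).add (contDiff_fst.fst.contDiffOn.smul
      (hRs.comp (f := fun q : (ℝ × ℝ) × V => (q.1.2, q.2)) (by fun_prop) fun _ hq => hq))
  set U'' : Set ((ℝ × ℝ) × V) := {q | (q.1.2, q.2) ∈ U' ∧ Ψ 0 q.2 + q.1.1 • R q.1.2 q.2 ∈ O}
  have hf : IsFamily D O U'' fun (t : ℝ × ℝ) => Ψ 0 + t.1 • R t.2 :=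
    ⟨hs.continuousOn.isOpen_inter_preimage (hU'o.preimage (by fun_prop)) hO,
      fun q hq => h.mem_base _ (hU'0 _ hq.1), hs.mono fun q hq => hq.1, fun q hq => hq.2⟩
  have hmem : (((0 : ℝ), (0 : ℝ)), p) ∈ r.dom U'' := by
    intro u hu
    refine ⟨fun v _ => by simpa using hp u hu, ?_⟩
    simpa using h.mem_values _ (hp u hu)
  have hd : DifferentiableAt ℝ (fun t : ℝ × ℝ => G (Ψ 0 + t.1 • R t.2) p) (0, 0) := by
    have := ContDiffOn.differentiableAt_infty (r.isOpen_dom hf.isOpen) (hG (ℝ × ℝ) U'' _ hf) hmem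
    exact this.comp (f := fun t : ℝ × ℝ => (t, p)) (0, 0) (by fun_prop)
  have h1 := hasDerivAt_slice_left hd
  have h2 := hd.hasFDerivAt.comp_hasDerivAt (f := fun s => ((0 : ℝ), s)) (0 : ℝ)
    ((hasDerivAt_const _ _).prodMk (hasDerivAt_id _))
  have h3 := hd.hasFDerivAt.comp_hasDerivAt (f := fun s => (s, s)) (0 : ℝ)
    ((hasDerivAt_id _).prodMk (hasDerivAt_id _))
  simp only [hR0] at h1
  -- At `t = 0` the function does not depend on `s`. The diagonal derivative is thus the partial
  -- derivative in `t` at `s = 0`, that is, the variation along `Y`.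
  have h4 : fderiv ℝ (fun t : ℝ × ℝ => G (Ψ 0 + t.1 • R t.2) p) (0, 0) (0, 1) = 0 := by
    refine h2.unique ?_
    simp only [Function.comp_def, zero_smul]
    exact hasDerivAt_const _ _
  have h5 : ((1 : ℝ), (1 : ℝ)) = (1, 0) + (0, 1) := by simp
  rw [h5, map_add, h4, add_zero] at h3
  simp only [Function.comp_def, ← hΨ] at h3
  rw [← h1.deriv] at h3
  exact h3

/-- The product rule for one-forms. -/
theorem IsOneForm.hasDerivAt_curve {α : (V → W) → (V → W) → V → Z} (hα : IsOneForm r D O α)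
    (hD : IsOpen D) (hO : IsOpen O) {φ Y A : V → W} (hφ : IsField O D φ) (hY : ContDiffOn ℝ ∞ Y D)
    {X : ℝ → V → W} (hX : ContDiffOn ℝ ∞ (fun q : ℝ × V => X q.1 q.2)
      (familyDomain D O fun t : ℝ => φ + t • Y))
    (hX0 : ContDiffOn ℝ ∞ (X 0) D) (hA : ContDiffOn ℝ ∞ A D)
    (hXA : ∀ q ∈ D, HasDerivAt (fun t => X t q) (A q) 0) {p : V} (hp : p ∈ r.core D) :
    HasDerivAt (fun t => α (φ + t • Y) (X t) p)
      (delta0 (fun χ => α χ (X 0)) φ Y p + α φ A p) 0 := by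
  have hf := isFamily_familyDomain (Ψ := fun t : ℝ => φ + t • Y) hD hO
    (contDiffOn_affine hφ.1 hY)
  have hmem : ((0 : ℝ), p) ∈ r.dom (familyDomain D O fun t : ℝ => φ + t • Y) :=
    mem_dom_familyDomain hφ (by simp) hp
  have hf2 : IsFamily D (O ×ˢ (univ : Set W)) (familyDomain D O fun t : ℝ => φ + t • Y)
      fun t q => ((φ + t • Y) q, X t q) :=
    ⟨hf.isOpen, hf.mem_base, hf.smooth.prodMk hX, fun q hq => ⟨hf.mem_values q hq, trivial⟩⟩
  -- The one-form is a functional of the pair (field, variation), here on a curve with velocity `(Y,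
  -- A)`. Only this velocity matters, so `X t` may be replaced by `X 0 + t • A`.
  have h1 := hα.smooth.hasDerivAt_curve (hO.prod isOpen_univ) hf2 (Y := fun q => (Y q, A q))
    (fun q hq => by
      refine HasDerivAt.prodMk ?_ (hXA q hq.1)
      simpa using ((hasDerivAt_id (0 : ℝ)).smul_const (Y q)).const_add (φ q)) hmem
  refine h1.congr_deriv ?_
  -- For `t ≠ 0` the field `φ + t • Y` is admissible only on an open part of `D`. Linearity is
  -- therefore applied on that part, which contains the reach of `p` for small `t`.
  have hlin : (fun t : ℝ => α (φ + t • Y) (X 0 + t • A) p) =ᶠ[𝓝 0]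
      fun t => α (φ + t • Y) (X 0) p + t • α (φ + t • Y) A p := by
    have hev : ∀ᶠ t : ℝ in 𝓝 0, (t, p) ∈ r.dom (familyDomain D O fun t : ℝ => φ + t • Y) :=
      (Continuous.prodMk_left p).tendsto 0 |>.eventually ((r.isOpen_dom hf.isOpen).mem_nhds hmem)
    filter_upwards [hev] with t ht
    exact hα.linear _ (fun q hq => hq.1) (hf.isOpen_slice t) _ (hf.isField t) _ _
      (hX0.mono fun q hq => hq.1) (hA.mono fun q hq => hq.1) t p ht
  have hd1 := (hα.smoothFunctional hX0).hasDerivAt hD hO hφ hY hp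
  have hd2 := (hα.smoothFunctional hA).hasDerivAt hD hO hφ hY hp
  have hd3 := hd1.add ((hasDerivAt_id (0 : ℝ)).smul hd2)
  have hd4 := (hd3.congr_of_eventuallyEq hlin).deriv
  simp only [id, zero_smul, add_zero, zero_add, one_smul] at hd4
  rw [← hd4, delta0]
  congr 1
  funext t
  simp only [pairFunctional, Pi.add_apply, Pi.smul_apply, Prod.fst_add, Prod.smul_fst,
    Prod.snd_add, Prod.smul_snd, zero_smul, Pi.zero_apply, add_zero]
  rfl

end ChainRule

end Families

/-! ### Stability of smooth functionals and one-forms; anomalies of one-forms -/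

section Operations

variable {V W Z Z' P : Type*} [NormedAddCommGroup V] [NormedSpace ℝ V]
  [NormedAddCommGroup W] [NormedSpace ℝ W] [NormedAddCommGroup Z] [NormedSpace ℝ Z]
  [NormedAddCommGroup Z'] [NormedSpace ℝ Z'] [NormedAddCommGroup P] [NormedSpace ℝ P]
  {r : Reach V} {D : Set V} {O : Set W}

theorem contDiffOn_fderiv_slice {F : P × V → Z} {U : Set (P × V)} (hU : IsOpen U)
    (hF : ContDiffOn ℝ ∞ F U) :
    ContDiffOn ℝ ∞ (fun q : P × V => fderiv ℝ (fun v => F (q.1, v)) q.2) U := by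
  have h : ContDiffOn ℝ ∞ (fun q => (fderiv ℝ F q).comp (ContinuousLinearMap.inr ℝ P V)) U :=
    (ContDiffOn.fderiv_infty hU hF).clm_comp contDiffOn_const
  exact h.congr fun q hq =>
    (hasFDerivAt_slice_right (ContDiffOn.differentiableAt_infty hU hF hq)).fderiv

namespace SmoothFunctional

variable {G G' : (V → W) → V → Z}

theorem clm (hG : SmoothFunctional r D O G) (T : Z →L[ℝ] Z') :
    SmoothFunctional r D O fun χ p => T (G χ p) :=
  fun P _ _ _ U Ψ h => T.contDiff.comp_contDiffOn (hG P U Ψ h)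

theorem add (hG : SmoothFunctional r D O G) (hG' : SmoothFunctional r D O G') :
    SmoothFunctional r D O fun χ p => G χ p + G' χ p :=
  fun P _ _ _ U Ψ h => (hG P U Ψ h).add (hG' P U Ψ h)

theorem neg (hG : SmoothFunctional r D O G) : SmoothFunctional r D O fun χ p => -G χ p :=
  fun P _ _ _ U Ψ h => (hG P U Ψ h).neg

theorem sub (hG : SmoothFunctional r D O G) (hG' : SmoothFunctional r D O G') :
    SmoothFunctional r D O fun χ p => G χ p - G' χ p :=
  fun P _ _ _ U Ψ h => (hG P U Ψ h).sub (hG' P U Ψ h)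

protected theorem fderiv (hG : SmoothFunctional r D O G) :
    SmoothFunctional r D O fun χ => fderiv ℝ (G χ) :=
  fun P _ _ _ U Ψ h => contDiffOn_fderiv_slice (r.isOpen_dom h.isOpen) (hG P U Ψ h)

theorem of_contDiffOn {f : V → Z} (hf : ContDiffOn ℝ ∞ f D) :
    SmoothFunctional r D O fun _ : V → W => f :=
  fun _ _ _ _ U _ h => hf.comp contDiffOn_snd fun q hq => h.mem_base q (r.dom_subset U hq)

theorem contr {k : ℕ} {ξ : (V → W) → V → V} {a : (V → W) → Form k V}
    (hξ : SmoothFunctional r D O ξ) (ha : SmoothFunctional r D O a) :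
    SmoothFunctional r D O fun χ p => contr (ξ χ p) (a χ p) :=
  fun P _ _ _ U Ψ h => ContDiffOn.contr (hξ P U Ψ h) (ha P U Ψ h)

theorem extDerivPred {k : ℕ} {a : (V → W) → Form (k - 1) V} (ha : SmoothFunctional r D O a) :
    SmoothFunctional r D O fun χ => (extDerivPred (a χ) : Form k V) := by
  have := ha.fderiv.clm (altL (V := V) k)
  simpa only [← extDerivPred_eq_altL] using this

end SmoothFunctional

theorem delta0_const {S V W : Type*} [NormedAddCommGroup W] [NormedSpace ℝ W] (f : S → Z)
    (φ Y : V → W) : delta0 (fun _ => f) φ Y = 0 := by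
  funext p
  simp [delta0]

section Variations

variable {φ Y : V → W} {p : V}

theorem HasDerivAt.contr {k : ℕ} {f : ℝ → V} {f' : V} {g : ℝ → V [⋀^Fin k]→L[ℝ] ℝ}
    {g' : V [⋀^Fin k]→L[ℝ] ℝ} {t : ℝ} (hf : HasDerivAt f f' t) (hg : HasDerivAt g g' t) :
    HasDerivAt (fun t => contr (f t) (g t)) (contr f' (g t) + contr (f t) g') t := by
  have hL : HasFDerivAt (𝕜 := ℝ) (F := (V [⋀^Fin k]→L[ℝ] ℝ) →L[ℝ] V [⋀^Fin (k - 1)]→L[ℝ] ℝ)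
      (fun w => contrL k w) (contrL k) (f t) := ContinuousLinearMap.hasFDerivAt _
  have h1 : HasDerivAt (fun t => contrL k (f t)) (contrL k f') t :=
    HasFDerivAt.comp_hasDerivAt (𝕜 := ℝ) (F := V)
      (E := (V [⋀^Fin k]→L[ℝ] ℝ) →L[ℝ] V [⋀^Fin (k - 1)]→L[ℝ] ℝ) t hL hf
  simp only [contr_eq_contrL]
  exact h1.clm_apply hg

theorem SmoothFunctional.hasDerivAt_contr {k : ℕ} {ξ : (V → W) → V → V} {a : (V → W) → Form k V}
    (hξ : SmoothFunctional r D O ξ) (ha : SmoothFunctional r D O a) (hD : IsOpen D)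
    (hO : IsOpen O) (hφ : IsField O D φ) (hY : ContDiffOn ℝ ∞ Y D) (hp : p ∈ r.core D) :
    HasDerivAt (fun t : ℝ => HoloRen.contr (ξ (φ + t • Y) p) (a (φ + t • Y) p))
      (HoloRen.contr (delta0 ξ φ Y p) (a φ p) + HoloRen.contr (ξ φ p) (delta0 a φ Y p)) 0 := by
  simpa using HasDerivAt.contr (hξ.hasDerivAt hD hO hφ hY hp) (ha.hasDerivAt hD hO hφ hY hp)

/-- The exterior derivative commutes with variations. -/
theorem SmoothFunctional.hasDerivAt_extDerivPred {k : ℕ} {a : (V → W) → Form (k - 1) V}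
    (ha : SmoothFunctional r D O a) (hD : IsOpen D)
    (hO : IsOpen O) (hφ : IsField O D φ) (hY : ContDiffOn ℝ ∞ Y D) (hp : p ∈ r.core D) :
    HasDerivAt (fun t : ℝ => HoloRen.extDerivPred (k := k) (a (φ + t • Y)) p)
      (HoloRen.extDerivPred (delta0 a φ Y) p) 0 := by
  simp only [extDerivPred_eq_altL]
  exact (altL (V := V) k).hasFDerivAt.comp_hasDerivAt (0 : ℝ) (ha.delta0_fderiv hD hO hφ hY hp)

theorem SmoothFunctional.hasDerivAt_extDeriv {k : ℕ} {a : (V → W) → Form k V}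
    (ha : SmoothFunctional r D O a) (hD : IsOpen D)
    (hO : IsOpen O) (hφ : IsField O D φ) (hY : ContDiffOn ℝ ∞ Y D) (hp : p ∈ r.core D) :
    HasDerivAt (fun t : ℝ => _root_.extDeriv (a (φ + t • Y)) p)
      (_root_.extDeriv (delta0 a φ Y) p) 0 :=
  SmoothFunctional.hasDerivAt_extDerivPred (k := k + 1) ha hD hO hφ hY hp

/-- The Lie derivative along a field-independent vector field commutes with variations. -/
theorem SmoothFunctional.hasDerivAt_lieForm {k : ℕ} {a : (V → W) → Form k V}
    (ha : SmoothFunctional r D O a) {η : V → V} (hη : ContDiffOn ℝ ∞ η D) (hD : IsOpen D)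
    (hO : IsOpen O) (hφ : IsField O D φ) (hY : ContDiffOn ℝ ∞ Y D) (hp : p ∈ r.core D) :
    HasDerivAt (fun t : ℝ => lieForm η (a (φ + t • Y)) p) (lieForm η (delta0 a φ Y) p) 0 := by
  have h1 := (curryL (V := V) k (η p)).hasFDerivAt.comp_hasDerivAt (0 : ℝ)
    (ha.hasDerivAt_extDeriv hD hO hφ hY hp)
  have hη' : SmoothFunctional r D O fun _ : V → W => η := SmoothFunctional.of_contDiffOn hη
  have hc := SmoothFunctional.contr hη' ha
  have h2 := SmoothFunctional.hasDerivAt_extDerivPred hc hD hO hφ hY hp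
  have h3 : HoloRen.extDerivPred (delta0 (fun χ q => HoloRen.contr (η q) (a χ q)) φ Y) p =
      HoloRen.extDerivPred (fun q => HoloRen.contr (η q) (delta0 a φ Y q)) p := by
    refine extDerivPred_congr ?_
    filter_upwards [(r.isOpen_core hD).mem_nhds hp] with q hq
    have := (SmoothFunctional.hasDerivAt_contr hη' ha hD hO hφ hY hq).deriv
    rw [delta0_const] at this
    refine Eq.trans this ?_
    rw [Pi.zero_apply, contr_zero_left, zero_add]
  rw [h3] at h2
  exact h1.add h2

end Variations

section OneForms

variable {α β : (V → W) → (V → W) → V → Z}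

theorem IsOneForm.add (hα : IsOneForm r D O α) (hβ : IsOneForm r D O β) :
    IsOneForm r D O fun φ Y p => α φ Y p + β φ Y p where
  smooth := hα.smooth.add hβ.smooth
  linear U hUD hU φ hφ X Y hX hY c p hp := by
    simp only [hα.linear U hUD hU φ hφ X Y hX hY c p hp, hβ.linear U hUD hU φ hφ X Y hX hY c p hp,
      smul_add]
    abel

theorem IsOneForm.sub (hα : IsOneForm r D O α) (hβ : IsOneForm r D O β) :
    IsOneForm r D O fun φ Y p => α φ Y p - β φ Y p where
  smooth := hα.smooth.sub hβ.smooth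
  linear U hUD hU φ hφ X Y hX hY c p hp := by
    simp only [hα.linear U hUD hU φ hφ X Y hX hY c p hp, hβ.linear U hUD hU φ hφ X Y hX hY c p hp,
      smul_sub]
    abel

theorem IsOneForm.neg (hα : IsOneForm r D O α) : IsOneForm r D O fun φ Y p => -α φ Y p where
  smooth := hα.smooth.neg
  linear U hUD hU φ hφ X Y hX hY c p hp := by
    simp only [hα.linear U hUD hU φ hφ X Y hX hY c p hp, smul_neg]
    abel

theorem IsOneForm.map_add (hα : IsOneForm r D O α) (hD : IsOpen D) {φ X Y : V → W}
    (hφ : IsField O D φ) (hX : ContDiffOn ℝ ∞ X D) (hY : ContDiffOn ℝ ∞ Y D) {p : V}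
    (hp : p ∈ r.core D) : α φ (X + Y) p = α φ X p + α φ Y p := by
  have := hα.linear D Subset.rfl hD φ hφ X Y hX hY 1 p hp
  simpa using this

/-- A smooth one-form with values in forms, evaluated on a field and a variation. -/
theorem IsOneForm.contDiffOn (hα : IsOneForm r D O α) (hD : IsOpen D) {φ Y : V → W}
    (hφ : IsField O D φ) (hY : ContDiffOn ℝ ∞ Y D) : ContDiffOn ℝ ∞ (α φ Y) (r.core D) :=
  (hα.smoothFunctional hY).contDiffOn hD hφ

theorem IsOneForm.extDerivPred {k : ℕ} {α : (V → W) → (V → W) → Form (k - 1) V}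
    (hα : IsOneForm r D O α) : IsOneForm r D O fun φ Y => (extDerivPred (α φ Y) : Form k V) where
  smooth := SmoothFunctional.extDerivPred hα.smooth
  linear U hUD hU φ hφ X Y hX hY c p hp := by
    have hα' := hα.mono hUD
    have h1 : α φ (X + c • Y) =ᶠ[𝓝 p] fun q => α φ X q + c • α φ Y q := by
      filter_upwards [(r.isOpen_core hU).mem_nhds hp] with q hq
      exact hα.linear U hUD hU φ hφ X Y hX hY c q hq
    have hX' := (hα'.smoothFunctional hX).differentiableAt hU hφ hp
    have hY' := (hα'.smoothFunctional hY).differentiableAt hU hφ hp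
    have hY2 : DifferentiableAt ℝ (fun q => c • α φ Y q) p := hY'.const_smul c
    rw [extDerivPred_congr h1, extDerivPred_eq_altL, extDerivPred_eq_altL, extDerivPred_eq_altL,
      fderiv_fun_add hX' hY2, fderiv_fun_const_smul hY']
    simp

theorem IsOneForm.extDeriv {k : ℕ} {α : (V → W) → (V → W) → Form k V}
    (hα : IsOneForm r D O α) : IsOneForm r D O fun φ Y => extDeriv (α φ Y) :=
  IsOneForm.extDerivPred (k := k + 1) hα

end OneForms

section LieDerivatives

variable [FiniteDimensional ℝ V] (ρ : TensorRep V W)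

/-- A representation of `𝔤𝔩(V)` as a continuous linear map. -/
def TensorRep.toCLM : (V →L[ℝ] V) →L[ℝ] (W →L[ℝ] W) := LinearMap.toContinuousLinearMap ρ.toLinearMap

theorem lieField_apply (η : V → V) (φ : V → W) (p : V) :
    lieField ρ η φ p = fderiv ℝ φ p (η p) - ρ.toCLM (fderiv ℝ η p) (φ p) := rfl

theorem contDiffOn_lieField_family {U : Set (P × V)} (hU : IsOpen U) {s : P → V → V}
    {Ψ : P → V → W} (hs : ContDiffOn ℝ ∞ (fun q : P × V => s q.1 q.2) U)
    (hΨ : ContDiffOn ℝ ∞ (fun q : P × V => Ψ q.1 q.2) U) :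
    ContDiffOn ℝ ∞ (fun q : P × V => lieField ρ (s q.1) (Ψ q.1) q.2) U := by
  simp only [lieField_apply]
  exact ((contDiffOn_fderiv_slice hU hΨ).clm_apply hs).sub
    ((ρ.toCLM.contDiff.comp_contDiffOn (contDiffOn_fderiv_slice hU hs)).clm_apply hΨ)

theorem ContDiffOn.lieField (hD : IsOpen D) {η : V → V} {φ : V → W} (hη : ContDiffOn ℝ ∞ η D)
    (hφ : ContDiffOn ℝ ∞ φ D) : ContDiffOn ℝ ∞ (lieField ρ η φ) D := by
  have : HoloRen.lieField ρ η φ = fun p => _ := funext (lieField_apply ρ η φ)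
  rw [this]
  exact ((ContDiffOn.fderiv_infty hD hφ).clm_apply hη).sub
    ((ρ.toCLM.contDiff.comp_contDiffOn (ContDiffOn.fderiv_infty hD hη)).clm_apply hφ)

theorem lieField_zero (φ : V → W) : lieField ρ 0 φ = 0 := by
  funext p
  simp [lieField_apply]

theorem smoothFunctional_hat {ξ : (V → W) → V → V}
    (hξ : SmoothFunctional (Reach.point V) D O ξ) :
    SmoothFunctional (Reach.point V) D O (hat ρ ξ) := by
  intro P _ _ _ U Ψ h
  have hdom : (Reach.point V).dom U = U :=
    Set.Subset.antisymm ((Reach.point V).dom_subset U) fun _ hq _ _ => hq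
  have h1 := hξ P U Ψ h
  rw [hdom] at h1 ⊢
  exact contDiffOn_lieField_family ρ (s := fun t => ξ (Ψ t)) h.isOpen h1 h.smooth

/-- The variation of the Lie derivative of the field. -/
theorem hasDerivAt_hat {ξ : (V → W) → V → V} (hξ : SmoothFunctional (Reach.point V) D O ξ)
    (hD : IsOpen D) (hO : IsOpen O) {φ Y : V → W} (hφ : IsField O D φ) (hY : ContDiffOn ℝ ∞ Y D)
    {p : V} (hp : p ∈ D) :
    HasDerivAt (fun t : ℝ => hat ρ ξ (φ + t • Y) p)
      (lieField ρ (ξ φ) Y p + lieField ρ (delta0 ξ φ Y) φ p) 0 := by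
  have hp' : p ∈ (Reach.point V).core D := by rwa [Reach.core_point]
  have hφp := ContDiffOn.differentiableAt_infty hD hφ.1 hp
  have hYp := ContDiffOn.differentiableAt_infty hD hY hp
  have h1 : HasDerivAt (fun t : ℝ => fderiv ℝ (φ + t • Y) p) (fderiv ℝ Y p) 0 := by
    have : (fun t : ℝ => fderiv ℝ (φ + t • Y) p) = fun t => fderiv ℝ φ p + t • fderiv ℝ Y p := by
      funext t
      rw [fderiv_add hφp (hYp.const_smul t), fderiv_const_smul hYp]
    rw [this]
    simpa using ((hasDerivAt_id (0 : ℝ)).smul_const (fderiv ℝ Y p)).const_add (fderiv ℝ φ p)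
  have h2 := hξ.hasDerivAt hD hO hφ hY hp'
  have h3 := hξ.delta0_fderiv hD hO hφ hY hp'
  have h4 : HasDerivAt (fun t : ℝ => (φ + t • Y) p) (Y p) 0 := by
    simpa using ((hasDerivAt_id (0 : ℝ)).smul_const (Y p)).const_add (φ p)
  have h5 := (h1.clm_apply h2).sub
    ((ρ.toCLM.hasFDerivAt.comp_hasDerivAt (0 : ℝ) h3).clm_apply h4)
  simp only [zero_smul, add_zero, Function.comp_def] at h5
  refine h5.congr_deriv ?_
  simp only [lieField_apply]
  abel

variable [CompleteSpace W]

/-- The variation of the contraction of a one-form with the vector field of Lie derivatives. -/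
theorem IsOneForm.hasDerivAt_hat {α : (V → W) → (V → W) → V → Z} (hα : IsOneForm r D O α)
    {ξ : (V → W) → V → V} (hξ : SmoothFunctional (Reach.point V) D O ξ)
    (hD : IsOpen D) (hO : IsOpen O) {φ Y : V → W} (hφ : IsField O D φ) (hY : ContDiffOn ℝ ∞ Y D)
    {p : V} (hp : p ∈ r.core D) :
    HasDerivAt (fun t : ℝ => α (φ + t • Y) (hat ρ ξ (φ + t • Y)) p)
      (delta0 (fun χ => α χ (hat ρ ξ φ)) φ Y p + (α φ (lieField ρ (ξ φ) Y) p
        + α φ (lieField ρ (delta0 ξ φ Y) φ) p)) 0 := by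
  have hcore := Reach.core_point D
  have hξφ : ContDiffOn ℝ ∞ (ξ φ) D := hcore ▸ hξ.contDiffOn hD hφ
  have hδ : ContDiffOn ℝ ∞ (delta0 ξ φ Y) D :=
    hcore ▸ (hξ.isOneForm_delta0 hO).contDiffOn hD hφ hY
  have hA1 : ContDiffOn ℝ ∞ (lieField ρ (ξ φ) Y) D := ContDiffOn.lieField ρ hD hξφ hY
  have hA2 : ContDiffOn ℝ ∞ (lieField ρ (delta0 ξ φ Y) φ) D := ContDiffOn.lieField ρ hD hδ hφ.1
  have hf := isFamily_familyDomain (Ψ := fun t : ℝ => φ + t • Y) hD hO (contDiffOn_affine hφ.1 hY)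
  have hdom : (Reach.point V).dom (familyDomain D O fun t : ℝ => φ + t • Y) =
      familyDomain D O fun t : ℝ => φ + t • Y :=
    Set.Subset.antisymm ((Reach.point V).dom_subset _) fun _ hq _ _ => hq
  have hX : ContDiffOn ℝ ∞ (fun q : ℝ × V => hat ρ ξ (φ + q.1 • Y) q.2)
      (familyDomain D O fun t : ℝ => φ + t • Y) := by
    have := smoothFunctional_hat ρ hξ ℝ _ _ hf
    rwa [hdom] at this
  have hX0 : ContDiffOn ℝ ∞ (hat ρ ξ φ) D := ContDiffOn.lieField ρ hD hξφ hφ.1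
  have h1 := hα.hasDerivAt_curve hD hO hφ hY (X := fun t => hat ρ ξ (φ + t • Y))
    (A := lieField ρ (ξ φ) Y + lieField ρ (delta0 ξ φ Y) φ) hX (by simpa using hX0) (hA1.add hA2)
    (fun q hq => HoloRen.hasDerivAt_hat ρ hξ hD hO hφ hY hq) hp
  rw [hα.map_add hD hφ hA1 hA2 hp] at h1
  simpa only [zero_smul, add_zero] using h1

/-- The anomaly of a one-form depends on the vector field only through its value at the given
field. -/
theorem anomaly1_eq {k : ℕ} {α : (V → W) → (V → W) → Form k V} (hα : IsOneForm r D O α)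
    {ξ : (V → W) → V → V} (hξ : SmoothFunctional (Reach.point V) D O ξ)
    (hD : IsOpen D) (hO : IsOpen O) {φ Y : V → W} (hφ : IsField O D φ) (hY : ContDiffOn ℝ ∞ Y D)
    {p : V} (hp : p ∈ r.core D) :
    anomaly1 ρ ξ α φ Y p = delta0 (fun χ => α χ Y) φ (lieField ρ (ξ φ) φ) p
      + α φ (lieField ρ (ξ φ) Y) p - lieForm (ξ φ) (α φ Y) p := by
  -- Of the three terms given by the product rule for `δ I_ξ̂ α`, the first cancels the second half
  -- of `delta1` and the last cancels `iDeltaHat`; the variation of `ξ` disappears.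
  have h : delta0 (fun χ => α χ (hat ρ ξ χ)) φ Y p = _ :=
    (hα.hasDerivAt_hat ρ hξ hD hO hφ hY hp).deriv
  rw [anomaly1, lieFieldSpace1, delta1, iDeltaHat, h]
  change _ - _ + (_ + (_ + _)) - _ - _ = delta0 (fun χ => α χ Y) φ (hat ρ ξ φ) p + _ - _
  abel

end LieDerivatives

end Operations

/-! ### The homotopy operator as a functional with column reach -/

section ColumnReach

variable {E W : Type*} [NormedAddCommGroup E] [NormedSpace ℝ E]
  [NormedAddCommGroup W] [NormedSpace ℝ W]
  {D : Set (E × ℝ)} {O : Set W} {c : ℝ}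

/-- The reach consisting of the segments to the slice `Φ = c`. -/
def Reach.column (E : Type*) [NormedAddCommGroup E] (c : ℝ) : Reach (E × ℝ) where
  path p u := (p.1, p.2 + u * (c - p.2))
  continuous_path := by fun_prop
  path_zero _ := by simp

theorem Reach.core_column (D : Set (E × ℝ)) : (Reach.column E c).core D = columnSet c D := by
  ext q
  exact mem_columnSet_iff.symm

theorem Reach.mem_dom_column {P : Type*} {U : Set (P × (E × ℝ))} {q : P × (E × ℝ)} :
    q ∈ (Reach.column E c).dom U ↔ ∀ s ∈ uIcc q.2.2 c, (q.1, (q.2.1, s)) ∈ U :=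
  (mem_columnSet_iff (c := c) (U := {w : (P × E) × ℝ | (w.1.1, (w.1.2, w.2)) ∈ U})
    (q := ((q.1, q.2.1), q.2.2))).symm

variable {k : ℕ} {G : (E × ℝ → W) → Form k (E × ℝ)}

theorem SmoothFunctional.homotopyPred [FiniteDimensional ℝ E]
    (hG : SmoothFunctional (Reach.point (E × ℝ)) D O G) :
    SmoothFunctional (Reach.column E c) D O fun χ => homotopyPred c (G χ) := by
  intro P _ _ _ U Ψ h
  have hs : ContDiffOn ℝ ∞ (fun q : P × (E × ℝ) => G (Ψ q.1) q.2) U := by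
    refine (hG P U Ψ h).mono fun q hq _ _ => hq
  have hm : ContDiff ℝ ∞ (fun w : (P × E) × ℝ => (w.1.1, (w.1.2, w.2))) := by fun_prop
  have hF : ContDiffOn ℝ ∞ (fun w : (P × E) × ℝ => pullL E (k - 1)
      (contrL k rig (G (Ψ w.1.1) (w.1.2, w.2)))) {w | (w.1.1, (w.1.2, w.2)) ∈ U} :=
    (pullL E (k - 1)).contDiff.comp_contDiffOn ((contrL (V := E × ℝ) k rig).contDiff.comp_contDiffOn
      (hs.comp hm.contDiffOn fun _ h => h))
  have h1 := contDiffOn_column_integral (h.isOpen.preimage hm.continuous) hF c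
  have h2 := (liftL E (k - 1)).contDiff.comp_contDiffOn (h1.comp
    (f := fun q : P × (E × ℝ) => ((q.1, q.2.1), q.2.2)) (s := (Reach.column E c).dom U)
    (by fun_prop) fun q hq => Reach.mem_dom_column.1 hq)
  exact h2.congr fun q _ => homotopyPred_apply c _ _

/-- The column of integration does not depend on the field, so the variation passes under the
integral sign: `δ` commutes with the homotopy operator. -/
theorem SmoothFunctional.hasDerivAt_homotopyPred [FiniteDimensional ℝ E]
    (hG : SmoothFunctional (Reach.point (E × ℝ)) D O G) (hD : IsOpen D) (hO : IsOpen O)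
    {φ Y : E × ℝ → W} (hφ : IsField O D φ) (hY : ContDiffOn ℝ ∞ Y D) {p : E × ℝ}
    (hp : p ∈ columnSet c D) :
    HasDerivAt (fun t : ℝ => HoloRen.homotopyPred c (G (φ + t • Y)) p)
      (HoloRen.homotopyPred c (delta0 G φ Y) p) 0 := by
  have hf := isFamily_familyDomain (Ψ := fun t : ℝ => φ + t • Y) hD hO (contDiffOn_affine hφ.1 hY)
  have hs : ContDiffOn ℝ ∞ (fun q : ℝ × (E × ℝ) => G (φ + q.1 • Y) q.2)
      (familyDomain D O fun t : ℝ => φ + t • Y) := by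
    refine (hG ℝ _ _ hf).mono fun q hq _ _ => hq
  set U : Set (ℝ × ℝ) := {w | (w.1, (p.1, w.2)) ∈ familyDomain D O fun t : ℝ => φ + t • Y} with hUdef
  have hU : IsOpen U := hf.isOpen.preimage (by fun_prop)
  set F : ℝ × ℝ → E [⋀^Fin (k - 1)]→L[ℝ] ℝ := fun w =>
    pullL E (k - 1) (contrL k rig (G (φ + w.1 • Y) (p.1, w.2))) with hFdef
  have hF : ContDiffOn ℝ ∞ F U :=
    (pullL E (k - 1)).contDiff.comp_contDiffOn ((contrL (V := E × ℝ) k rig).contDiff.comp_contDiffOn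
      (hs.comp (f := fun w : ℝ × ℝ => (w.1, (p.1, w.2))) (by fun_prop) fun _ h => h))
  have hmem : ∀ s ∈ uIcc p.2 c, ((0 : ℝ), s) ∈ U := fun s hs =>
    ⟨hp s hs, by simpa using hφ.2 _ (hp s hs)⟩
  have h1 := (hasFDerivAt_integral_of_contDiffOn hU (hF.of_le (by simp)) hmem).hasDerivAt
  have hc : ContinuousOn (fun s => (fderiv ℝ F (0, s)).comp (ContinuousLinearMap.inl ℝ ℝ ℝ))
      (uIcc p.2 c) :=
    (continuousOn_slice (ContDiffOn.fderiv_infty hU hF).continuousOn hmem).clm_comp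
      continuousOn_const
  rw [ContinuousLinearMap.intervalIntegral_apply hc.intervalIntegrable] at h1
  have h2 := (liftL E (k - 1)).hasFDerivAt.comp_hasDerivAt (0 : ℝ) h1
  simp only [homotopyPred_apply]
  refine h2.congr_deriv ?_
  congr 1
  refine intervalIntegral.integral_congr fun s hs => ?_
  have hd := hasDerivAt_slice_left (ContDiffOn.differentiableAt_infty hU hF (hmem s hs))
  have hps : (p.1, s) ∈ (Reach.point (E × ℝ)).core D := by
    rw [Reach.core_point]; exact hp s hs
  have hd2 := ((pullL E (k - 1)).comp (contrL (V := E × ℝ) k rig)).hasFDerivAt.comp_hasDerivAt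
    (0 : ℝ) (hG.hasDerivAt hD hO hφ hY hps)
  exact hd.unique hd2

theorem IsOneForm.homotopyPred [FiniteDimensional ℝ E]
    {α : (E × ℝ → W) → (E × ℝ → W) → Form k (E × ℝ)}
    (hα : IsOneForm (Reach.point (E × ℝ)) D O α) :
    IsOneForm (Reach.column E c) D O fun φ Y => homotopyPred c (α φ Y) where
  smooth := SmoothFunctional.homotopyPred hα.smooth
  linear U hUD hU φ hφ X Y hX hY r p hp := by
    have hα' := hα.mono hUD
    rw [Reach.core_column] at hp
    have hcX := (hα'.contDiffOn hU hφ hX).continuousOn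
    have hcY := (hα'.contDiffOn hU hφ hY).continuousOn
    rw [Reach.core_point] at hcX hcY
    have hcY' : ContinuousOn (fun q => r • α φ Y q) U := hcY.const_smul r
    rw [homotopyPred_congr (a' := fun q => α φ X q + r • α φ Y q) (fun q hq =>
      hα.linear U hUD hU φ hφ X Y hX hY r q (by rwa [Reach.core_point])) hp,
      homotopyPred_add hcX hcY' hp, homotopyPred_smul]

end ColumnReach

/-! ### Algebra of the Lie derivative of forms -/

section LieFormAlgebra

variable {V : Type*} [NormedAddCommGroup V] [NormedSpace ℝ V] {k : ℕ} {D : Set V} {η : V → V}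
  {a a' : Form k V} {p : V}

theorem lieForm_apply (η : V → V) (a : Form k V) (p : V) :
    lieForm η a p = (extDeriv a p).curryLeft (η p)
      + extDerivPred (fun q => contr (η q) (a q)) p := rfl

theorem lieForm_add (hD : IsOpen D) (hη : ContDiffOn ℝ ∞ η D) (ha : ContDiffOn ℝ ∞ a D)
    (ha' : ContDiffOn ℝ ∞ a' D) (hp : p ∈ D) :
    lieForm η (fun q => a q + a' q) p = lieForm η a p + lieForm η a' p := by
  have h := ContDiffOn.differentiableAt_infty hD ha hp
  have h' := ContDiffOn.differentiableAt_infty hD ha' hp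
  have h1 := ContDiffOn.differentiableAt_infty hD (ContDiffOn.contr hη ha) hp
  have h2 := ContDiffOn.differentiableAt_infty hD (ContDiffOn.contr hη ha') hp
  simp only [lieForm_apply, contr_add_right]
  rw [extDeriv_fun_add h h', extDerivPred_add h1 h2, ContinuousAlternatingMap.curryLeft_add]
  simp only [_root_.add_apply]
  abel

theorem lieForm_neg (η : V → V) (a : Form k V) (p : V) :
    lieForm η (fun q => -a q) p = -lieForm η a p := by
  have h1 : ∀ q, contr (η q) (-a q) = -contr (η q) (a q) := fun q => by
    have := contr_sub_right (η q) 0 (a q)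
    rwa [zero_sub, contr_zero_right, zero_sub] at this
  have h2 : extDeriv (fun q => -a q) p = -extDeriv a p := extDerivPred_neg (k := k + 1) a p
  have h3 : (-extDeriv a p).curryLeft (η p) = -(extDeriv a p).curryLeft (η p) := rfl
  simp only [lieForm_apply, h1]
  rw [h2, extDerivPred_neg, h3]
  abel

theorem lieForm_sub (hD : IsOpen D) (hη : ContDiffOn ℝ ∞ η D) (ha : ContDiffOn ℝ ∞ a D)
    (ha' : ContDiffOn ℝ ∞ a' D) (hp : p ∈ D) :
    lieForm η (fun q => a q - a' q) p = lieForm η a p - lieForm η a' p := by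
  simp only [sub_eq_add_neg]
  rw [lieForm_add hD hη ha ha'.neg hp, lieForm_neg]

theorem lieForm_congr (h : a =ᶠ[𝓝 p] a') : lieForm η a p = lieForm η a' p := by
  rw [lieForm_apply, lieForm_apply, h.extDeriv_eq]
  congr 1
  exact extDerivPred_congr (h.mono fun q hq => by simp only [hq])

/-- By Cartan's formula and `dd = 0`, both sides are `d i_η d a`. -/
theorem lieForm_extDeriv (hD : IsOpen D) (hη : ContDiffOn ℝ ∞ η D) (ha : ContDiffOn ℝ ∞ a D)
    (hp : p ∈ D) : lieForm η (extDeriv a) p = extDeriv (lieForm η a) p := by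
  have hda := ContDiffOn.extDeriv hD ha
  have hia := ContDiffOn.contr hη ha
  have h1 : ContDiffOn ℝ ∞ (fun q => (extDeriv a q).curryLeft (η q)) D :=
    ContDiffOn.contr (k := k + 1) hη hda
  have h2 : lieForm η a = fun q => (extDeriv a q).curryLeft (η q)
      + extDerivPred (fun q => contr (η q) (a q)) q := rfl
  have h3 : extDeriv (extDeriv a) p = 0 := extDeriv_extDerivPred (k := k + 1) hD ha hp
  have h4 : (0 : V [⋀^Fin (k + 1 + 1)]→L[ℝ] ℝ).curryLeft (η p) = 0 := rfl
  rw [h2, extDeriv_fun_add (ContDiffOn.differentiableAt_infty hD h1 hp)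
    (ContDiffOn.differentiableAt_infty hD (ContDiffOn.extDerivPred hD hia) hp),
    extDeriv_extDerivPred hD hia hp, add_zero, lieForm_apply, h3, h4, zero_add]
  rfl

end LieFormAlgebra

/-! ### Field-independent anomalies commute with `d` and `δ` -/

section LieVariation

variable {V W : Type*} [NormedAddCommGroup V] [NormedSpace ℝ V] [FiniteDimensional ℝ V]
  [NormedAddCommGroup W] [NormedSpace ℝ W]
  {r : Reach V} {D : Set V} {O : Set W} (ρ : TensorRep V W) {k : ℕ}

/-- The anomaly of a one-form for a field-independent vector field, in terms of the variations of
the field and of the variation along the vector field. -/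
def lieVariation (η : V → V) (α : (V → W) → (V → W) → Form k V) (φ Y : V → W) : Form k V :=
  fun p => delta0 (fun χ => α χ Y) φ (lieField ρ η φ) p + α φ (lieField ρ η Y) p
    - lieForm η (α φ Y) p

variable {α β : (V → W) → (V → W) → Form k V} {η : V → V} {φ Y : V → W} {p : V}

theorem lieVariation_add (hα : IsOneForm r D O α) (hβ : IsOneForm r D O β) (hD : IsOpen D)
    (hO : IsOpen O) (hη : ContDiffOn ℝ ∞ η D) (hφ : IsField O D φ) (hY : ContDiffOn ℝ ∞ Y D)
    (hp : p ∈ r.core D) :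
    lieVariation ρ η (fun φ Y p => α φ Y p + β φ Y p) φ Y p =
      lieVariation ρ η α φ Y p + lieVariation ρ η β φ Y p := by
  have hφ' := ContDiffOn.lieField ρ hD hη hφ.1
  have h1 := ((hα.smoothFunctional hY).hasDerivAt hD hO hφ hφ' hp).add
    ((hβ.smoothFunctional hY).hasDerivAt hD hO hφ hφ' hp)
  have h2 : delta0 (fun χ p => α χ Y p + β χ Y p) φ (lieField ρ η φ) p = _ := h1.deriv
  simp only [lieVariation]
  rw [h2, lieForm_add (r.isOpen_core hD) (hη.mono (r.core_subset D)) (hα.contDiffOn hD hφ hY)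
    (hβ.contDiffOn hD hφ hY) hp]
  abel

theorem lieVariation_sub (hα : IsOneForm r D O α) (hβ : IsOneForm r D O β) (hD : IsOpen D)
    (hO : IsOpen O) (hη : ContDiffOn ℝ ∞ η D) (hφ : IsField O D φ) (hY : ContDiffOn ℝ ∞ Y D)
    (hp : p ∈ r.core D) :
    lieVariation ρ η (fun φ Y p => α φ Y p - β φ Y p) φ Y p =
      lieVariation ρ η α φ Y p - lieVariation ρ η β φ Y p := by
  have hφ' := ContDiffOn.lieField ρ hD hη hφ.1
  have h1 := ((hα.smoothFunctional hY).hasDerivAt hD hO hφ hφ' hp).sub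
    ((hβ.smoothFunctional hY).hasDerivAt hD hO hφ hφ' hp)
  have h2 : delta0 (fun χ p => α χ Y p - β χ Y p) φ (lieField ρ η φ) p = _ := h1.deriv
  simp only [lieVariation]
  rw [h2, lieForm_sub (r.isOpen_core hD) (hη.mono (r.core_subset D)) (hα.contDiffOn hD hφ hY)
    (hβ.contDiffOn hD hφ hY) hp]
  abel

/-- The exterior derivative commutes with each of the three terms: with the field-space variation,
with substitution of a variation, and with `£_η`. -/
theorem lieVariation_extDeriv (hα : IsOneForm r D O α) (hD : IsOpen D)
    (hO : IsOpen O) (hη : ContDiffOn ℝ ∞ η D) (hφ : IsField O D φ) (hY : ContDiffOn ℝ ∞ Y D)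
    (hp : p ∈ r.core D) :
    lieVariation ρ η (fun φ Y => extDeriv (α φ Y)) φ Y p =
      extDeriv (lieVariation ρ η α φ Y) p := by
  have hφ' := ContDiffOn.lieField ρ hD hη hφ.1
  have hY' := ContDiffOn.lieField ρ hD hη hY
  have hC := r.isOpen_core hD
  have hηC := hη.mono (r.core_subset D)
  have h1 : delta0 (fun χ => extDeriv (α χ Y)) φ (lieField ρ η φ) p = _ :=
    ((hα.smoothFunctional hY).hasDerivAt_extDeriv hD hO hφ hφ' hp).deriv
  have s1 := ((hα.smoothFunctional hY).isOneForm_delta0 hO).contDiffOn hD hφ hφ'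
  have s2 := hα.contDiffOn hD hφ hY'
  have s3 := ContDiffOn.lieForm hC hηC (hα.contDiffOn hD hφ hY)
  have d1 := ContDiffOn.differentiableAt_infty hC s1 hp
  have d2 := ContDiffOn.differentiableAt_infty hC s2 hp
  have d3 := ContDiffOn.differentiableAt_infty hC s3 hp
  have h2 : extDeriv (lieVariation ρ η α φ Y) p =
      extDeriv (delta0 (fun χ => α χ Y) φ (lieField ρ η φ)) p
        + extDeriv (α φ (lieField ρ η Y)) p - extDeriv (lieForm η (α φ Y)) p := by
    have e1 := extDerivPred_sub (k := k + 1) (d1.add d2) d3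
    have e2 := extDerivPred_add (k := k + 1) d1 d2
    refine e1.trans ?_
    congr 1
  rw [h2, ← lieForm_extDeriv hC hηC (hα.contDiffOn hD hφ hY) hp, ← h1]
  rfl

/-- The anomaly of the variation of a functional is the variation of its anomaly. -/
theorem hasDerivAt_anomaly [CompleteSpace W] {G : (V → W) → Form k V}
    (hG : SmoothFunctional r D O G)
    (hD : IsOpen D) (hO : IsOpen O) (hη : ContDiffOn ℝ ∞ η D) (hφ : IsField O D φ)
    (hY : ContDiffOn ℝ ∞ Y D) (hp : p ∈ r.core D) :
    HasDerivAt (fun t : ℝ => anomaly0 ρ (fun _ => η) G (φ + t • Y) p)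
      (lieVariation ρ η (delta0 G) φ Y p) 0 := by
  have hφ' := ContDiffOn.lieField ρ hD hη hφ.1
  have hY' := ContDiffOn.lieField ρ hD hη hY
  have hη' : SmoothFunctional (Reach.point V) D O fun _ : V → W => η :=
    SmoothFunctional.of_contDiffOn hη
  have hf := isFamily_familyDomain (Ψ := fun t : ℝ => φ + t • Y) hD hO (contDiffOn_affine hφ.1 hY)
  have hX : ContDiffOn ℝ ∞ (fun q : ℝ × V => lieField ρ η (φ + q.1 • Y) q.2)
      (familyDomain D O fun t : ℝ => φ + t • Y) :=
    contDiffOn_lieField_family ρ (s := fun _ => η) (Ψ := fun t : ℝ => φ + t • Y) hf.isOpen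
      (hη.comp contDiffOn_snd hf.mem_base) hf.smooth
  have h1 := (hG.isOneForm_delta0 hO).hasDerivAt_curve hD hO hφ hY
    (X := fun t => lieField ρ η (φ + t • Y)) (A := lieField ρ η Y) hX
    (by simpa using hφ') hY' (fun q hq => by
      have := hasDerivAt_hat ρ hη' hD hO hφ hY hq
      rw [delta0_const, lieField_zero, Pi.zero_apply, add_zero] at this
      exact this) hp
  simp only [zero_smul, add_zero] at h1
  -- The symmetry of second variations, `δδ = 0` in field space, turns the `Y`-variation of `δG`
  -- along `£_η φ` into the variation of `δG(Y)` along `£_η φ`.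
  rw [hG.delta0_comm hD hO hφ hY hφ' hp] at h1
  exact h1.sub (hG.hasDerivAt_lieForm hη hD hO hφ hY hp)

end LieVariation

/-! ### Smoothness and variation of `kappaMu` -/

section Kappa

variable {E W : Type*} [NormedAddCommGroup E] [NormedSpace ℝ E] [FiniteDimensional ℝ E]
  [NormedAddCommGroup W] [NormedSpace ℝ W]
  {D : Set (E × ℝ)} {O : Set W} {c : ℝ} {k : ℕ}

theorem SmoothFunctional.of_point {V Z : Type*} [NormedAddCommGroup V] [NormedSpace ℝ V]
    [NormedAddCommGroup Z] [NormedSpace ℝ Z] {D : Set V} {G : (V → W) → V → Z}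
    (hG : SmoothFunctional (Reach.point V) D O G) (r : Reach V) : SmoothFunctional r D O G :=
  fun P _ _ _ U Ψ h => (hG P U Ψ h).mono fun _ hq _ _ => r.dom_subset U hq

theorem ContDiffOn.kappaMu (hD : IsOpen D) {η : E × ℝ → E × ℝ} {a : Form (k + 1) (E × ℝ)}
    (hη : ContDiffOn ℝ ∞ η D) (ha : ContDiffOn ℝ ∞ a D) :
    ContDiffOn ℝ ∞ (kappaMu c η a) (columnSet c D) := by
  have : HoloRen.kappaMu c η a = fun p => _ := funext (kappaMu_eq c η a)
  rw [this]
  exact ((ContDiffOn.homotopyPred c hD (ContDiffOn.contr (k := k + 1) hη ha)).add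
    (ContDiffOn.contr (hη.mono columnSet_subset) (ContDiffOn.homotopyOp c hD ha))).neg

theorem SmoothFunctional.kappaMu {ξ : (E × ℝ → W) → E × ℝ → E × ℝ}
    {a : (E × ℝ → W) → Form (k + 1) (E × ℝ)} (hξ : SmoothFunctional (Reach.point _) D O ξ)
    (ha : SmoothFunctional (Reach.point _) D O a) :
    SmoothFunctional (Reach.column E c) D O fun χ => kappaMu c (ξ χ) (a χ) := by
  have h1 : SmoothFunctional (Reach.point _) D O fun χ q => (a χ q).curryLeft (ξ χ q) :=
    SmoothFunctional.contr (k := k + 1) hξ ha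
  have h2 : SmoothFunctional (Reach.column E c) D O fun χ => homotopyOp c (a χ) :=
    SmoothFunctional.homotopyPred (k := k + 1) ha
  have h3 := ((SmoothFunctional.homotopyPred (c := c) h1).add
    (SmoothFunctional.contr (hξ.of_point _) h2)).neg
  have : (fun χ => HoloRen.kappaMu c (ξ χ) (a χ)) = fun χ p => _ :=
    funext fun χ => funext (kappaMu_eq c (ξ χ) (a χ))
  rw [this]
  exact h3

/-- The variation of `kappaMu`. -/
theorem SmoothFunctional.hasDerivAt_kappaMu {ξ : (E × ℝ → W) → E × ℝ → E × ℝ}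
    {a : (E × ℝ → W) → Form (k + 1) (E × ℝ)} (hξ : SmoothFunctional (Reach.point _) D O ξ)
    (ha : SmoothFunctional (Reach.point _) D O a) (hD : IsOpen D) (hO : IsOpen O)
    {φ Y : E × ℝ → W} (hφ : IsField O D φ) (hY : ContDiffOn ℝ ∞ Y D) {p : E × ℝ}
    (hp : p ∈ columnSet c D) :
    HasDerivAt (fun t : ℝ => HoloRen.kappaMu c (ξ (φ + t • Y)) (a (φ + t • Y)) p)
      (HoloRen.kappaMu c (delta0 ξ φ Y) (a φ) p + HoloRen.kappaMu c (ξ φ) (delta0 a φ Y) p) 0 := by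
  have hp' : p ∈ (Reach.column E c).core D := by rwa [Reach.core_column]
  have h1 : SmoothFunctional (Reach.point _) D O fun χ q => (a χ q).curryLeft (ξ χ q) :=
    SmoothFunctional.contr (k := k + 1) hξ ha
  have h2 : SmoothFunctional (Reach.column E c) D O fun χ => homotopyOp c (a χ) :=
    SmoothFunctional.homotopyPred (k := k + 1) ha
  have d1 := h1.hasDerivAt_homotopyPred (c := c) hD hO hφ hY hp
  have d2 := SmoothFunctional.hasDerivAt_contr (hξ.of_point _) h2 hD hO hφ hY hp'
  have d3 : delta0 (fun χ => homotopyOp c (a χ)) φ Y p = homotopyOp c (delta0 a φ Y) p :=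
    (ha.hasDerivAt_homotopyPred (k := k + 1) hD hO hφ hY hp).deriv
  rw [d3] at d2
  have hpt : ∀ q ∈ D, q ∈ (Reach.point (E × ℝ)).core D := fun q hq => by
    rwa [Reach.core_point]
  have sξ : ContDiffOn ℝ ∞ (ξ φ) D := by
    simpa only [Reach.core_point] using hξ.contDiffOn hD hφ
  have sa : ContDiffOn ℝ ∞ (a φ) D := by
    simpa only [Reach.core_point] using ha.contDiffOn hD hφ
  have sδξ : ContDiffOn ℝ ∞ (delta0 ξ φ Y) D := by
    simpa only [Reach.core_point] using (hξ.isOneForm_delta0 hO).contDiffOn hD hφ hY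
  have sδa : ContDiffOn ℝ ∞ (delta0 a φ Y) D := by
    simpa only [Reach.core_point] using (ha.isOneForm_delta0 hO).contDiffOn hD hφ hY
  have d4 : HoloRen.homotopyPred c (delta0 (fun χ q => (a χ q).curryLeft (ξ χ q)) φ Y) p =
      HoloRen.homotopyPred c (fun q => (a φ q).curryLeft (delta0 ξ φ Y q)) p +
      HoloRen.homotopyPred c (fun q => (delta0 a φ Y q).curryLeft (ξ φ q)) p := by
    have i1 : ContinuousOn (fun q => (a φ q).curryLeft (delta0 ξ φ Y q)) D :=
      (ContDiffOn.contr (k := k + 1) sδξ sa).continuousOn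
    have i2 : ContinuousOn (fun q => (delta0 a φ Y q).curryLeft (ξ φ q)) D :=
      (ContDiffOn.contr (k := k + 1) sξ sδa).continuousOn
    rw [← homotopyPred_add i1 i2 hp]
    exact homotopyPred_congr (fun q hq =>
      (SmoothFunctional.hasDerivAt_contr (k := k + 1) hξ ha hD hO hφ hY (hpt q hq)).deriv) hp
  rw [d4] at d1
  have d5 := (d1.add d2).neg
  simp only [kappaMu_eq]
  refine d5.congr_deriv ?_
  abel

theorem homotopyPred_zero (c : ℝ) (p : E × ℝ) :
    homotopyPred c (fun _ => (0 : (E × ℝ) [⋀^Fin k]→L[ℝ] ℝ)) p = 0 := by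
  simp [homotopyPred_apply]

theorem kappaMu_congr {η : E × ℝ → E × ℝ} {a a' : Form (k + 1) (E × ℝ)}
    (h : ∀ q ∈ D, a q = a' q) {p : E × ℝ} (hp : p ∈ columnSet c D) :
    kappaMu c η a p = kappaMu c η a' p := by
  rw [kappaMu_eq, kappaMu_eq, homotopyOp, homotopyOp, homotopyPred_congr h hp,
    homotopyPred_congr (fun q hq => by rw [h q hq]) hp]

theorem kappaMu_zero_form (η : E × ℝ → E × ℝ) (p : E × ℝ) :
    kappaMu c η (fun _ => (0 : (E × ℝ) [⋀^Fin (k + 1)]→L[ℝ] ℝ)) p = 0 := by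
  rw [kappaMu_eq, homotopyOp, homotopyPred_zero]
  have h : (fun q => (0 : (E × ℝ) [⋀^Fin (k + 1)]→L[ℝ] ℝ).curryLeft (η q)) = fun _ => 0 := rfl
  rw [h, homotopyPred_zero]
  exact neg_eq_zero.2 ((zero_add _).trans (contr_zero_right (k := k) (η p)))

theorem kappaMu_zero_field (a : Form (k + 1) (E × ℝ)) (p : E × ℝ) :
    kappaMu c 0 a p = 0 := by
  rw [kappaMu_eq]
  have h : (fun q => (a q).curryLeft ((0 : E × ℝ → E × ℝ) q)) = fun _ => 0 := by
    funext q
    exact (a q).curryLeft.map_zero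
  rw [h, homotopyPred_zero, Pi.zero_apply, contr_zero_left, add_zero, neg_zero]

end Kappa

/-! ### Consequences of covariance and of the field equations -/

namespace Theory

section Restrict

variable {V W : Type*} [NormedAddCommGroup V] [NormedSpace ℝ V]
  [NormedAddCommGroup W] [NormedSpace ℝ W] {n : ℕ} {D D' : Set V} {O : Set W}

/-- The restriction of a theory to a smaller set. -/
def restrict (T : Theory n D O) (h : D' ⊆ D) : Theory n D' O where
  L := T.L
  θ := T.θ
  eom := T.eom
  smooth_L k U Ψ hU hD := T.smooth_L k U Ψ hU fun q hq => h (hD q hq)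
  smooth_θ k U Ψ hU hD := T.smooth_θ k U Ψ hU fun q hq => h (hD q hq)
  linear_θ U hU := T.linear_θ U (hU.trans h)
  variation U hU := T.variation U (hU.trans h)

theorem IsCovariant.restrict {T : Theory n D O} {ρ : TensorRep V W} (hT : T.IsCovariant ρ)
    (h : D' ⊆ D) : (T.restrict h).IsCovariant ρ :=
  fun U hU => hT U (hU.trans h)

theorem smoothFunctional_L (T : Theory n D O) (r : Reach V) : SmoothFunctional r D O T.L :=
  T.smooth_L.smoothFunctional r

theorem isOneForm_θ (T : Theory n D O) (r : Reach V) : IsOneForm r D O T.θ where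
  smooth := T.smooth_θ.smoothFunctional r
  linear U hUD hU φ hφ X Y hX hY c p hp :=
    T.linear_θ U hUD hU φ hφ X Y hX hY c p (r.core_subset U hp)

theorem contDiffOn_L (T : Theory n D O) (hD : IsOpen D) {φ : V → W} (hφ : IsField O D φ) :
    ContDiffOn ℝ ∞ (T.L φ) D := by
  simpa only [Reach.core_point] using (T.smoothFunctional_L (Reach.point V)).contDiffOn hD hφ

theorem contDiffOn_θ (T : Theory n D O) (hD : IsOpen D) {φ Y : V → W} (hφ : IsField O D φ)
    (hY : ContDiffOn ℝ ∞ Y D) : ContDiffOn ℝ ∞ (T.θ φ Y) D := by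
  simpa only [Reach.core_point] using (T.isOneForm_θ (Reach.point V)).contDiffOn hD hφ hY

theorem delta0_L_of_eom (T : Theory n D O) (hD : IsOpen D) {φ Y : V → W} (hφ : T.IsSolution φ)
    (hY : ContDiffOn ℝ ∞ Y D) {p : V} (hp : p ∈ D) :
    delta0 T.L φ Y p = extDeriv (T.θ φ Y) p := by
  rw [T.variation D Subset.rfl hD φ hφ.1 Y hY p hp, hφ.2 p hp, _root_.zero_apply,
    zero_add]

variable {ρ : TensorRep V W}

theorem IsCovariant.delta0_L {T : Theory n D O} (hT : T.IsCovariant ρ) (hD : IsOpen D)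
    {φ : V → W} (hφ : IsField O D φ) {η : V → V} (hη : ContDiffOn ℝ ∞ η D) {p : V} (hp : p ∈ D) :
    delta0 T.L φ (lieField ρ η φ) p = lieForm η (T.L φ) p :=
  sub_eq_zero.1 ((hT D Subset.rfl hD φ hφ η hη).1 p hp)

/-- Covariance is assumed for field-independent vector fields only. In this form it involves a
single vector field `η`, so that it can be applied to the value `ξ φ` of a field-dependent one. -/
theorem IsCovariant.delta0_θ [FiniteDimensional ℝ V] [CompleteSpace W] {T : Theory n D O}
    (hT : T.IsCovariant ρ) (hD : IsOpen D) (hO : IsOpen O) {φ Y : V → W} (hφ : IsField O D φ)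
    (hY : ContDiffOn ℝ ∞ Y D) {η : V → V} (hη : ContDiffOn ℝ ∞ η D) {p : V} (hp : p ∈ D) :
    delta0 (fun χ => T.θ χ Y) φ (lieField ρ η φ) p + T.θ φ (lieField ρ η Y) p =
      lieForm η (T.θ φ Y) p := by
  have hp' : p ∈ (Reach.point V).core D := by rwa [Reach.core_point]
  have h := anomaly1_eq ρ (T.isOneForm_θ (Reach.point V))
    (SmoothFunctional.of_contDiffOn (W := W) (O := O) hη) hD hO hφ hY hp'
  rw [(hT D Subset.rfl hD φ hφ η hη).2 Y hY p hp] at h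
  exact sub_eq_zero.1 h.symm

end Restrict

/-! ### The boundary canonical transformation and its anomalies in the collar -/

section Column

variable {E W : Type*} [NormedAddCommGroup E] [NormedSpace ℝ E] [FiniteDimensional ℝ E]
  [NormedAddCommGroup W] [NormedSpace ℝ W] {n : ℕ} {D : Set (E × ℝ)} {O : Set W}
  (T : Theory n D O) (c : ℝ) {ρ : TensorRep (E × ℝ) W}

theorem B_eq (φ : E × ℝ → W) : T.B c φ = homotopyOp c (T.L φ) := rfl

theorem Lam_eq (φ Y : E × ℝ → W) : T.Lam c φ Y = fun p => -homotopyOp c (T.θ φ Y) p := by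
  funext p
  rw [Lam, lift_eq_liftL, map_neg]
  rfl

theorem finB_eq (η : E × ℝ → E × ℝ) (φ : E × ℝ → W) :
    T.finB c η φ = slicePullback c fun q => (T.L φ q).curryLeft (η q) := rfl

/-- Splitting `η` at the slice into its tangential part and a multiple of `v` identifies the
definition with `-Q i_η θ' + i_η Q θ'`, the shape in which the commutator formula delivers it. -/
theorem finLam_eq (η : E × ℝ → E × ℝ) (φ Y : E × ℝ → W) (p : E × ℝ) :
    T.finLam c η φ Y p = -slicePullback c (fun q => (T.θ φ Y q).curryLeft (η q)) p
      + (slicePullback c (T.θ φ Y) p).curryLeft (η p) := by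
  set a := T.θ φ Y (p.1, c) with ha
  set w := η (p.1, c) with hw
  have h1 : (liftL E (n + 1) (pullL E (n + 1) a)).curryLeft (η p) =
      liftL E n ((pullL E (n + 1) a).curryLeft (η p).1) := contr_liftL (k := n + 1) _ _
  have h2 : (pullL E (n + 1) a).curryLeft w.1 = pullL E n (a.curryLeft (w.1, 0)) :=
    contr_pullL (k := n + 1) _ _
  have h3 : a.curryLeft w = a.curryLeft (w.1, 0) + w.2 • a.curryLeft rig := by
    rw [← map_smul, ← map_add]
    congr 1
    simp [rig]
  change liftL E n (-pullL E n (w.2 • a.curryLeft rig)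
      - (pullL E (n + 1) a).curryLeft (w.1 - (η p).1)) =
    -liftL E n (pullL E n (a.curryLeft w)) +
      (liftL E (n + 1) (pullL E (n + 1) a)).curryLeft (η p)
  rw [h1, h3, map_sub (pullL E (n + 1) a).curryLeft, h2]
  simp only [map_sub, map_add, map_neg]
  abel

theorem smoothFunctional_B : SmoothFunctional (Reach.column E c) D O (T.B c) :=
  SmoothFunctional.homotopyPred (k := n + 2) (T.smoothFunctional_L _)

theorem isOneForm_Lam : IsOneForm (Reach.column E c) D O (T.Lam c) := by
  have h := (IsOneForm.homotopyPred (c := c) (k := n + 1) (T.isOneForm_θ (Reach.point _))).neg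
  have : T.Lam c = fun φ Y p => -homotopyOp c (T.θ φ Y) p :=
    funext fun φ => funext fun Y => T.Lam_eq c φ Y
  rw [this]
  exact h

theorem isOneForm_θren (hO : IsOpen O) : IsOneForm (Reach.column E c) D O (T.θren c) :=
  ((T.isOneForm_θ _).add ((T.smoothFunctional_B c).isOneForm_delta0 hO)).sub
    (T.isOneForm_Lam c).extDeriv

theorem smoothFunctional_kappa {ξ : (E × ℝ → W) → E × ℝ → E × ℝ}
    (hξ : SmoothFunctional (Reach.point _) D O ξ) :
    SmoothFunctional (Reach.column E c) D O fun χ => T.kappa c (ξ χ) χ :=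
  SmoothFunctional.kappaMu (k := n + 1) hξ (T.smoothFunctional_L _)

theorem contDiffOn_mu (hD : IsOpen D) {η : E × ℝ → E × ℝ} (hη : ContDiffOn ℝ ∞ η D)
    {φ Y : E × ℝ → W} (hφ : IsField O D φ) (hY : ContDiffOn ℝ ∞ Y D) :
    ContDiffOn ℝ ∞ (T.mu c η φ Y) (columnSet c D) :=
  ContDiffOn.kappaMu hD hη (T.contDiffOn_θ hD hφ hY)

variable {T c}

theorem delta0_B (hD : IsOpen D) (hO : IsOpen O) {φ Y : E × ℝ → W} (hφ : IsField O D φ)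
    (hY : ContDiffOn ℝ ∞ Y D) {p : E × ℝ} (hp : p ∈ columnSet c D) :
    delta0 (T.B c) φ Y p = homotopyOp c (delta0 T.L φ Y) p :=
  ((T.smoothFunctional_L _).hasDerivAt_homotopyPred (k := n + 2) hD hO hφ hY hp).deriv

theorem finrank_prod_real (hE : Module.finrank ℝ E = n + 1) :
    Module.finrank ℝ (E × ℝ) = n + 2 := by
  rw [Module.finrank_prod, hE, Module.finrank_self]

theorem slicePullback_top (hE : Module.finrank ℝ E = n + 1) (a : Form (n + 2) (E × ℝ))
    (p : E × ℝ) : slicePullback c a p = 0 := by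
  rw [slicePullback_apply, form_eq_zero_of_finrank_lt (by omega) (pullL E (n + 2) (a (p.1, c))),
    map_zero]

theorem extDeriv_top (hE : Module.finrank ℝ E = n + 1) (a : Form (n + 2) (E × ℝ)) :
    extDeriv a = fun _ => 0 :=
  funext fun p => form_eq_zero_of_finrank_lt (by rw [finrank_prod_real hE]; omega) _

/-- The anomaly of `B`. -/
theorem IsCovariant.variation_B (hT : T.IsCovariant ρ) (hE : Module.finrank ℝ E = n + 1)
    (hD : IsOpen D) (hO : IsOpen O) {φ : E × ℝ → W} (hφ : IsField O D φ) {η : E × ℝ → E × ℝ}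
    (hη : ContDiffOn ℝ ∞ η D) {p : E × ℝ} (hp : p ∈ columnSet c D) :
    delta0 (T.B c) φ (lieField ρ η φ) p - lieForm η (T.B c φ) p =
      T.finB c η φ p + extDeriv (T.kappa c η φ) p := by
  have hφ' := ContDiffOn.lieField ρ hD hη hφ.1
  have h1 : homotopyOp c (delta0 T.L φ (lieField ρ η φ)) p =
      homotopyOp c (lieForm η (T.L φ)) p :=
    homotopyPred_congr (k := n + 2) (fun q hq => hT.delta0_L hD hφ hη hq) hp
  have h2 := homotopyOp_lieForm_sub hD (T.contDiffOn_L hD hφ) hη hp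
  -- `L'` has top degree, hence is closed and pulls back to zero on the slice. Of the commutator
  -- formula only `Q i_η L'` and the exact term survive, for every field and not only on solutions.
  have h3 : kappaSucc c η (extDeriv (T.L φ)) p = 0 := by
    rw [extDeriv_top hE]
    exact kappaMu_zero_form (k := n + 2) η p
  have h4 : (0 : (E × ℝ) [⋀^Fin (n + 2)]→L[ℝ] ℝ).curryLeft (η p) = 0 := rfl
  rw [delta0_B hD hO hφ hφ' hp, h1, B_eq, h2, h3, slicePullback_top hE, h4, sub_zero, sub_zero]
  rfl

/-- The anomaly of `Λ` on solutions. -/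
theorem IsCovariant.anomaly_Lam [CompleteSpace W] (hT : T.IsCovariant ρ)
    (hD : IsOpen D) (hO : IsOpen O) {φ Y : E × ℝ → W} (hφ : T.IsSolution φ)
    (hY : ContDiffOn ℝ ∞ Y D) {ξ : (E × ℝ → W) → E × ℝ → E × ℝ}
    (hξ : SmoothFunctional (Reach.point _) D O ξ) {p : E × ℝ} (hp : p ∈ columnSet c D) :
    anomaly1 ρ ξ (T.Lam c) φ Y p = T.finLam c (ξ φ) φ Y p
      + delta0 (fun χ => T.kappa c (ξ χ) χ) φ Y p - extDerivPred (T.mu c (ξ φ) φ Y) p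
      - T.kappa c (delta0 ξ φ Y) φ p := by
  have hp' : p ∈ (Reach.column E c).core D := by rwa [Reach.core_column]
  have hη : ContDiffOn ℝ ∞ (ξ φ) D := by
    simpa only [Reach.core_point] using hξ.contDiffOn hD hφ.1
  have hφ' := ContDiffOn.lieField ρ hD hη hφ.1.1
  have hY' := ContDiffOn.lieField ρ hD hη hY
  have hθ : IsOneForm (Reach.point _) D O T.θ := T.isOneForm_θ _
  have hθY := hθ.smoothFunctional hY
  have s1 : ContinuousOn (delta0 (fun χ => T.θ χ Y) φ (lieField ρ (ξ φ) φ)) D := by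
    simpa only [Reach.core_point] using ((hθY.isOneForm_delta0 hO).contDiffOn hD hφ.1 hφ').continuousOn
  have s2 : ContinuousOn (T.θ φ (lieField ρ (ξ φ) Y)) D :=
    (T.contDiffOn_θ hD hφ.1 hY').continuousOn
  have h1 : delta0 (fun χ => T.Lam c χ Y) φ (lieField ρ (ξ φ) φ) p =
      -homotopyOp c (delta0 (fun χ => T.θ χ Y) φ (lieField ρ (ξ φ) φ)) p := by
    simp only [Lam_eq]
    exact (hθY.hasDerivAt_homotopyPred (k := n + 1) hD hO hφ.1 hφ' hp).neg.deriv
  have h2 : homotopyOp c (delta0 (fun χ => T.θ χ Y) φ (lieField ρ (ξ φ) φ)) p +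
      homotopyOp c (T.θ φ (lieField ρ (ξ φ) Y)) p = homotopyOp c (lieForm (ξ φ) (T.θ φ Y)) p := by
    refine (homotopyPred_add (k := n + 1) s1 s2 hp).symm.trans ?_
    exact homotopyPred_congr (k := n + 1)
      (fun q hq => hT.delta0_θ hD hO hφ.1 hY hη hq) hp
  have h3 := homotopyOp_lieForm_sub hD (T.contDiffOn_θ hD hφ.1 hY) hη hp
  -- `κ_ξ` varies through `ξ` and through `L'`. On solutions `δL' = dθ'`, so the second part is the
  -- term `κ(dθ')` of the commutator formula applied to `θ'`.
  have h4 : delta0 (fun χ => T.kappa c (ξ χ) χ) φ Y p =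
      T.kappa c (delta0 ξ φ Y) φ p + kappaSucc c (ξ φ) (extDeriv (T.θ φ Y)) p := by
    refine (SmoothFunctional.hasDerivAt_kappaMu (k := n + 1) hξ (T.smoothFunctional_L _) hD hO hφ.1
      hY hp).deriv.trans ?_
    congr 1
    exact kappaMu_congr (k := n + 1) (fun q hq => T.delta0_L_of_eom hD hφ hY hq) hp
  rw [anomaly1_eq ρ (T.isOneForm_Lam c) hξ hD hO hφ.1 hY hp', h1, finLam_eq, h4]
  simp only [Lam_eq]
  rw [lieForm_neg]
  have h5 : extDerivPred (T.mu c (ξ φ) φ Y) p = extDerivPred (kappaMu c (ξ φ) (T.θ φ Y)) p := rfl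
  rw [h5]
  have h6 : extDerivPred (kappaMu c (ξ φ) (T.θ φ Y)) p = homotopyOp c (lieForm (ξ φ) (T.θ φ Y)) p
      - lieForm (ξ φ) (homotopyOp c (T.θ φ Y)) p
      - slicePullback c (fun q => (T.θ φ Y q).curryLeft (ξ φ q)) p
      + (slicePullback c (T.θ φ Y) p).curryLeft (ξ φ p)
      + kappaSucc c (ξ φ) (extDeriv (T.θ φ Y)) p := by
    rw [h3]
    abel
  rw [h6, ← h2]
  abel

/-- The renormalized Lagrangian vanishes. -/
theorem Lren_eq_zero (hE : Module.finrank ℝ E = n + 1) (hD : IsOpen D) {φ : E × ℝ → W}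
    (hφ : IsField O D φ) {p : E × ℝ} (hp : p ∈ columnSet c D) : T.Lren c φ p = 0 := by
  have h : homotopyOp c (extDeriv (T.L φ)) p = 0 := by
    rw [extDeriv_top hE]
    exact homotopyPred_zero (k := n + 3) c p
  rw [Lren, B_eq, extDeriv_homotopyOp hD (T.contDiffOn_L hD hφ) hp, slicePullback_top hE, h]
  abel

/-- On solutions, the renormalized symplectic potential is the pullback from the slice. -/
theorem θren_eq (hD : IsOpen D) (hO : IsOpen O) {φ Y : E × ℝ → W} (hφ : T.IsSolution φ)
    (hY : ContDiffOn ℝ ∞ Y D) {p : E × ℝ} (hp : p ∈ columnSet c D) :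
    T.θren c φ Y p = slicePullback c (T.θ φ Y) p := by
  have h1 : homotopyOp c (delta0 T.L φ Y) p = homotopyOp c (extDeriv (T.θ φ Y)) p :=
    homotopyPred_congr (k := n + 2) (fun q hq => T.delta0_L_of_eom hD hφ hY hq) hp
  have h2 : extDeriv (T.Lam c φ Y) p = -extDeriv (homotopyOp c (T.θ φ Y)) p := by
    rw [Lam_eq]
    exact extDerivPred_neg (k := n + 1) _ p
  rw [θren, delta0_B hD hO hφ.1 hY hp, h1, h2,
    extDeriv_homotopyOp hD (T.contDiffOn_θ hD hφ.1 hY) hp]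
  abel

/-- The variation of the finite part of the anomaly of `B`. -/
theorem hasDerivAt_finB (hD : IsOpen D) (hO : IsOpen O) {φ Y : E × ℝ → W} (hφ : IsField O D φ)
    (hY : ContDiffOn ℝ ∞ Y D) (η : E × ℝ → E × ℝ) {p : E × ℝ}
    (hp : (p.1, c) ∈ D) :
    HasDerivAt (fun t : ℝ => T.finB c η (φ + t • Y) p)
      (slicePullback c (fun q => (delta0 T.L φ Y q).curryLeft (η q)) p) 0 := by
  have hp' : (p.1, c) ∈ (Reach.point (E × ℝ)).core D := by rwa [Reach.core_point]
  exact ((liftL E (n + 1)).comp ((pullL E (n + 1)).comp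
    (curryL (V := E × ℝ) (n + 1) (η (p.1, c))))).hasFDerivAt.comp_hasDerivAt (0 : ℝ)
    ((T.smoothFunctional_L _).hasDerivAt hD hO hφ hY hp')

/-- The anomaly of the renormalized symplectic potential. -/
theorem IsCovariant.anomaly_θren [CompleteSpace W] (hT : T.IsCovariant ρ)
    (hE : Module.finrank ℝ E = n + 1) (hD : IsOpen D) (hO : IsOpen O) {φ Y : E × ℝ → W}
    (hφ : T.IsSolution φ) (hY : ContDiffOn ℝ ∞ Y D) {η : E × ℝ → E × ℝ}
    (hη : ContDiffOn ℝ ∞ η D) {p : E × ℝ} (hp : p ∈ columnSet c D) :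
    anomaly1 ρ (fun _ => η) (T.θren c) φ Y p =
      delta0 (T.finB c η) φ Y p - extDeriv (T.finLam c η φ Y) p := by
  have hp' : p ∈ (Reach.column E c).core D := by rwa [Reach.core_column]
  have hηs : ∀ r : Reach (E × ℝ), SmoothFunctional r D O fun _ : E × ℝ → W => η :=
    fun r => SmoothFunctional.of_contDiffOn hη
  have hB := T.smoothFunctional_B c
  have hκ := T.smoothFunctional_kappa c (hηs _)
  have hC := (Reach.column E c).isOpen_core hD
  have e1 := anomaly1_eq ρ (T.isOneForm_θren c hO) (hηs _) hD hO hφ.1 hY hp'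
  have e2 : lieVariation ρ η (T.θren c) φ Y p = lieVariation ρ η T.θ φ Y p
      + lieVariation ρ η (delta0 (T.B c)) φ Y p
      - lieVariation ρ η (fun φ Y => extDeriv (T.Lam c φ Y)) φ Y p := by
    have f1 := lieVariation_sub ρ ((T.isOneForm_θ _).add (hB.isOneForm_delta0 hO))
      (T.isOneForm_Lam c).extDeriv hD hO hη hφ.1 hY hp'
    have f2 := lieVariation_add ρ (T.isOneForm_θ _) (hB.isOneForm_delta0 hO) hD hO hη hφ.1 hY hp'
    rw [f2] at f1
    exact f1
  have e3 : lieVariation ρ η T.θ φ Y p = 0 :=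
    sub_eq_zero.2 (hT.delta0_θ hD hO hφ.1 hY hη (columnSet_subset hp))
  -- the variation of the anomaly of `B`
  have e4 : lieVariation ρ η (delta0 (T.B c)) φ Y p =
      delta0 (T.finB c η) φ Y p + extDeriv (delta0 (fun χ => T.kappa c η χ) φ Y) p := by
    have g1 := hasDerivAt_anomaly ρ hB hD hO hη hφ.1 hY hp'
    have g2 := (hasDerivAt_finB (T := T) hD hO hφ.1 hY η
      (columnSet_subset_slice hp)).differentiableAt.hasDerivAt.add
      (hκ.hasDerivAt_extDeriv hD hO hφ.1 hY hp')
    refine g1.unique (g2.congr_of_eventuallyEq ?_)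
    -- The anomaly of `B` is to be differentiated in the arbitrary direction `Y`, so its formula is
    -- needed off shell at `φ + t • Y`. That field is admissible only on part of the collar, to
    -- which the theory is restricted; the column over `p` lies in it for small `t`.
    have hf := isFamily_familyDomain (Ψ := fun t : ℝ => φ + t • Y) hD hO
      (contDiffOn_affine hφ.1.1 hY)
    have hmem : ((0 : ℝ), p) ∈ (Reach.column E c).dom
        (familyDomain D O fun t : ℝ => φ + t • Y) := mem_dom_familyDomain hφ.1 (by simp) hp'
    have hev := (Continuous.prodMk_left p).tendsto (0 : ℝ) |>.eventually
      (((Reach.column E c).isOpen_dom hf.isOpen).mem_nhds hmem)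
    filter_upwards [hev] with t ht
    have hsub : {q | (t, q) ∈ familyDomain D O fun t : ℝ => φ + t • Y} ⊆ D := fun q hq => hq.1
    exact (hT.restrict hsub).variation_B hE (hf.isOpen_slice t) hO (hf.isField t) (hη.mono hsub)
      ((Reach.mem_dom_column (q := (t, p))).1 ht)
  -- the differential of the anomaly of `Λ`
  have e5 : lieVariation ρ η (fun φ Y => extDeriv (T.Lam c φ Y)) φ Y p =
      extDeriv (T.finLam c η φ Y) p + extDeriv (delta0 (fun χ => T.kappa c η χ) φ Y) p := by
    rw [lieVariation_extDeriv ρ (T.isOneForm_Lam c) hD hO hη hφ.1 hY hp']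
    have g1 : lieVariation ρ η (T.Lam c) φ Y =ᶠ[𝓝 p] fun q => T.finLam c η φ Y q
        + delta0 (fun χ => T.kappa c η χ) φ Y q - extDerivPred (T.mu c η φ Y) q := by
      filter_upwards [hC.mem_nhds hp'] with q hq
      have k1 := anomaly1_eq ρ (T.isOneForm_Lam c) (hηs _) hD hO hφ.1 hY hq
      rw [Reach.core_column] at hq
      have k2 := hT.anomaly_Lam hD hO hφ hY (hηs _) hq
      have k3 : T.kappa c (delta0 (fun _ : E × ℝ → W => η) φ Y) φ q = 0 := by
        rw [delta0_const]
        exact kappaMu_zero_field (k := n + 1) _ q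
      rw [k3, sub_zero] at k2
      exact k1.symm.trans k2
    have s1 : ContDiffOn ℝ ∞ (T.finLam c η φ Y) (columnSet c D) := by
      have hθ := T.contDiffOn_θ hD hφ.1 hY
      have : T.finLam c η φ Y = fun p => _ := funext (T.finLam_eq c η φ Y)
      rw [this]
      exact ((ContDiffOn.slicePullback c (ContDiffOn.contr (k := n + 1) hη hθ)).mono
        columnSet_subset_slice).neg.add (ContDiffOn.contr (k := n + 1) (hη.mono columnSet_subset)
        ((ContDiffOn.slicePullback c hθ).mono columnSet_subset_slice))
    have s2 := (hκ.isOneForm_delta0 hO).contDiffOn hD hφ.1 hY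
    have s3 := T.contDiffOn_mu c hD hη hφ.1 hY
    have hC' := isOpen_columnSet (c := c) hD
    have d1 := ContDiffOn.differentiableAt_infty hC' s1 hp
    have d2 := ContDiffOn.differentiableAt_infty hC s2 hp'
    have d3 := ContDiffOn.differentiableAt_infty hC' (ContDiffOn.extDerivPred (k := n) hC' s3) hp
    rw [g1.extDeriv_eq]
    have k1 := extDerivPred_sub (k := n + 1) (d1.add d2) d3
    have k2 := extDerivPred_add (k := n + 1) d1 d2
    -- The `μ`-term drops out by `dd = 0`; in the lowest degree `extDerivPred` is zero already.
    have k3 : extDeriv (extDerivPred (T.mu c η φ Y)) p = 0 := extDeriv_extDerivPred hC' s3 hp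
    refine k1.trans ?_
    change _ - extDeriv (extDerivPred (T.mu c η φ Y)) p = _
    rw [k3, sub_zero]
    exact k2
  refine e1.trans ?_
  change lieVariation ρ η (T.θren c) φ Y p = _
  -- The exact term `d δκ` occurs in the anomalies of both `δB` and `dΛ` and cancels in their
  -- difference.
  rw [e2, e3, e4, e5]
  abel

end Column

end Theory

/-! ### Forms smooth up to the boundary and limits of pullbacks -/

section Boundary

variable {E : Type*} [NormedAddCommGroup E] [NormedSpace ℝ E] {N : Set E} {b c : ℝ} {k : ℕ}

theorem isOpen_collar (hN : IsOpen N) : IsOpen (collar N b) := hN.prod isOpen_Ioo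

theorem collar_subset_closedCollar : collar N b ⊆ closedCollar N b :=
  prod_mono Subset.rfl Ioo_subset_Ico_self

theorem mem_columnSet_collar (h0 : 0 < c) (hb : c < b) {p : E × ℝ} (hp : p ∈ collar N b) :
    p ∈ columnSet c (collar N b) := fun _ hs =>
  ⟨hp.1, (convex_Ioo (0 : ℝ) b).ordConnected.uIcc_subset hp.2 ⟨h0, hb⟩ hs⟩

theorem slicePullback_extDeriv {a : Form k (E × ℝ)} {p : E × ℝ}
    (ha : DifferentiableAt ℝ a (p.1, c)) :
    extDeriv (slicePullback c a) p = slicePullback c (extDeriv a) p := by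
  set f : E × ℝ →L[ℝ] E × ℝ :=
    (ContinuousLinearMap.inl ℝ E ℝ).comp (ContinuousLinearMap.fst ℝ E ℝ) with hf
  have hg : HasFDerivAt (fun q : E × ℝ => (q.1, c)) f p :=
    (hasFDerivAt_fst (𝕜 := ℝ) (E := E) (F := ℝ) (p := p)).prodMk (hasFDerivAt_const c p)
  have h1 : HasFDerivAt (fun q : E × ℝ => a (q.1, c)) ((fderiv ℝ a (p.1, c)).comp f) p :=
    HasFDerivAt.comp p (f := fun q : E × ℝ => (q.1, c)) ha.hasFDerivAt hg
  have h2 : HasFDerivAt (slicePullback c a)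
      (((liftL E k).comp (pullL E k)).comp ((fderiv ℝ a (p.1, c)).comp f)) p :=
    ((liftL E k).comp (pullL E k)).hasFDerivAt.comp p h1
  rw [extDeriv_eq_altL, h2.fderiv]
  exact (altL_compContinuousLinearMap (k := k + 1) (fderiv ℝ a (p.1, c)) f).symm

theorem lieForm_zero {V : Type*} [NormedAddCommGroup V] [NormedSpace ℝ V] (η : V → V) (p : V) :
    lieForm η (fun _ => (0 : V [⋀^Fin k]→L[ℝ] ℝ)) p = 0 := by
  have h := lieForm_neg η (fun _ => (0 : V [⋀^Fin k]→L[ℝ] ℝ)) p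
  simp only [neg_zero] at h
  ext v
  have hv := DFunLike.congr_fun h v
  rw [ContinuousAlternatingMap.neg_apply] at hv
  exact self_eq_neg.1 hv

/-- At `υ = 0` the form `a` has only a derivative within the closed collar. The slice direction
stays inside the collar and `N` is open, so the pullback nevertheless has a full derivative. -/
theorem hasFDerivAt_pull (hN : IsOpen N) {a : Form k (E × ℝ)}
    (ha : ContDiffOn ℝ ∞ a (closedCollar N b)) {x : E} (hx : x ∈ N) {υ : ℝ} (hυ : υ ∈ Ico 0 b) :
    HasFDerivAt (pull υ a) ((pullL E k).comp
      ((fderivWithin ℝ a (closedCollar N b) (x, υ)).comp (ContinuousLinearMap.inl ℝ E ℝ))) x := by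
  have h1 := (ha.differentiableOn (by simp) (x, υ) ⟨hx, hυ⟩).hasFDerivWithinAt
  have h2 : HasFDerivWithinAt (fun y : E => (y, υ)) (ContinuousLinearMap.inl ℝ E ℝ) N x :=
    (hasFDerivAt_prodMk_left x υ).hasFDerivWithinAt
  have h3 := (h1.comp (f := fun y : E => (y, υ)) x h2 fun y hy => ⟨hy, hυ⟩).hasFDerivAt
    (hN.mem_nhds hx)
  exact (pullL E k).hasFDerivAt.comp x h3

theorem ContDiffOn.pull {a : Form k (E × ℝ)} (ha : ContDiffOn ℝ ∞ a (closedCollar N b)) {υ : ℝ}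
    (hυ : υ ∈ Ico 0 b) : ContDiffOn ℝ ∞ (pull υ a) N :=
  (pullL E k).contDiff.comp_contDiffOn
    (ha.comp (contDiff_prodMk_left υ).contDiffOn fun _ hy => ⟨hy, hυ⟩)

/-- For a form that is smooth up to the boundary, the differentials of the pullbacks converge. -/
theorem tendsto_extDeriv_pull (hN : IsOpen N) (hb : 0 < b) {a : Form k (E × ℝ)}
    (ha : ContDiffOn ℝ ∞ a (closedCollar N b)) {x : E} (hx : x ∈ N) :
    Tendsto (fun υ => extDeriv (pull υ a) x) (𝓝[>] 0) (𝓝 (extDeriv (pull 0 a) x)) := by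
  -- Unique differentiability makes the derivative within the closed collar continuous up to `Φ =
  -- 0`. The differentials of the pullbacks are a fixed continuous linear function of it.
  have hS : UniqueDiffOn ℝ (closedCollar N b) := hN.uniqueDiffOn.prod (uniqueDiffOn_Ico 0 b)
  have hc := ha.continuousOn_fderivWithin hS (by simp)
  have h1 : Tendsto (fun υ : ℝ => (x, υ)) (𝓝[>] 0) (𝓝[closedCollar N b] (x, 0)) := by
    refine tendsto_nhdsWithin_iff.2
      ⟨((Continuous.prodMk_right x).tendsto 0).mono_left nhdsWithin_le_nhds, ?_⟩
    filter_upwards [Ioo_mem_nhdsGT hb] with υ hυ using ⟨hx, hυ.1.le, hυ.2⟩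
  have h2 := (hc (x, 0) ⟨hx, le_rfl, hb⟩).tendsto.comp h1
  have h3 : Continuous fun A : E × ℝ →L[ℝ] (E × ℝ) [⋀^Fin k]→L[ℝ] ℝ =>
      altL (V := E) (k + 1) ((pullL E k).comp (A.comp (ContinuousLinearMap.inl ℝ E ℝ))) :=
    (altL (V := E) (k + 1)).continuous.comp
      (continuous_const.clm_comp (continuous_id.clm_comp continuous_const))
  have h4 := (h3.tendsto _).comp h2
  rw [extDeriv_eq_altL, (hasFDerivAt_pull hN ha hx ⟨le_rfl, hb⟩).fderiv]
  refine h4.congr' ?_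
  filter_upwards [Ioo_mem_nhdsGT hb] with υ hυ
  rw [extDeriv_eq_altL, (hasFDerivAt_pull hN ha hx ⟨hυ.1.le, hυ.2⟩).fderiv]
  rfl

end Boundary

/-! ### Anomalies of the renormalized quantities and of the boundary symplectic potential -/

namespace Theory

variable {E W : Type*} [NormedAddCommGroup E] [NormedSpace ℝ E] [FiniteDimensional ℝ E]
  [NormedAddCommGroup W] [NormedSpace ℝ W] {n : ℕ} {D : Set (E × ℝ)} {O : Set W}
  {T : Theory n D O} {c : ℝ} {ρ : TensorRep (E × ℝ) W}

/-- Along the affine curve of fields for small parameters, and at all points near `p`, the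
renormalized Lagrangian is zero, so its variation and its Lie derivative both vanish. -/
theorem anomaly_Lren (hE : Module.finrank ℝ E = n + 1) (hD : IsOpen D) (hO : IsOpen O)
    {φ : E × ℝ → W} (hφ : IsField O D φ) {η : E × ℝ → E × ℝ} (hη : ContDiffOn ℝ ∞ η D)
    {p : E × ℝ} (hp : p ∈ columnSet c D) :
    anomaly0 ρ (fun _ => η) (T.Lren c) φ p = 0 := by
  have hX := ContDiffOn.lieField ρ hD hη hφ.1
  have hp' : p ∈ (Reach.column E c).core D := by rwa [Reach.core_column]
  have h1 : delta0 (T.Lren c) φ (lieField ρ η φ) p = 0 := by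
    have hf := isFamily_familyDomain (Ψ := fun t : ℝ => φ + t • lieField ρ η φ) hD hO
      (contDiffOn_affine hφ.1 hX)
    have hmem : ((0 : ℝ), p) ∈ (Reach.column E c).dom
        (familyDomain D O fun t : ℝ => φ + t • lieField ρ η φ) :=
      mem_dom_familyDomain hφ (by simp) hp'
    have hev := (Continuous.prodMk_left p).tendsto (0 : ℝ) |>.eventually
      (((Reach.column E c).isOpen_dom hf.isOpen).mem_nhds hmem)
    have : (fun t : ℝ => T.Lren c (φ + t • lieField ρ η φ) p) =ᶠ[𝓝 0] fun _ => 0 := by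
      filter_upwards [hev] with t ht
      have hsub : {q | (t, q) ∈ familyDomain D O fun t : ℝ => φ + t • lieField ρ η φ} ⊆ D :=
        fun q hq => hq.1
      exact Lren_eq_zero (T := T.restrict hsub) hE (hf.isOpen_slice t) (hf.isField t)
        ((Reach.mem_dom_column (q := (t, p))).1 ht)
    exact this.deriv_eq.trans (deriv_const _ _)
  have h2 : lieForm η (T.Lren c φ) p = 0 := by
    refine (lieForm_congr ?_).trans (lieForm_zero η p)
    filter_upwards [(isOpen_columnSet hD).mem_nhds hp] with q hq using Lren_eq_zero hE hD hφ hq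
  change delta0 (T.Lren c) φ (lieField ρ η φ) p - lieForm η (T.Lren c φ) p = 0
  rw [h1, h2, sub_zero]

/-- The differential passes through the slice pullback and becomes a form of degree larger than the
dimension of the slice. -/
theorem extDeriv_finB (hE : Module.finrank ℝ E = n + 1) (hD : IsOpen D)
    {φ : E × ℝ → W} (hφ : IsField O D φ) {η : E × ℝ → E × ℝ} (hη : ContDiffOn ℝ ∞ η D)
    {p : E × ℝ} (hp : (p.1, c) ∈ D) : extDeriv (T.finB c η φ) p = 0 := by
  have h : ContDiffOn ℝ ∞ (fun q => (T.L φ q).curryLeft (η q)) D :=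
    ContDiffOn.contr (k := n + 2) hη (T.contDiffOn_L hD hφ)
  rw [finB_eq, slicePullback_extDeriv (ContDiffOn.differentiableAt_infty hD h hp),
    slicePullback_top hE]

theorem contDiffOn_finB (hD : IsOpen D) {φ : E × ℝ → W} (hφ : IsField O D φ)
    {η : E × ℝ → E × ℝ} (hη : ContDiffOn ℝ ∞ η D) :
    ContDiffOn ℝ ∞ (T.finB c η φ) {p | (p.1, c) ∈ D} :=
  ContDiffOn.slicePullback c (ContDiffOn.contr (k := n + 2) hη (T.contDiffOn_L hD hφ))

theorem contDiffOn_finLam (hD : IsOpen D) {φ Y : E × ℝ → W} (hφ : IsField O D φ)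
    (hY : ContDiffOn ℝ ∞ Y D) {η : E × ℝ → E × ℝ} (hη : ContDiffOn ℝ ∞ η D) {S : Set (E × ℝ)}
    (hS : ∀ p ∈ S, (p.1, c) ∈ D) (hηS : ContDiffOn ℝ ∞ η S) :
    ContDiffOn ℝ ∞ (T.finLam c η φ Y) S := by
  have hθ := T.contDiffOn_θ hD hφ hY
  have : T.finLam c η φ Y = fun p => _ := funext (T.finLam_eq c η φ Y)
  rw [this]
  exact ((ContDiffOn.slicePullback c (ContDiffOn.contr (k := n + 1) hη hθ)).mono hS).neg.add
    (ContDiffOn.contr (k := n + 1) hηS ((ContDiffOn.slicePullback c hθ).mono hS))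

theorem pull_finLam (η : E × ℝ → E × ℝ) (φ Y : E × ℝ → W) (υ : ℝ) :
    pull υ (T.finLam c η φ Y) = fun x =>
      -pull c (fun q => (T.θ φ Y q).curryLeft (η q)) x
        + (pull c (T.θ φ Y) x).curryLeft (η (x, υ)).1 := by
  funext x
  have h1 : (liftL E (n + 1) (pullL E (n + 1) (T.θ φ Y (x, c)))).curryLeft (η (x, υ)) =
      liftL E n ((pullL E (n + 1) (T.θ φ Y (x, c))).curryLeft (η (x, υ)).1) :=
    contr_liftL (k := n + 1) _ _
  rw [pull_eq_pullL, finLam_eq, map_add, map_neg, slicePullback_apply, slicePullback_apply,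
    pullL_liftL, h1, pullL_liftL]
  rfl

/-- The variation of the finite part of the anomaly of `B`, pulled back to a slice, on solutions. -/
theorem delta0_pull_finB (hD : IsOpen D) (hO : IsOpen O) {φ Y : E × ℝ → W} (hφ : T.IsSolution φ)
    (hY : ContDiffOn ℝ ∞ Y D) (η : E × ℝ → E × ℝ) (υ : ℝ) {x : E} (hx : (x, c) ∈ D) :
    delta0 (fun χ => pull υ (T.finB c η χ)) φ Y x =
      pullL E (n + 1) ((extDeriv (T.θ φ Y) (x, c)).curryLeft (η (x, c))) := by
  have h := (pullL E (n + 1)).hasFDerivAt.comp_hasDerivAt (0 : ℝ)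
    (hasDerivAt_finB (T := T) (p := (x, υ)) hD hO hφ.1 hY η hx)
  refine h.deriv.trans ?_
  rw [slicePullback_apply, pullL_liftL, T.delta0_L_of_eom hD hφ hY hx]

/-- Pullback to a fixed slice is a continuous linear map on values, so it commutes with all
field-space derivatives; covariance of `θ'` does the rest. The result involves the full `ξ` at the
slice `c`, including its normal component there. -/
theorem IsCovariant.lieFieldSpace1_pull_θ [CompleteSpace W] (hT : T.IsCovariant ρ) (hD : IsOpen D)
    (hO : IsOpen O) {φ Y : E × ℝ → W} (hφ : IsField O D φ) (hY : ContDiffOn ℝ ∞ Y D)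
    {η : E × ℝ → E × ℝ} (hη : ContDiffOn ℝ ∞ η D) {x : E} (hx : (x, c) ∈ D) :
    lieFieldSpace1 (hat ρ fun _ => η) (fun χ Z => pull c (T.θ χ Z)) φ Y x =
      pullL E (n + 1) (lieForm η (T.θ φ Y) (x, c)) := by
  have hθ := T.isOneForm_θ (Reach.point _)
  have hx' : (x, c) ∈ (Reach.point (E × ℝ)).core D := by rwa [Reach.core_point]
  have hX := ContDiffOn.lieField ρ hD hη hφ.1
  have hηs : SmoothFunctional (Reach.point _) D O fun _ : E × ℝ → W => η :=
    SmoothFunctional.of_contDiffOn hη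
  have d0 : ∀ {f : ℝ → (E × ℝ) [⋀^Fin (n + 1)]→L[ℝ] ℝ} {f'}, HasDerivAt f f' 0 →
      deriv (fun t => pullL E (n + 1) (f t)) 0 = pullL E (n + 1) (deriv f 0) := fun h =>
    ((pullL E (n + 1)).hasFDerivAt.comp_hasDerivAt (0 : ℝ) h).deriv.trans
      (congrArg _ h.deriv.symm)
  have h1 := d0 ((hθ.smoothFunctional hY).hasDerivAt hD hO hφ hX hx')
  have h2 := d0 ((hθ.smoothFunctional hX).hasDerivAt hD hO hφ hY hx')
  have h3 := d0 (hθ.hasDerivAt_hat ρ hηs hD hO hφ hY hx')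
  have h4 : iDeltaHat ρ (fun _ : E × ℝ → W => η) T.θ φ Y (x, c) = 0 := by
    rw [iDeltaHat, delta0_const, lieField_zero]
    exact hθ.map_zero hD hφ hx'
  have h5 : lieFieldSpace1 (hat ρ fun _ => η) T.θ φ Y (x, c) = lieForm η (T.θ φ Y) (x, c) := by
    have := (hT D Subset.rfl hD φ hφ η hη).2 Y hY _ hx
    rw [anomaly1, h4, sub_zero] at this
    exact sub_eq_zero.1 this
  rw [← h5]
  simp only [lieFieldSpace1, delta1, delta0, map_add, map_sub]
  exact congrArg₂ _ (congrArg₂ _ h1 h2) h3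

/-- The anomaly of the symplectic potential on the boundary. -/
theorem IsCovariant.boundaryAnomaly_θ [CompleteSpace W] (hT : T.IsCovariant ρ)
    (hE : Module.finrank ℝ E = n + 1) (hD : IsOpen D)
    (hO : IsOpen O) {φ Y : E × ℝ → W} (hφ : T.IsSolution φ) (hY : ContDiffOn ℝ ∞ Y D)
    {η : E × ℝ → E × ℝ} (hη : ContDiffOn ℝ ∞ η D) {x : E} (hx : (x, c) ∈ D)
    (h0 : DifferentiableAt ℝ (fun y => (η (y, 0)).1) x) :
    boundaryAnomaly1 ρ (fun _ => η) (fun χ Z => pull c (T.θ χ Z)) φ Y x =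
      delta0 (fun χ => pull 0 (T.finB c η χ)) φ Y x
        - extDeriv (pull 0 (T.finLam c η φ Y)) x := by
  have hθc := T.contDiffOn_θ hD hφ.1 hY
  have hθ := ContDiffOn.differentiableAt_infty hD hθc hx
  have hiθ := ContDiffOn.differentiableAt_infty hD (ContDiffOn.contr (k := n + 1) hη hθc) hx
  have hslice : HasFDerivAt (fun y : E => (y, c)) (ContinuousLinearMap.inl ℝ E ℝ) x :=
    hasFDerivAt_prodMk_left x c
  have dθ : DifferentiableAt ℝ (pull c (T.θ φ Y)) x :=
    (pullL E (n + 1)).differentiableAt.comp x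
      (hθ.comp (f := fun y : E => (y, c)) x hslice.differentiableAt)
  have diθ : DifferentiableAt ℝ (pull c fun q => (T.θ φ Y q).curryLeft (η q)) x :=
    (pullL E n).differentiableAt.comp x
      (hiθ.comp (f := fun y : E => (y, c)) x hslice.differentiableAt)
  have hL : DifferentiableAt ℝ (F := (E [⋀^Fin (n + 1)]→L[ℝ] ℝ) →L[ℝ] E [⋀^Fin n]→L[ℝ] ℝ)
      (fun w => curryL n w) (η (x, 0)).1 := ContinuousLinearMap.differentiableAt _
  have hLη : DifferentiableAt ℝ (F := (E [⋀^Fin (n + 1)]→L[ℝ] ℝ) →L[ℝ] E [⋀^Fin n]→L[ℝ] ℝ)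
      (fun y => curryL n (η (y, 0)).1) x :=
    DifferentiableAt.comp (𝕜 := ℝ) (G := (E [⋀^Fin (n + 1)]→L[ℝ] ℝ) →L[ℝ] E [⋀^Fin n]→L[ℝ] ℝ)
      x hL h0
  have dc : DifferentiableAt ℝ (fun y => (pull c (T.θ φ Y) y).curryLeft (η (y, 0)).1) x :=
    hLη.clm_apply dθ
  have h1 : iDeltaHat ρ (fun _ : E × ℝ → W => η) (fun χ Z => pull c (T.θ χ Z)) φ Y x = 0 := by
    have hx' : (x, c) ∈ (Reach.point (E × ℝ)).core D := by rwa [Reach.core_point]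
    rw [iDeltaHat, delta0_const, lieField_zero, pull_eq_pullL,
      (T.isOneForm_θ (Reach.point _)).map_zero hD hφ.1 hx', map_zero]
  -- The pullback of `θ'` has top degree on the boundary. Its Lie derivative along the boundary
  -- vector field is thus exact, and supplies the part of `d (Δ_ξ̂ Λ)_fin` that involves `ξ` at `Φ =
  -- 0`.
  have h2 : extDeriv (pull c (T.θ φ Y)) x = 0 := form_eq_zero_of_finrank_lt (by omega) _
  have h3 : extDeriv (pull 0 (T.finLam c η φ Y)) x =
      -extDeriv (pull c fun q => (T.θ φ Y q).curryLeft (η q)) x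
        + extDeriv (fun y => (pull c (T.θ φ Y) y).curryLeft (η (y, 0)).1) x := by
    rw [pull_finLam]
    refine (extDerivPred_add (k := n + 1) diθ.neg dc).trans ?_
    exact congrArg (· + _) (extDerivPred_neg (k := n + 1) _ x)
  have h4 : pullL E (n + 1) (lieForm η (T.θ φ Y) (x, c)) =
      pullL E (n + 1) ((extDeriv (T.θ φ Y) (x, c)).curryLeft (η (x, c)))
        + extDeriv (pull c fun q => (T.θ φ Y q).curryLeft (η q)) x := by
    rw [lieForm_apply, map_add]
    exact congrArg _ (pullL_extDerivPred (k := n + 1) hiθ)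
  have h5 : lieForm (fun y => (η (y, 0)).1) (pull c (T.θ φ Y)) x =
      extDeriv (fun y => (pull c (T.θ φ Y) y).curryLeft (η (y, 0)).1) x := by
    rw [lieForm_apply, h2]
    exact zero_add _
  rw [boundaryAnomaly1, hT.lieFieldSpace1_pull_θ hD hO hφ.1 hY hη hx, h1, h3, h4, h5,
    delta0_pull_finB hD hO hφ hY η 0 hx]
  abel

end Theory

end HoloRen

end

/-! ### Assembly of the theorem on the collar -/

theorem mainTheorem8
    {E W : Type*} [NormedAddCommGroup E] [NormedSpace ℝ E] [FiniteDimensional ℝ E]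
    [NormedAddCommGroup W] [NormedSpace ℝ W] [FiniteDimensional ℝ W]
    (n : ℕ) (hE : Module.finrank ℝ E = n + 1)
    (N : Set E) (hN : IsOpen N) (b υ₀ : ℝ) (hυ₀ : 0 < υ₀) (hb : υ₀ < b)
    (ρ : TensorRep (E × ℝ) W) (O : Set W) (hO : IsOpen O)
    (T : Theory n (collar N b) O) (hT : T.IsCovariant ρ) :
    -- the forms below are differentiable on the collar and along variations of the field, so that
    -- all derivatives are genuine
    (∀ φ, IsField O (collar N b) φ →
      ∀ Y, ContDiffOn ℝ ∞ Y (collar N b) → ∀ X, ContDiffOn ℝ ∞ X (collar N b) →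
      ∀ ξ : (E × ℝ → W) → E × ℝ → E × ℝ, IsSmoothLocal (collar N b) O ξ →
      ∀ p ∈ collar N b,
        DifferentiableAt ℝ (T.B υ₀ φ) p ∧ DifferentiableAt ℝ (T.Lam υ₀ φ Y) p ∧
        DifferentiableAt ℝ (T.kappa υ₀ (ξ φ) φ) p ∧ DifferentiableAt ℝ (T.mu υ₀ (ξ φ) φ Y) p ∧
        DifferentiableAt ℝ (T.θren υ₀ φ Y) p ∧
        DifferentiableAt ℝ (fun t : ℝ => T.B υ₀ (φ + t • Y) p) 0 ∧
        DifferentiableAt ℝ (fun t : ℝ => T.Lam υ₀ (φ + t • Y) X p) 0 ∧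
        DifferentiableAt ℝ
          (fun t : ℝ => T.Lam υ₀ (φ + t • Y) (hat ρ ξ (φ + t • Y)) p) 0 ∧
        DifferentiableAt ℝ (fun t : ℝ => T.θren υ₀ (φ + t • Y) X p) 0 ∧
        DifferentiableAt ℝ (fun t : ℝ => T.kappa υ₀ (ξ (φ + t • Y)) (φ + t • Y) p) 0) ∧
    -- the anomalies of `B` and `Λ`, for possibly field-dependent `ξ`
    (∀ ξ : (E × ℝ → W) → E × ℝ → E × ℝ, IsSmoothLocal (collar N b) O ξ →
      ∀ φ, IsField O (collar N b) φ → IsBoundaryVectorField N b (ξ φ) →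
        ContDiffOn ℝ ∞ (T.finB υ₀ (ξ φ) φ) (closedCollar N b) ∧
        (∀ p ∈ collar N b,
          anomaly0 ρ ξ (T.B υ₀) φ p =
            T.finB υ₀ (ξ φ) φ p + extDeriv (T.kappa υ₀ (ξ φ) φ) p) ∧
        ∀ Y, ContDiffOn ℝ ∞ Y (collar N b) →
          ContDiffOn ℝ ∞ (T.finLam υ₀ (ξ φ) φ Y) (closedCollar N b) ∧
          (T.IsSolution φ → ∀ p ∈ collar N b,
            anomaly1 ρ ξ (T.Lam υ₀) φ Y p =
              T.finLam υ₀ (ξ φ) φ Y p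
                + delta0 (fun χ => T.kappa υ₀ (ξ χ) χ) φ Y p
                - extDerivPred (T.mu υ₀ (ξ φ) φ Y) p
                - T.kappa υ₀ (delta0 ξ φ Y) φ p)) ∧
    -- field-independent `ξ`
    (∀ ξ : E × ℝ → E × ℝ, IsBoundaryVectorField N b ξ → ∀ φ, T.IsSolution φ →
      ∀ Y, ContDiffOn ℝ ∞ Y (collar N b) →
        (∀ p ∈ collar N b,
          anomaly1 ρ (fun _ => ξ) (T.Lam υ₀) φ Y p =
            T.finLam υ₀ ξ φ Y p + delta0 (T.kappa υ₀ ξ) φ Y p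
              - extDerivPred (T.mu υ₀ ξ φ Y) p
              - iDeltaHat ρ (fun _ => ξ) (T.Lam υ₀) φ Y p) ∧
        (∀ p ∈ collar N b,
          anomaly0 ρ (fun _ => ξ) (T.Lren υ₀) φ p = extDeriv (T.finB υ₀ ξ φ) p) ∧
        (∀ p ∈ collar N b,
          anomaly1 ρ (fun _ => ξ) (T.θren υ₀) φ Y p =
            delta0 (T.finB υ₀ ξ) φ Y p - extDeriv (T.finLam υ₀ ξ φ Y) p) ∧
        -- the pullback to the boundary: finiteness of the two terms on the right-hand side ...
        ContDiffOn ℝ ∞ (fun x => delta0 (fun χ => pull 0 (T.finB υ₀ ξ χ)) φ Y x) N ∧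
        ContDiffOn ℝ ∞ (pull 0 (T.finB υ₀ ξ φ)) N ∧
        ContDiffOn ℝ ∞ (pull 0 (T.finLam υ₀ ξ φ Y)) N ∧
        -- ... the limit of the pullbacks of `θ'_ren`, and the anomaly of this limit ...
        (∀ x ∈ N, Tendsto (fun υ => pull υ (T.θren υ₀ φ Y) x) (𝓝[>] 0)
          (𝓝 (pull υ₀ (T.θ φ Y) x))) ∧
        (∀ x ∈ N,
          boundaryAnomaly1 ρ (fun _ => ξ) (fun χ Z => pull υ₀ (T.θ χ Z)) φ Y x =
            delta0 (fun χ => pull 0 (T.finB υ₀ ξ χ)) φ Y x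
              - extDeriv (pull 0 (T.finLam υ₀ ξ φ Y)) x) ∧
        -- ... and the limit of the pullbacks of the anomaly of `θ'_ren`
        (∀ x ∈ N, Tendsto (fun υ => pull υ (anomaly1 ρ (fun _ => ξ) (T.θren υ₀) φ Y) x) (𝓝[>] 0)
          (𝓝 (delta0 (fun χ => pull 0 (T.finB υ₀ ξ χ)) φ Y x
              - extDeriv (pull 0 (T.finLam υ₀ ξ φ Y)) x)))) := by
  have hD : IsOpen (collar N b) := isOpen_collar hN
  have hcol : ∀ {p}, p ∈ collar N b → p ∈ columnSet υ₀ (collar N b) :=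
    fun hp => mem_columnSet_collar hυ₀ hb hp
  -- The interval `(0, b)` is convex and contains `υ₀`, so every column to the slice stays inside
  -- the collar and no point is lost to the column condition.
  have hC : columnSet υ₀ (collar N b) = collar N b := Subset.antisymm columnSet_subset fun _ => hcol
  have hcore : (Reach.column E υ₀).core (collar N b) = collar N b := by rw [Reach.core_column, hC]
  have hslice : ∀ {x : E}, x ∈ N → (x, υ₀) ∈ collar N b := fun hx => ⟨hx, hυ₀, hb⟩
  have h0b : 0 < b := hυ₀.trans hb
  refine ⟨fun φ hφ Y hY X hX ξ hξ p hp => ?_, fun ξ hξ φ hφ hξφ => ?_,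
    fun ξ hξ φ hφ Y hY => ?_⟩
  · have hξs := hξ.smoothFunctional (Reach.point (E × ℝ))
    have hη : ContDiffOn ℝ ∞ (ξ φ) (collar N b) := by
      simpa only [Reach.core_point] using hξs.contDiffOn hD hφ
    have hp' : p ∈ (Reach.column E υ₀).core (collar N b) := by rwa [hcore]
    have hB := T.smoothFunctional_B υ₀
    have hΛ := T.isOneForm_Lam υ₀
    have hκ := T.smoothFunctional_kappa υ₀ hξs
    have hθ := T.isOneForm_θren υ₀ hO
    have hμ := T.contDiffOn_mu υ₀ hD hη hφ hY
    exact ⟨hB.differentiableAt hD hφ hp', (hΛ.smoothFunctional hY).differentiableAt hD hφ hp',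
      hκ.differentiableAt hD hφ hp',
      ContDiffOn.differentiableAt_infty (isOpen_columnSet hD) hμ (hcol hp),
      (hθ.smoothFunctional hY).differentiableAt hD hφ hp',
      (hB.hasDerivAt hD hO hφ hY hp').differentiableAt,
      ((hΛ.smoothFunctional hX).hasDerivAt hD hO hφ hY hp').differentiableAt,
      (hΛ.hasDerivAt_hat ρ hξs hD hO hφ hY hp').differentiableAt,
      ((hθ.smoothFunctional hX).hasDerivAt hD hO hφ hY hp').differentiableAt,
      (hκ.hasDerivAt hD hO hφ hY hp').differentiableAt⟩
  · have hξs := hξ.smoothFunctional (Reach.point (E × ℝ))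
    have hη := hξφ.smooth.mono collar_subset_closedCollar
    have hS : ∀ p ∈ closedCollar N b, (p.1, υ₀) ∈ collar N b := fun p hp => hslice hp.1
    refine ⟨(Theory.contDiffOn_finB hD hφ hη).mono hS, fun p hp => hT.variation_B hE hD hO hφ hη (hcol hp),
      fun Y hY => ⟨Theory.contDiffOn_finLam hD hφ hY hη hS hξφ.smooth, fun hsol p hp =>
        hT.anomaly_Lam hD hO hsol hY hξs (hcol hp)⟩⟩
  · have hη := hξ.smooth.mono collar_subset_closedCollar
    have hηs : SmoothFunctional (Reach.point _) (collar N b) O fun _ : E × ℝ → W => ξ :=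
      SmoothFunctional.of_contDiffOn hη
    have hS : ∀ p ∈ closedCollar N b, (p.1, υ₀) ∈ collar N b := fun p hp => hslice hp.1
    have hfinB : ContDiffOn ℝ ∞ (T.finB υ₀ ξ φ) (closedCollar N b) :=
      (Theory.contDiffOn_finB hD hφ.1 hη).mono hS
    have hfinΛ : ContDiffOn ℝ ∞ (T.finLam υ₀ ξ φ Y) (closedCollar N b) :=
      Theory.contDiffOn_finLam hD hφ.1 hY hη hS hξ.smooth
    have hθ := T.contDiffOn_θ hD hφ.1 hY
    have hθren : ∀ p ∈ collar N b, anomaly1 ρ (fun _ => ξ) (T.θren υ₀) φ Y p =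
        delta0 (T.finB υ₀ ξ) φ Y p - extDeriv (T.finLam υ₀ ξ φ Y) p :=
      fun p hp => hT.anomaly_θren hE hD hO hφ hY hη (hcol hp)
    have hδ : ∀ υ, ∀ x ∈ N, delta0 (fun χ => pull υ (T.finB υ₀ ξ χ)) φ Y x =
        pullL E (n + 1) ((extDeriv (T.θ φ Y) (x, υ₀)).curryLeft (ξ (x, υ₀))) :=
      fun υ x hx => Theory.delta0_pull_finB hD hO hφ hY ξ υ (hslice hx)
    refine ⟨fun p hp => ?_, fun p hp => ?_, hθren, ?_, hfinB.pull ⟨le_rfl, h0b⟩,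
      hfinΛ.pull ⟨le_rfl, h0b⟩, fun x hx => ?_, fun x hx => ?_, fun x hx => ?_⟩
    · have h1 : T.kappa υ₀ (delta0 (fun _ : E × ℝ → W => ξ) φ Y) φ p = 0 := by
        rw [delta0_const]
        exact kappaMu_zero_field (k := n + 1) _ p
      have h2 : iDeltaHat ρ (fun _ : E × ℝ → W => ξ) (T.Lam υ₀) φ Y p = 0 := by
        rw [iDeltaHat, delta0_const, lieField_zero]
        exact (T.isOneForm_Lam υ₀).map_zero hD hφ.1 (by rwa [hcore])
      have h3 := hT.anomaly_Lam hD hO hφ hY hηs (hcol hp)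
      rw [h1] at h3
      rw [h3, h2]
    · rw [Theory.anomaly_Lren hE hD hO hφ.1 hη (hcol hp), Theory.extDeriv_finB hE hD hφ.1 hη (hslice hp.1)]
    · have h : ContDiffOn ℝ ∞ (fun q => (extDeriv (T.θ φ Y) q).curryLeft (ξ q)) (collar N b) :=
        ContDiffOn.contr (k := n + 2) hη (ContDiffOn.extDeriv hD hθ)
      exact ((pullL E (n + 1)).contDiff.comp_contDiffOn (h.comp
        (contDiff_prodMk_left υ₀).contDiffOn fun _ hx => hslice hx)).congr fun x hx => hδ 0 x hx
    -- On solutions `θ'_ren` is pulled back from the slice `υ₀`, so the function of `υ` is constant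
    -- on `(0, b)`.
    · refine tendsto_const_nhds.congr' ?_
      filter_upwards [Ioo_mem_nhdsGT h0b] with υ hυ
      rw [pull_eq_pullL, pull_eq_pullL, Theory.θren_eq hD hO hφ hY (hcol ⟨hx, hυ⟩), slicePullback_apply,
        pullL_liftL]
    · refine hT.boundaryAnomaly_θ hE hD hO hφ hY hη (hslice hx) ?_
      have h : ContDiffOn ℝ ∞ (fun y : E => (ξ (y, 0)).1) N :=
        contDiff_fst.comp_contDiffOn (hξ.smooth.comp (contDiff_prodMk_left 0).contDiffOn
          fun y hy => ⟨hy, le_rfl, h0b⟩)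
      exact ContDiffOn.differentiableAt_infty hN h hx
    -- The pullback of `δ (Δ_ξ̂ B)_fin` does not depend on `υ`. Only the second term moves, and it
    -- converges because `finLam` is smooth up to the boundary.
    · refine (tendsto_const_nhds.sub (tendsto_extDeriv_pull hN h0b hfinΛ hx)).congr' ?_
      filter_upwards [Ioo_mem_nhdsGT h0b] with υ hυ
      have hυx : (x, υ) ∈ collar N b := ⟨hx, hυ⟩
      have hd : DifferentiableAt ℝ (T.finLam υ₀ ξ φ Y) (x, υ) :=
        ContDiffOn.differentiableAt_infty hD (hfinΛ.mono collar_subset_closedCollar) hυx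
      have h1 : pullL E (n + 1) (delta0 (T.finB υ₀ ξ) φ Y (x, υ)) =
          delta0 (fun χ => pull 0 (T.finB υ₀ ξ χ)) φ Y x := by
        rw [hδ 0 x hx, ← hδ υ x hx]
        exact ((pullL E (n + 1)).hasFDerivAt.comp_hasDerivAt (0 : ℝ)
          (Theory.hasDerivAt_finB (T := T) (p := (x, υ)) hD hO hφ.1 hY ξ
            (hslice hx)).differentiableAt.hasDerivAt).deriv.symm
      rw [pull_eq_pullL, hθren _ hυx, map_sub, h1]
      exact congrArg _ (pullL_extDerivPred (k := n + 1) hd).symm
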